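/- Let $X$ be a compact complex manifold (Hausdorff, of pure dimension $n$, not necessarily connected) with sheaf of holomorphic functions $\mathcal O_X$. Let $D=D_1\cup\dots\cup D_N$ be a reduced divisor with simple normal crossings in $X$: the branches $D_1,\dots,D_N$ are closed subsets of $X$, and around every point $x\in X$ there are holomorphic coordinates $(z_1,\dots,z_n)$ in which the $D_i$ passing through $x$ are the zero sets of pairwise distinct coordinate functions. Put $D_{ij}=D_i\cap D_j$. For a closed analytic subset $Z\subseteq X$, let $G_Z(X)$ be the Grothendieck group of the category of coherent sheaves of $\mathcal O_X$-modules with support in $Z$, that is, the free abelian group on these sheaves modulo the relations $[\mathcal G]=[\mathcal F]+[\mathcal H]$ for all exact sequences $0\to\mathcal F\to\mathcal G\to\mathcal H\to 0$ of such sheaves; for $Z\subseteq W$ there is a canonical map $G_Z(X)\to G_W(X)$, $[\mathcal F]\mapsto[\mathcal F]$. Then the sequence $$\bigoplus_{i<j}G_{D_{ij}}(X)\longrightarrow\bigoplus_i G_{D_i}(X)\longrightarrow G_D(X)\longrightarrow 0$$ is exact, where the first map sends an element $x$ of the summand $G_{D_{ij}}(X)$ to the image of $x$ in $G_{D_i}(X)$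 minus the image of $x$ in $G_{D_j}(X)$, and the second map is the sum of the canonical maps $G_{D_i}(X)\to G_D(X)$. -/

import Mathlib

open CategoryTheory TopologicalSpace Opposite
open scoped Manifold ContDiff DirectSum

noncomputable section

namespace AnalyticK

section Grothendieck

universe v u

variable {C : Type u} [Category.{v} C] [Abelian C]

/-- The relations `[S.X₁] + [S.X₃] - [S.X₂]` attached to the short exact sequences
`0 ⟶ S.X₁ ⟶ S.X₂ ⟶ S.X₃ ⟶ 0` whose three terms satisfy `P`. -/
def relations (P : ObjectProperty C) : Set (FreeAbelianGroup P.FullSubcategory) :=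
  {r | ∃ (S : ShortComplex C) (_ : S.ShortExact) (h₁ : P S.X₁) (h₂ : P S.X₂) (h₃ : P S.X₃),
    r = FreeAbelianGroup.of ⟨S.X₁, h₁⟩ + FreeAbelianGroup.of ⟨S.X₃, h₃⟩
      - FreeAbelianGroup.of ⟨S.X₂, h₂⟩}

/-- The Grothendieck group of the objects of an abelian category satisfying `P`: the free abelian
group on these objects modulo the relations given by short exact sequences. -/
abbrev K0 (P : ObjectProperty C) : Type u :=
  FreeAbelianGroup P.FullSubcategory ⧸ AddSubgroup.closure (relations P)

/-- The class `[F]` of an object. -/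
def K0.cls (P : ObjectProperty C) (F : P.FullSubcategory) : K0 P :=
  QuotientAddGroup.mk' (AddSubgroup.closure (relations P)) (FreeAbelianGroup.of F)

/-- The homomorphism `[F] ↦ [F]` induced by an inclusion of classes of objects. -/
def K0.map {P Q : ObjectProperty C} (h : P ≤ Q) : K0 P →+ K0 Q :=
  QuotientAddGroup.map _ _
    (FreeAbelianGroup.map fun F : P.FullSubcategory ↦ (⟨F.obj, h _ F.property⟩ : Q.FullSubcategory))
    (by
      rw [AddSubgroup.closure_le]
      rintro _ ⟨S, hS, h₁, h₂, h₃, rfl⟩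
      refine AddSubgroup.subset_closure ⟨S, hS, h _ h₁, h _ h₂, h _ h₃, ?_⟩
      simp)

lemma K0.map_cls {P Q : ObjectProperty C} (h : P ≤ Q) (F : P.FullSubcategory) :
    K0.map h (K0.cls P F) = K0.cls Q ⟨F.obj, h _ F.property⟩ := by
  simp [K0.map, K0.cls]

end Grothendieck

section Coherent

variable {X : TopCat.{0}} {R : Sheaf (Opens.grothendieckTopology X) RingCat.{0}}

/-- Restriction of sections of the sheaf of rings. -/
def resR (R : Sheaf (Opens.grothendieckTopology X) RingCat.{0}) {U V : Opens X} (h : V ≤ U) :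
    R.obj.obj (op U) →+* R.obj.obj (op V) :=
  (R.obj.map (homOfLE h).op).hom

/-- Restriction of sections of a sheaf of modules. -/
def resM (F : SheafOfModules.{0} R) {U V : Opens X} (h : V ≤ U) :
    F.val.obj (op U) →ₛₗ[resR R h] F.val.obj (op V) :=
  F.val.restrictₛₗ (homOfLE h).op

/-- `F` is of finite type: every point has an open neighbourhood `U` with finitely many sections
over `U` of which every section of `F` over an open subset of `U` is, locally, a linear
combination. -/
def IsFiniteType (F : SheafOfModules.{0} R) : Prop :=
  ∀ x : X, ∃ (U : Opens X) (_ : x ∈ U) (n : ℕ) (s : Fin n → F.val.obj (op U)),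
    ∀ (V : Opens X) (hV : V ≤ U) (t : F.val.obj (op V)), ∀ y ∈ V,
      ∃ (W : Opens X) (hW : W ≤ V) (_ : y ∈ W) (c : Fin n → R.obj.obj (op W)),
        resM F hW t = ∑ i, c i • resM F (hW.trans hV) (s i)

/-- For all open `U` and all finite families `s` of sections of `F` over `U`, the sheaf of relations
between the `s i`, that is the kernel of the morphism `R|_U ^ n ⟶ F|_U` defined by `s`, is of finite
type: near every point of `U` it is generated by finitely many relations `r j`. -/
def HasFiniteTypeRelations (F : SheafOfModules.{0} R) : Prop :=
  ∀ (U : Opens X) (n : ℕ) (s : Fin n → F.val.obj (op U)), ∀ x ∈ U,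
    ∃ (V : Opens X) (hV : V ≤ U) (_ : x ∈ V) (m : ℕ) (r : Fin m → Fin n → R.obj.obj (op V)),
      (∀ j, ∑ i, r j i • resM F hV (s i) = 0) ∧
      ∀ (W : Opens X) (hW : W ≤ V) (c : Fin n → R.obj.obj (op W)),
        ∑ i, c i • resM F (hW.trans hV) (s i) = 0 → ∀ y ∈ W,
          ∃ (W' : Opens X) (hW' : W' ≤ W) (_ : y ∈ W') (d : Fin m → R.obj.obj (op W')),
            ∀ i, resR R hW' (c i) = ∑ j, d j * resR R (hW'.trans hW) (r j i)

/-- Coherent sheaves of modules. -/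
def IsCoherent (F : SheafOfModules.{0} R) : Prop :=
  IsFiniteType F ∧ HasFiniteTypeRelations F

/-- The support of `F`: the set of points where the stalk of `F` is not zero. -/
def support (F : SheafOfModules.{0} R) : Set X :=
  {x | Nontrivial (TopCat.Presheaf.stalk (C := AddCommGrpCat.{0}) (X := X) F.val.presheaf x)}

/-- The coherent sheaves of `R`-modules with support in `Z`. -/
def cohWithSupport (R : Sheaf (Opens.grothendieckTopology X) RingCat.{0}) (Z : Set X) :
    ObjectProperty (SheafOfModules.{0} R) :=
  fun F ↦ IsCoherent F ∧ support F ⊆ Z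

lemma cohWithSupport_mono (R : Sheaf (Opens.grothendieckTopology X) RingCat.{0}) {Z W : Set X} (h : Z ⊆ W) :
    cohWithSupport R Z ≤ cohWithSupport R W :=
  fun _ hF ↦ ⟨hF.1, hF.2.trans h⟩

end Coherent

section Manifold

variable (n : ℕ) (X : Type) [TopologicalSpace X] [ChartedSpace (EuclideanSpace ℂ (Fin n)) X]

/-- The sheaf of rings `𝒪_X` of holomorphic functions on an `n`-dimensional complex manifold `X`:
over `ℂ`, the `C^∞` functions are the holomorphic ones. -/
def holSheaf : Sheaf (Opens.grothendieckTopology (TopCat.of X)) RingCat.{0} :=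
  (sheafCompose _ (forget₂ CommRingCat.{0} RingCat.{0})).obj
    (smoothSheafCommRing 𝓘(ℂ, EuclideanSpace ℂ (Fin n)) 𝓘(ℂ) X ℂ)

/-- `G_Z(X)`: the Grothendieck group of the category of coherent analytic sheaves on `X` with
support in `Z`. -/
abbrev G (Z : Set X) : Type 1 := K0 (cohWithSupport (holSheaf n X) Z)

variable {X}

/-- The canonical map `G_Z(X) → G_W(X)` for `Z ⊆ W`. -/
def G.map {Z W : Set X} (h : Z ⊆ W) : G n X Z →+ G n X W :=
  K0.map (cohWithSupport_mono (holSheaf n X) h)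

/-- `D 0, …, D (N - 1)` are smooth hypersurfaces crossing normally: they are closed subsets of `X`,
and around every point `x` there are holomorphic coordinates in which the `D i` passing through `x`
are given by the vanishing of pairwise distinct coordinates. -/
def IsSimpleNormalCrossing {N : ℕ} (D : Fin N → Set X) : Prop :=
  (∀ i, IsClosed (D i)) ∧
  ∀ x : X, ∃ φ ∈ IsManifold.maximalAtlas 𝓘(ℂ, EuclideanSpace ℂ (Fin n)) ω X, x ∈ φ.source ∧
    ∃ k : {i // x ∈ D i} → Fin n, Function.Injective k ∧
      ∀ i, ∀ y ∈ φ.source, y ∈ D i.1 ↔ φ y (k i) = 0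

variable {N : ℕ} (D : Fin N → Set X)

/-- The map `⨁_{i<j} G_{D_i ∩ D_j}(X) → ⨁_i G_{D_i}(X)` sending `x` in the `(i, j)` summand to `x` in
the `i`-th summand minus `x` in the `j`-th summand. -/
def pairsToBranches :
    (⨁ p : {p : Fin N × Fin N // p.1 < p.2}, G n X (D p.1.1 ∩ D p.1.2)) →+ ⨁ i, G n X (D i) :=
  DirectSum.toAddMonoid fun p ↦
    (DirectSum.of (fun i ↦ G n X (D i)) p.1.1).comp (G.map n Set.inter_subset_left) -
      (DirectSum.of (fun i ↦ G n X (D i)) p.1.2).comp (G.map n Set.inter_subset_right)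

/-- The canonical map `⨁_i G_{D_i}(X) → G_D(X)`, where `D` is the union of the `D_i`. -/
def branchesToDivisor : (⨁ i, G n X (D i)) →+ G n X (⋃ i, D i) :=
  DirectSum.toAddMonoid fun i ↦ G.map n (Set.subset_iUnion D i)

end Manifold

end AnalyticK

end

/-! Let C be the cokernel of the first map. The sum of the canonical maps kills the image of the
first map, so it induces C → G_D(X), and exactness amounts to a left inverse of this map. A coherent
sheaf with support in D has a finite filtration whose graded pieces are coherent with support in
single branches. The inverse sends [F] to the sum in C of the classes of the pieces.

This sum does not depend on the filtration. As in the Schreier refinement theorem, two filtrations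
have a common refinement (`exists_refinement`, `Dev.split`); classes in each G_{D_i}(X) are additive
under refinement; and a piece supported in both D_i and D_j is supported in D_ij, so that its two
classes agree in C (`toCoker_eq`). Hence `Dev.unique`, which also gives additivity of F ↦ sum.
Surjectivity of the second map is read off from the filtration (`exact_of_devissage`).

For the existence of the filtration, let e_i be a local generator of the ideal J_i of functions
vanishing on D_i. The product of the e_i vanishes on the support of F, so by the Nullstellensatz one
of its powers kills F near each point, and by compactness one exponent serves everywhere
(`exists_killedBy`). The subsheaf annihilated by J_i is locally the kernel of multiplication by e_i
on F, hence coherent as soon as F is; the quotient by it is killed by a shorter product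
(`exists_dev`). Coherence of the structure sheaf itself is never needed.

The Nullstellensatz for sheaves reduces to functions: the maximal minors of a local matrix of
generating relations annihilate F, and their common zeros lie in its support. For functions it is
deduced from Weierstrass division, by induction on the dimension (`zeros_of_regular`,
`primesHaveZeros`). Division is obtained by inverting an analytic family of operators on the disc
algebra, which rests on a Banach-valued Osgood lemma. Division by a coordinate also shows that the
J_i are locally principal. -/

noncomputable section

namespace AnalyticK

/-! ### Osgood's lemma for weakly holomorphic maps into Banach spaces. -/

section Osgood

open Set Metric Filter Topology

/-- The interval parametrising circles. -/
abbrev AngleInterval : Type := Set.Icc (0 : ℝ) (2 * Real.pi)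

/-- The projection of the line onto the interval of angles. -/
def toAngle (θ : ℝ) : AngleInterval := Set.projIcc 0 (2 * Real.pi) Real.two_pi_pos.le θ

lemma continuous_toAngle : Continuous toAngle :=
  continuous_projIcc (h := Real.two_pi_pos.le)

lemma toAngle_of_mem {θ : ℝ} (h : θ ∈ Set.Icc (0 : ℝ) (2 * Real.pi)) : (toAngle θ : ℝ) = θ := by
  rw [toAngle, Set.projIcc_of_mem _ h]

/-- The pairing `(k, φ) ↦ ∫ k φ` of continuous functions on the interval of angles. -/
def anglePairing (G : Type) [NormedAddCommGroup G] [NormedSpace ℂ G] :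
    C(AngleInterval, ℂ) →L[ℂ] C(AngleInterval, G) →L[ℂ] G :=
  LinearMap.mkContinuous₂
    (LinearMap.mk₂ ℂ (fun k φ ↦ ∫ θ in (0 : ℝ)..(2 * Real.pi), k (toAngle θ) • φ (toAngle θ))
      (fun k k' φ ↦ by
        simp only [ContinuousMap.add_apply, add_smul]
        apply intervalIntegral.integral_add <;>
          exact Continuous.intervalIntegrable
            ((map_continuous _ |>.comp continuous_toAngle).smul
              (map_continuous _ |>.comp continuous_toAngle)) _ _)
      (fun c k φ ↦ by
        simp only [ContinuousMap.smul_apply, smul_eq_mul, mul_smul]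
        exact intervalIntegral.integral_smul _ _)
      (fun k φ φ' ↦ by
        simp only [ContinuousMap.add_apply, smul_add]
        apply intervalIntegral.integral_add <;>
          exact Continuous.intervalIntegrable
            ((map_continuous _ |>.comp continuous_toAngle).smul
              (map_continuous _ |>.comp continuous_toAngle)) _ _)
      (fun c k φ ↦ by
        simp only [ContinuousMap.smul_apply, smul_comm _ c]
        exact intervalIntegral.integral_smul _ _))
    (2 * Real.pi) (fun k φ ↦ by
      have := intervalIntegral.norm_integral_le_of_norm_le_const (a := 0) (b := 2 * Real.pi)
        (f := fun θ ↦ k (toAngle θ) • φ (toAngle θ)) (C := ‖k‖ * ‖φ‖) (fun θ _ ↦ by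
          rw [norm_smul]
          exact mul_le_mul (k.norm_coe_le_norm _) (φ.norm_coe_le_norm _) (norm_nonneg _)
            (norm_nonneg _))
      rw [sub_zero, abs_of_pos Real.two_pi_pos] at this
      simp only [LinearMap.mk₂_apply]
      linarith)

lemma anglePairing_apply (G : Type) [NormedAddCommGroup G] [NormedSpace ℂ G]
    (k : C(AngleInterval, ℂ)) (φ : C(AngleInterval, G)) :
    anglePairing G k φ = ∫ θ in (0 : ℝ)..(2 * Real.pi), k (toAngle θ) • φ (toAngle θ) := rfl

/-- A circle as a continuous function of the angle. -/
def circleFun (b : ℂ) (ρ : ℝ) : C(AngleInterval, ℂ) :=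
  ⟨fun θ ↦ circleMap b ρ θ, by fun_prop⟩

/-- The derivative of a circle as a continuous function of the angle. -/
def circleDeriv (b : ℂ) (ρ : ℝ) : C(AngleInterval, ℂ) :=
  ⟨fun θ ↦ deriv (circleMap b ρ) θ, by simp only [deriv_circleMap]; fun_prop⟩

/-- The Cauchy kernel of a circle. -/
def cauchyKernel (b : ℂ) (ρ : ℝ) (w : ℂ) : C(AngleInterval, ℂ) :=
  Ring.inverse (circleFun b ρ - algebraMap ℂ _ w)

lemma isUnit_circleFun_sub {b : ℂ} {ρ : ℝ} {w : ℂ} (hw : w ∈ ball b ρ) :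
    IsUnit (circleFun b ρ - algebraMap ℂ C(AngleInterval, ℂ) w) := by
  rw [ContinuousMap.isUnit_iff_forall_ne_zero]
  intro θ h
  exact circleMap_ne_mem_ball hw θ (by simpa [circleFun, sub_eq_zero] using h)

lemma cauchyKernel_apply {b : ℂ} {ρ : ℝ} {w : ℂ} (hw : w ∈ ball b ρ) (θ : AngleInterval) :
    cauchyKernel b ρ w θ = (circleMap b ρ θ - w)⁻¹ := by
  apply eq_inv_of_mul_eq_one_left
  have := congrArg (fun f : C(AngleInterval, ℂ) ↦ f θ)
    (Ring.inverse_mul_cancel _ (isUnit_circleFun_sub hw))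
  simpa [circleFun, cauchyKernel] using this

/-- Inversion is analytic at the units of a Banach algebra. This is why the kernel is an inverse in
the algebra of continuous functions instead of a pointwise formula. -/
lemma analyticAt_cauchyKernel {b : ℂ} {ρ : ℝ} {w : ℂ} (hw : w ∈ ball b ρ) :
    AnalyticAt ℂ (cauchyKernel b ρ) w := by
  have h := analyticAt_inverse (𝕜 := ℂ) (isUnit_circleFun_sub hw).unit
  refine AnalyticAt.comp (g := Ring.inverse) h ?_
  refine analyticAt_const.sub ?_
  exact (Algebra.linearMap ℂ C(AngleInterval, ℂ)).mkContinuous 1 (fun x ↦ by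
    rw [one_mul, ContinuousMap.norm_le _ (norm_nonneg _)]
    simp) |>.analyticAt w

/-- Continuous maps out of `E` that are holomorphic after composition with a separating family of
functionals are analytic. -/
def WeaklyHolomorphicIsAnalytic (E : Type) [NormedAddCommGroup E] [NormedSpace ℂ E] : Prop :=
  ∀ (G : Type) [NormedAddCommGroup G] [NormedSpace ℂ G] [CompleteSpace G]
    (S : Set (G →L[ℂ] ℂ)), (∀ x, (∀ l ∈ S, l x = 0) → x = 0) →
    ∀ (F : E → G) (U : Set E), IsOpen U → ContinuousOn F U →
      (∀ l ∈ S, DifferentiableOn ℂ (fun x ↦ l (F x)) U) → ∀ x ∈ U, AnalyticAt ℂ F x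

lemma WeaklyHolomorphicIsAnalytic.of_equiv {E E' : Type} [NormedAddCommGroup E] [NormedSpace ℂ E]
    [NormedAddCommGroup E'] [NormedSpace ℂ E'] (e : E ≃L[ℂ] E')
    (h : WeaklyHolomorphicIsAnalytic E) : WeaklyHolomorphicIsAnalytic E' := by
  intro G _ _ _ S hS F U hU hF hl x hx
  have := h G S hS (F ∘ e) (e ⁻¹' U) (hU.preimage e.continuous)
    (hF.comp e.continuous.continuousOn fun _ h ↦ h)
    (fun l hl' ↦ (hl l hl').comp e.differentiableOn fun _ h ↦ h) (e.symm x) (by simpa using hx)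
  have h2 := AnalyticAt.comp (g := F ∘ e) (f := e.symm) (x := x) this (e.symm.analyticAt x)
  refine h2.congr (Eventually.of_forall fun y ↦ by simp)

lemma WeaklyHolomorphicIsAnalytic.of_subsingleton (E : Type) [NormedAddCommGroup E]
    [NormedSpace ℂ E] [Subsingleton E] : WeaklyHolomorphicIsAnalytic E := by
  intro G _ _ _ S hS F U hU hF hl x hx
  have : F = fun _ ↦ F x := by ext y; rw [Subsingleton.elim y x]
  rw [this]
  exact analyticAt_const

/-- A map on an open set with values in functions on a compact space, from a function of two
variables. -/
def curryOn {E K G : Type} [TopologicalSpace E] [TopologicalSpace K] [TopologicalSpace G]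
    [Zero G] (V : Set E) (f : E → K → G)
    (hf : Continuous fun p : V × K ↦ f p.1 p.2) (z : E) : C(K, G) :=
  open Classical in
  if h : z ∈ V then ContinuousMap.curry ⟨fun p : V × K ↦ f p.1 p.2, hf⟩ ⟨z, h⟩ else 0

lemma curryOn_apply {E K G : Type} [TopologicalSpace E] [TopologicalSpace K] [TopologicalSpace G]
    [Zero G] {V : Set E} (f : E → K → G) (hf : Continuous fun p : V × K ↦ f p.1 p.2) {z : E}
    (hz : z ∈ V) (k : K) : curryOn V f hf z k = f z k := by
  simp [curryOn, hz]

lemma continuousOn_curryOn {E K G : Type} [TopologicalSpace E] [TopologicalSpace K]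
    [TopologicalSpace G] [Zero G] {V : Set E} {f : E → K → G}
    (hf : Continuous fun p : V × K ↦ f p.1 p.2) : ContinuousOn (curryOn V f hf) V := by
  rw [continuousOn_iff_continuous_domRestrict]
  convert (ContinuousMap.curry ⟨fun p : V × K ↦ f p.1 p.2, hf⟩).continuous using 1
  ext z k
  simp [curryOn]

lemma cauchy_formula_angle {g : ℂ → ℂ} {b w : ℂ} {ρ : ℝ} (hw : w ∈ ball b ρ)
    (hg : DifferentiableOn ℂ g (closedBall b ρ)) (φ : C(AngleInterval, ℂ))
    (hφ : ∀ θ, φ θ = g (circleMap b ρ θ)) :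
    anglePairing ℂ (circleDeriv b ρ * cauchyKernel b ρ w) φ = (2 * Real.pi * Complex.I) * g w := by
  have h := hg.circleIntegral_sub_inv_smul hw
  rw [smul_eq_mul] at h
  rw [← h, circleIntegral, anglePairing_apply]
  apply intervalIntegral.integral_congr
  intro θ hθ
  rw [Set.uIcc_of_le Real.two_pi_pos.le] at hθ
  simp only [ContinuousMap.mul_apply, cauchyKernel_apply hw, hφ, toAngle_of_mem hθ, smul_eq_mul,
    mul_assoc]
  congr 1
  change deriv (circleMap b ρ) (toAngle θ) = _
  rw [toAngle_of_mem hθ]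

lemma clm_anglePairing {G : Type} [NormedAddCommGroup G] [NormedSpace ℂ G] [CompleteSpace G]
    (l : G →L[ℂ] ℂ) (k : C(AngleInterval, ℂ)) (φ : C(AngleInterval, G)) :
    l (anglePairing G k φ) = anglePairing ℂ k ((l : C(G, ℂ)).comp φ) := by
  rw [anglePairing_apply, anglePairing_apply, ← ContinuousLinearMap.intervalIntegral_comp_comm]
  · simp
  · exact Continuous.intervalIntegrable
      ((map_continuous _ |>.comp continuous_toAngle).smul
        (map_continuous _ |>.comp continuous_toAngle)) _ _

/-- Cauchy's formula in the last variable. The values of F on a circle form a map Φ from E to the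
Banach space of continuous functions on the circle, weakly holomorphic for the functionals "evaluate
at an angle, then apply l". The hypothesis on E makes Φ analytic, and F is recovered by pairing Φ
with the Cauchy kernel. The passage from G to C(K, G) is the reason for allowing all Banach spaces
and all separating families. -/
lemma WeaklyHolomorphicIsAnalytic.prod {E : Type} [NormedAddCommGroup E] [NormedSpace ℂ E]
    (hE : WeaklyHolomorphicIsAnalytic E) : WeaklyHolomorphicIsAnalytic (E × ℂ) := by
  intro G _ _ _ S hS F U hU hF hl x hx
  obtain ⟨a, b⟩ := x
  obtain ⟨r, hr, hrU⟩ := Metric.isOpen_iff.1 hU _ hx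
  set ρ := r / 2 with hρ
  have hρ0 : 0 < ρ := by positivity
  set V := ball a r
  have hsub : ∀ z ∈ V, ∀ w ∈ closedBall b ρ, (z, w) ∈ U := by
    intro z hz w hw
    apply hrU
    rw [← ball_prod_same]
    exact ⟨hz, closedBall_subset_ball (by linarith) hw⟩
  have hcont : Continuous fun p : V × AngleInterval ↦ F ((p.1 : E), circleMap b ρ p.2) := by
    refine hF.comp_continuous (by fun_prop) ?_
    rintro ⟨⟨z, hz⟩, θ⟩
    exact hsub z hz _ (circleMap_mem_closedBall b hρ0.le _)
  set Φ := curryOn V (fun z (θ : AngleInterval) ↦ F (z, circleMap b ρ θ)) hcont with hΦ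
  have hΦa : AnalyticAt ℂ Φ a := by
    refine hE C(AngleInterval, G)
      {L | ∃ l ∈ S, ∃ θ, L = l.comp (ContinuousMap.evalCLM ℂ θ)} ?_ Φ V isOpen_ball
      (continuousOn_curryOn hcont) ?_ a (mem_ball_self hr)
    · intro φ hφ
      ext θ
      exact hS _ fun l hl' ↦ hφ _ ⟨l, hl', θ, rfl⟩
    · rintro _ ⟨l, hl', θ, rfl⟩
      have : DifferentiableOn ℂ (fun z ↦ l (F (z, circleMap b ρ θ))) V := by
        refine (hl l hl').comp (f := fun z ↦ (z, circleMap b ρ θ)) (by fun_prop) ?_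
        intro z hz
        exact hsub z hz _ (circleMap_mem_closedBall b hρ0.le _)
      refine this.congr fun z hz ↦ ?_
      simp [hΦ, curryOn_apply (fun z (θ : AngleInterval) ↦ F (z, circleMap b ρ θ)) hcont hz]
  have hker : AnalyticAt ℂ (fun p : E × ℂ ↦
      (2 * Real.pi * Complex.I : ℂ)⁻¹ •
        anglePairing G (circleDeriv b ρ * cauchyKernel b ρ p.2) (Φ p.1)) (a, b) := by
    refine analyticAt_const.smul ?_
    have h1 : AnalyticAt ℂ (fun p : E × ℂ ↦ circleDeriv b ρ * cauchyKernel b ρ p.2) (a, b) :=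
      analyticAt_const.mul (AnalyticAt.comp (g := cauchyKernel b ρ) (f := Prod.snd)
        (analyticAt_cauchyKernel (mem_ball_self hρ0)) analyticAt_snd)
    have h2 : AnalyticAt ℂ (fun p : E × ℂ ↦ Φ p.1) (a, b) :=
      AnalyticAt.comp (g := Φ) (f := Prod.fst) hΦa analyticAt_fst
    exact ((anglePairing G).analyticAt_bilinear _).comp (h1.prod h2)
  refine hker.congr ?_
  have hnhds : V ×ˢ ball b ρ ∈ 𝓝 (a, b) :=
    prod_mem_nhds (ball_mem_nhds a hr) (ball_mem_nhds b hρ0)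
  filter_upwards [hnhds]
  rintro ⟨z, w⟩ ⟨hz, hw⟩
  -- The two sides are compared through the functionals in S, which reduces the identity to the
  -- scalar Cauchy formula.
  rw [← sub_eq_zero]
  refine hS _ fun l hl' ↦ ?_
  rw [map_sub, map_smul, clm_anglePairing,
    cauchy_formula_angle (g := fun w ↦ l (F (z, w))) hw, smul_eq_mul, inv_mul_cancel_left₀,
    sub_self]
  · simp [Real.pi_ne_zero]
  · refine (hl l hl').comp (f := fun w ↦ (z, w)) (by fun_prop) ?_
    intro w hw
    exact hsub z hz w hw
  · intro θ
    simp [hΦ, curryOn_apply (fun z (θ : AngleInterval) ↦ F (z, circleMap b ρ θ)) hcont hz]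

lemma weaklyHolomorphicIsAnalytic_pi (n : ℕ) : WeaklyHolomorphicIsAnalytic (Fin n → ℂ) := by
  induction n with
  | zero => exact .of_subsingleton _
  | succ n ih =>
    have : FiniteDimensional ℂ ((Fin n → ℂ) × ℂ) := inferInstance
    refine ih.prod.of_equiv (ContinuousLinearEquiv.ofFinrankEq ?_)
    simp

/-- **Osgood's lemma**, for maps with values in a Banach space which are only assumed to be
weakly holomorphic. -/
lemma weaklyHolomorphicIsAnalytic (E : Type) [NormedAddCommGroup E] [NormedSpace ℂ E]
    [FiniteDimensional ℂ E] : WeaklyHolomorphicIsAnalytic E :=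
  (weaklyHolomorphicIsAnalytic_pi (Module.finrank ℂ E)).of_equiv
    (ContinuousLinearEquiv.ofFinrankEq (by simp))

lemma analyticAt_of_differentiableOn {E : Type} [NormedAddCommGroup E] [NormedSpace ℂ E]
    [FiniteDimensional ℂ E] {f : E → ℂ} {U : Set E} (hU : IsOpen U)
    (hf : DifferentiableOn ℂ f U) {x : E} (hx : x ∈ U) : AnalyticAt ℂ f x :=
  weaklyHolomorphicIsAnalytic E ℂ {ContinuousLinearMap.id ℂ ℂ} (fun x h ↦ h _ rfl) f U hU
    hf.continuousOn (by rintro _ rfl; exact hf) x hx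

end Osgood

/-! ### The disc algebra and Weierstrass division. -/

section DiscAlgebra

open Set Metric Filter Topology

/-- Extension by zero of a function on a closed disc. -/
def discExt {ρ : ℝ} (φ : C(closedBall (0 : ℂ) ρ, ℂ)) (w : ℂ) : ℂ :=
  open Classical in if h : w ∈ closedBall (0 : ℂ) ρ then φ ⟨w, h⟩ else 0

lemma discExt_coe {ρ : ℝ} (φ : C(closedBall (0 : ℂ) ρ, ℂ)) (w : closedBall (0 : ℂ) ρ) :
    discExt φ w = φ w := by
  simp only [discExt, w.2, dite_true]

lemma discExt_of_mem {ρ : ℝ} (φ : C(closedBall (0 : ℂ) ρ, ℂ)) {w : ℂ}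
    (hw : w ∈ closedBall (0 : ℂ) ρ) : discExt φ w = φ ⟨w, hw⟩ :=
  discExt_coe φ ⟨w, hw⟩

lemma continuousOn_discExt {ρ : ℝ} (φ : C(closedBall (0 : ℂ) ρ, ℂ)) :
    ContinuousOn (discExt φ) (closedBall 0 ρ) := by
  rw [continuousOn_iff_continuous_domRestrict]
  convert φ.continuous using 1
  ext w
  exact discExt_coe φ w

lemma norm_discExt_le {ρ : ℝ} (φ : C(closedBall (0 : ℂ) ρ, ℂ)) (w : ℂ) :
    ‖discExt φ w‖ ≤ ‖φ‖ := by
  by_cases h : w ∈ closedBall (0 : ℂ) ρ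
  · rw [discExt_of_mem φ h]; exact φ.norm_coe_le_norm _
  · simp [discExt, h]

/-- The disc algebra: continuous functions on a closed disc which are holomorphic in its
interior. -/
def discAlgebra (ρ : ℝ) : Subalgebra ℂ C(closedBall (0 : ℂ) ρ, ℂ) where
  carrier := {φ | DifferentiableOn ℂ (discExt φ) (ball 0 ρ)}
  mul_mem' {φ ψ} hφ hψ := (hφ.mul hψ).congr fun w hw ↦ by
    simp [discExt_of_mem _ (ball_subset_closedBall hw)]
  add_mem' {φ ψ} hφ hψ := (hφ.add hψ).congr fun w hw ↦ by
    simp [discExt_of_mem _ (ball_subset_closedBall hw)]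
  algebraMap_mem' c := (differentiableOn_const c).congr fun w hw ↦ by
    simp [discExt_of_mem _ (ball_subset_closedBall hw)]

/-- Locally uniform limits of holomorphic functions are holomorphic. -/
lemma isClosed_discAlgebra (ρ : ℝ) : IsClosed (discAlgebra ρ : Set C(closedBall (0 : ℂ) ρ, ℂ)) := by
  rw [← isSeqClosed_iff_isClosed]
  intro φ ψ hφ hlim
  refine TendstoLocallyUniformlyOn.differentiableOn (φ := atTop) (F := fun n ↦ discExt (φ n)) ?_
    (Eventually.of_forall hφ) isOpen_ball
  refine TendstoUniformlyOn.tendstoLocallyUniformlyOn ?_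
  rw [Metric.tendstoUniformlyOn_iff]
  intro ε hε
  filter_upwards [Metric.tendsto_nhds.1 hlim ε hε] with n hn w hw
  rw [discExt_of_mem _ (ball_subset_closedBall hw), discExt_of_mem _ (ball_subset_closedBall hw),
    dist_comm]
  exact (ContinuousMap.dist_apply_le_dist _).trans_lt hn

/-- The disc algebra as a Banach algebra. -/
def Disc (ρ : ℝ) : Type := discAlgebra ρ

instance (ρ : ℝ) : NormedCommRing (Disc ρ) := inferInstanceAs (NormedCommRing (discAlgebra ρ))

instance (ρ : ℝ) : NormedAlgebra ℂ (Disc ρ) := inferInstanceAs (NormedAlgebra ℂ (discAlgebra ρ))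

instance (ρ : ℝ) : CompleteSpace (Disc ρ) :=
  (isClosed_discAlgebra ρ).completeSpace_coe

variable {ρ : ℝ}

/-- An element of the disc algebra from a function. -/
def discMk (g : ℂ → ℂ) (hg : ContinuousOn g (closedBall 0 ρ))
    (hg' : DifferentiableOn ℂ g (ball 0 ρ)) : Disc ρ :=
  ⟨⟨fun w ↦ g w, continuousOn_iff_continuous_domRestrict.1 hg⟩, hg'.congr fun w hw ↦ by
    rw [discExt_of_mem _ (ball_subset_closedBall hw)]; rfl⟩

/-- The values of an element of the disc algebra. -/
def discEval (φ : Disc ρ) (w : ℂ) : ℂ := discExt φ.1 w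

lemma discEval_discMk {g : ℂ → ℂ} (hg : ContinuousOn g (closedBall 0 ρ))
    (hg' : DifferentiableOn ℂ g (ball 0 ρ)) {w : ℂ} (hw : w ∈ closedBall (0 : ℂ) ρ) :
    discEval (discMk g hg hg') w = g w :=
  discExt_of_mem _ hw

lemma disc_ext {φ ψ : Disc ρ}
    (h : ∀ w ∈ closedBall (0 : ℂ) ρ, discEval φ w = discEval ψ w) : φ = ψ := by
  refine Subtype.ext (ContinuousMap.ext fun w ↦ ?_)
  rw [← discExt_coe, ← discExt_coe]
  exact h w w.2

lemma norm_disc_le {φ : Disc ρ} {M : ℝ} (hM : 0 ≤ M)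
    (h : ∀ w ∈ closedBall (0 : ℂ) ρ, ‖discEval φ w‖ ≤ M) : ‖φ‖ ≤ M := by
  change ‖φ.1‖ ≤ M
  rw [ContinuousMap.norm_le _ hM]
  intro w
  rw [← discExt_coe]
  exact h w w.2

/-- Evaluation at a point as a continuous functional. -/
def discEvalCLM (w : ℂ) : Disc ρ →L[ℂ] ℂ :=
  LinearMap.mkContinuous
    { toFun := fun φ ↦ discEval φ w
      map_add' := fun φ ψ ↦ by
        by_cases h : w ∈ closedBall (0 : ℂ) ρ
        · simp only [discEval, discExt_of_mem _ h]; rfl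
        · simp [discEval, discExt, h, -mem_closedBall]
      map_smul' := fun c φ ↦ by
        by_cases h : w ∈ closedBall (0 : ℂ) ρ
        · simp only [discEval, discExt_of_mem _ h]; rfl
        · simp [discEval, discExt, h, -mem_closedBall] } 1
    (fun φ ↦ by rw [one_mul]; exact norm_discExt_le φ.1 w)

@[simp] lemma discEvalCLM_apply (w : ℂ) (φ : Disc ρ) :
    discEvalCLM w φ = discEval φ w := rfl

lemma discEval_mul (φ ψ : Disc ρ) (w : ℂ) :
    discEval (φ * ψ) w = discEval φ w * discEval ψ w := by
  by_cases h : w ∈ closedBall (0 : ℂ) ρ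
  · simp only [discEval, discExt_of_mem _ h]; rfl
  · simp [discEval, discExt, h, -mem_closedBall]

lemma discEval_add (φ ψ : Disc ρ) (w : ℂ) :
    discEval (φ + ψ) w = discEval φ w + discEval ψ w := map_add (discEvalCLM w) φ ψ

lemma discEval_sub (φ ψ : Disc ρ) (w : ℂ) :
    discEval (φ - ψ) w = discEval φ w - discEval ψ w := map_sub (discEvalCLM w) φ ψ

lemma discEval_smul (c : ℂ) (φ : Disc ρ) (w : ℂ) :
    discEval (c • φ) w = c * discEval φ w := map_smul (discEvalCLM w) c φ

lemma discEval_one {w : ℂ} (hw : w ∈ closedBall (0 : ℂ) ρ) :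
    discEval (1 : Disc ρ) w = 1 := by
  rw [discEval, discExt_of_mem _ hw]; rfl

lemma discEval_pow (φ : Disc ρ) {w : ℂ} (hw : w ∈ closedBall (0 : ℂ) ρ) (j : ℕ) :
    discEval (φ ^ j) w = discEval φ w ^ j := by
  induction j with
  | zero => simp [discEval_one hw]
  | succ j ih => rw [pow_succ, pow_succ, discEval_mul, ih]

lemma differentiableOn_discEval (φ : Disc ρ) :
    DifferentiableOn ℂ (discEval φ) (ball 0 ρ) := φ.2

lemma continuousOn_discEval (φ : Disc ρ) :
    ContinuousOn (discEval φ) (closedBall 0 ρ) := continuousOn_discExt φ.1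

/-- The coordinate function. -/
def discX : Disc ρ := discMk id continuousOn_id differentiableOn_id

lemma discEval_discX {w : ℂ} (hw : w ∈ closedBall (0 : ℂ) ρ) :
    discEval (discX : Disc ρ) w = w := discEval_discMk _ _ hw

lemma continuousOn_dslope_discEval (hρ : 0 < ρ) (φ : Disc ρ) :
    ContinuousOn (dslope (discEval φ) 0) (closedBall 0 ρ) :=
  (continuousOn_dslope (closedBall_mem_nhds 0 hρ)).2 ⟨continuousOn_discEval φ,
    (differentiableOn_discEval φ).differentiableAt (ball_mem_nhds 0 hρ)⟩

lemma differentiableOn_dslope_discEval (hρ : 0 < ρ) (φ : Disc ρ) :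
    DifferentiableOn ℂ (dslope (discEval φ) 0) (ball 0 ρ) :=
  (Complex.differentiableOn_dslope (ball_mem_nhds 0 hρ)).2 (differentiableOn_discEval φ)

/-- Cancel w off the origin and pass to the limit at it. Identities for the backward shift are
checked after multiplication by `discX`, which removes the quotient. -/
lemma eq_of_mul_discX (hρ : 0 < ρ) {φ ψ : Disc ρ} (h : discX * φ = discX * ψ) : φ = ψ := by
  have h0 : ∀ w ∈ closedBall (0 : ℂ) ρ, w ≠ 0 → discEval φ w = discEval ψ w := by
    intro w hw hw0
    have := congrArg (fun χ ↦ discEval χ w) h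
    simp only [discEval_mul, discEval_discX hw] at this
    exact mul_left_cancel₀ hw0 this
  refine disc_ext fun w hw ↦ ?_
  by_cases hw0 : w = 0
  · subst hw0
    have h1 : ∀ χ : Disc ρ, Tendsto (discEval χ) (𝓝[≠] 0) (𝓝 (discEval χ 0)) := fun χ ↦
      ((continuousOn_discEval χ).continuousAt (closedBall_mem_nhds 0 hρ)).tendsto.mono_left
        nhdsWithin_le_nhds
    refine tendsto_nhds_unique (h1 φ) ((h1 ψ).congr' ?_)
    filter_upwards [self_mem_nhdsWithin, nhdsWithin_le_nhds (closedBall_mem_nhds 0 hρ)]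
      with w hw0 hw
    exact (h0 w hw hw0).symm
  · exact h0 w hw hw0

/-- The backward shift `φ ↦ (φ - φ(0)) / w` of the disc algebra. -/
def discShift (hρ : 0 < ρ) : Disc ρ →L[ℂ] Disc ρ :=
  LinearMap.mkContinuous
    { toFun := fun φ ↦ discMk (dslope (discEval φ) 0) (continuousOn_dslope_discEval hρ φ)
        (differentiableOn_dslope_discEval hρ φ)
      map_add' := fun φ ψ ↦ by
        refine eq_of_mul_discX hρ (disc_ext fun w hw ↦ ?_)
        have := fun φ : Disc ρ ↦ sub_smul_dslope (discEval φ) 0 w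
        simp only [sub_zero, smul_eq_mul] at this
        simp only [discEval_mul, discEval_add, discEval_discX hw, discEval_discMk _ _ hw, mul_add,
          this]
        ring
      map_smul' := fun c φ ↦ by
        refine eq_of_mul_discX hρ (disc_ext fun w hw ↦ ?_)
        have := fun φ : Disc ρ ↦ sub_smul_dslope (discEval φ) 0 w
        simp only [sub_zero, smul_eq_mul] at this
        simp only [discEval_mul, discEval_smul, discEval_discX hw, discEval_discMk _ _ hw,
          mul_left_comm _ c, this, RingHom.id_apply]
        ring }
    (2 / ρ) (fun φ ↦ by
      refine norm_disc_le (by positivity) fun w hw ↦ ?_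
      -- By the maximum principle it is enough to bound (φ(w) - φ(0)) / w on the circle of radius ρ,
      -- where its norm is at most 2‖φ‖ / ρ.
      refine Complex.norm_le_of_forall_mem_frontier_norm_le (U := ball (0 : ℂ) ρ) isBounded_ball
        (f := discEval (discMk (dslope (discEval φ) 0) (continuousOn_dslope_discEval hρ φ)
          (differentiableOn_dslope_discEval hρ φ))) ⟨differentiableOn_discEval _, ?_⟩ ?_ ?_
      · rw [closure_ball _ hρ.ne']
        exact continuousOn_discEval _
      · intro w hw
        rw [frontier_ball _ hρ.ne', mem_sphere_zero_iff_norm] at hw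
        have hw0 : w ≠ 0 := by rintro rfl; simp at hw; exact hρ.ne hw
        rw [discEval_discMk _ _ (by simp [hw]), dslope_of_ne _ hw0, slope_def_module, norm_smul,
          sub_zero, norm_inv, hw, div_mul_eq_mul_div, div_eq_inv_mul]
        gcongr
        calc _ ≤ ‖discEval φ w‖ + ‖discEval φ 0‖ := norm_sub_le _ _
          _ ≤ ‖φ‖ + ‖φ‖ := add_le_add (norm_discExt_le _ _) (norm_discExt_le _ _)
          _ = _ := by ring
      · rwa [closure_ball _ hρ.ne'])

lemma discX_mul_discShift (hρ : 0 < ρ) (φ : Disc ρ) :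
    φ = discEval φ 0 • 1 + discX * discShift hρ φ := by
  refine disc_ext fun w hw ↦ ?_
  have := sub_smul_dslope (discEval φ) 0 w
  simp only [sub_zero, smul_eq_mul] at this
  rw [discEval_add, discEval_smul, discEval_one hw, discEval_mul, discEval_discX hw]
  change _ = _ + w * discEval (discMk (dslope (discEval φ) 0) (continuousOn_dslope_discEval hρ φ)
        (differentiableOn_dslope_discEval hρ φ)) w
  rw [discEval_discMk _ _ hw, this]
  ring

lemma discShift_discX_mul (hρ : 0 < ρ) (φ : Disc ρ) :
    discShift hρ (discX * φ) = φ := by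
  refine eq_of_mul_discX hρ ?_
  have h := discX_mul_discShift hρ (discX * φ)
  rw [discEval_mul, discEval_discX (by simp [hρ.le]), zero_mul, zero_smul, zero_add] at h
  exact h.symm

lemma discShift_pow_discX_pow_mul (hρ : 0 < ρ) (d : ℕ) (φ : Disc ρ) :
    (discShift hρ ^ d) (discX ^ d * φ) = φ := by
  induction d with
  | zero => simp
  | succ d ih =>
    rw [pow_succ, mul_apply_eq_comp, pow_succ', mul_assoc, discShift_discX_mul, ih]

/-- Iterated `discX_mul_discShift`. In particular an element killed by the d-th power of the shift
is a polynomial of degree less than d: this recognises remainders. -/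
lemma disc_taylor (hρ : 0 < ρ) (d : ℕ) (φ : Disc ρ) :
    φ = ∑ j : Fin d, discEval ((discShift hρ ^ (j : ℕ)) φ) 0 • discX ^ (j : ℕ) +
      discX ^ d * (discShift hρ ^ d) φ := by
  induction d with
  | zero => simp
  | succ d ih =>
    have h := congrArg (fun ψ ↦ discX ^ d * ψ) (discX_mul_discShift hρ ((discShift hρ ^ d) φ))
    simp only [mul_add, mul_smul_comm, mul_one, ← mul_assoc, ← pow_succ] at h
    rw [Fin.sum_univ_castSucc, pow_succ' (discShift hρ), mul_apply_eq_comp, add_assoc]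
    simp only [Fin.val_castSucc, Fin.val_last]
    rw [← h]
    exact ih

/-- With S the shift and k = (1 - wS)⁻¹ φ, one has φ = k - w S k, while k(w) = k(0) + w (S k)(w);
hence φ(w) = k(0). Evaluation at a moving point becomes evaluation at 0 after an operator that is
analytic in w, which yields joint analyticity in `analyticAt_eval_family`. -/
lemma eval_resolvent (hρ : 0 < ρ) {w : ℂ} (hw : w ∈ closedBall (0 : ℂ) ρ)
    (hu : IsUnit (1 - w • discShift hρ)) (φ : Disc ρ) :
    discEval (Ring.inverse (1 - w • discShift hρ) φ) 0 = discEval φ w := by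
  set k := Ring.inverse (1 - w • discShift hρ) φ with hk
  have h1 : φ = k - w • discShift hρ k := by
    have := congrArg (fun T : Disc ρ →L[ℂ] Disc ρ ↦ T φ)
      (Ring.mul_inverse_cancel _ hu)
    simp only [mul_apply_eq_comp, one_apply_eq_self] at this
    rw [← this, ← hk]
    simp
  have h2 := congrArg (fun χ ↦ discEval χ w) (discX_mul_discShift hρ k)
  simp only [discEval_add, discEval_smul, discEval_one hw, discEval_mul, discEval_discX hw] at h2
  rw [h1, discEval_sub, h2, discEval_smul]
  ring

lemma analyticAt_clm_apply {E B B' : Type} [NormedAddCommGroup E] [NormedSpace ℂ E]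
    [NormedAddCommGroup B] [NormedSpace ℂ B] [NormedAddCommGroup B'] [NormedSpace ℂ B']
    {T : E → B →L[ℂ] B'} {φ : E → B} {x : E} (hT : AnalyticAt ℂ T x) (hφ : AnalyticAt ℂ φ x) :
    AnalyticAt ℂ (fun z ↦ T z (φ z)) x :=
  AnalyticAt.comp (g := fun p : (B →L[ℂ] B') × B ↦ p.1 p.2) (f := fun z ↦ (T z, φ z))
    ((ContinuousLinearMap.id ℂ (B →L[ℂ] B')).analyticAt_bilinear (T x, φ x)) (hT.prod hφ)

lemma analyticAt_eval_family {E : Type} [NormedAddCommGroup E] [NormedSpace ℂ E] (hρ : 0 < ρ)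
    {q : E → Disc ρ} {x : E} (hq : AnalyticAt ℂ q x) :
    AnalyticAt ℂ (fun p : E × ℂ ↦ discEval (q p.1) p.2) (x, 0) := by
  have hT : AnalyticAt ℂ (fun p : E × ℂ ↦ (1 : Disc ρ →L[ℂ] Disc ρ) -
      p.2 • discShift hρ) (x, 0) := analyticAt_const.sub (analyticAt_snd.smul analyticAt_const)
  have hu0 : IsUnit ((1 : Disc ρ →L[ℂ] Disc ρ) - (x, (0 : ℂ)).2 • discShift hρ) := by
    have h : (x, (0 : ℂ)).2 • discShift hρ = 0 := zero_smul ℂ (discShift hρ)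
    rw [h, sub_zero]
    exact isUnit_one
  have hinv := AnalyticAt.comp (g := Ring.inverse) (f := fun p : E × ℂ ↦
    (1 : Disc ρ →L[ℂ] Disc ρ) - p.2 • discShift hρ) (x := (x, (0 : ℂ)))
    (analyticAt_inverse (𝕜 := ℂ) hu0.unit) hT
  have hq' : AnalyticAt ℂ (fun p : E × ℂ ↦ q p.1) (x, 0) :=
    AnalyticAt.comp (g := q) (f := Prod.fst) hq analyticAt_fst
  have h := (ContinuousLinearMap.analyticAt (discEvalCLM (ρ := ρ) 0) _).comp (analyticAt_clm_apply hinv hq')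
  refine h.congr ?_
  have hunit : ∀ᶠ p : E × ℂ in 𝓝 (x, 0),
      IsUnit ((1 : Disc ρ →L[ℂ] Disc ρ) - p.2 • discShift hρ) :=
    hT.continuousAt.eventually (Units.isOpen.mem_nhds hu0)
  have hmem : ∀ᶠ p : E × ℂ in 𝓝 (x, 0), p.2 ∈ closedBall (0 : ℂ) ρ :=
    (continuousAt_snd (p := (x, (0 : ℂ)))).eventually (closedBall_mem_nhds 0 hρ)
  filter_upwards [hunit, hmem] with p hp hp'
  exact eval_resolvent hρ hp' hp _

/-- Osgood's lemma with values in the disc algebra, the point evaluations being the separating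
family. -/
lemma exists_discFamily {E : Type} [NormedAddCommGroup E] [NormedSpace ℂ E]
    [FiniteDimensional ℂ E] {f : E × ℂ → ℂ} {V : Set E} (hV : IsOpen V)
    (hf : ∀ z ∈ V, ∀ w ∈ closedBall (0 : ℂ) ρ, AnalyticAt ℂ f (z, w)) :
    ∃ F : E → Disc ρ, (∀ z ∈ V, AnalyticAt ℂ F z) ∧
      ∀ z ∈ V, ∀ w ∈ closedBall (0 : ℂ) ρ, discEval (F z) w = f (z, w) := by
  have hcont : Continuous fun p : V × closedBall (0 : ℂ) ρ ↦ f ((p.1 : E), (p.2 : ℂ)) := by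
    rw [continuous_iff_continuousAt]
    rintro ⟨z, w⟩
    exact ContinuousAt.comp (g := f) (f := fun p : V × closedBall (0 : ℂ) ρ ↦ ((p.1 : E), (p.2 : ℂ)))
      (hf z z.2 w w.2).continuousAt (by fun_prop)
  set Φ := curryOn V (fun z (w : closedBall (0 : ℂ) ρ) ↦ f (z, (w : ℂ))) hcont with hΦ
  have hΦa : ∀ z ∈ V, ∀ w, Φ z w = f (z, (w : ℂ)) := fun z hz w ↦ by
    rw [hΦ, curryOn_apply (fun z (w : closedBall (0 : ℂ) ρ) ↦ f (z, (w : ℂ))) hcont hz]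
  have hmem : ∀ z, Φ z ∈ discAlgebra ρ := by
    intro z
    by_cases hz : z ∈ V
    · have : DifferentiableOn ℂ (fun w ↦ f (z, w)) (ball 0 ρ) := fun w hw ↦
        (DifferentiableAt.comp (g := f) (f := fun w ↦ (z, w)) w
          (hf z hz w (ball_subset_closedBall hw)).differentiableAt
          (by fun_prop)).differentiableWithinAt
      refine this.congr fun w hw ↦ ?_
      rw [discExt_of_mem _ (ball_subset_closedBall hw), hΦa z hz]
    · have : Φ z = 0 := by simp [hΦ, curryOn, hz]
      rw [this]
      exact zero_mem _
  have heval : ∀ z ∈ V, ∀ w ∈ closedBall (0 : ℂ) ρ,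
      discEval (⟨Φ z, hmem z⟩ : Disc ρ) w = f (z, w) := fun z hz w hw ↦ by
    rw [← hΦa z hz ⟨w, hw⟩]
    exact discExt_of_mem _ hw
  refine ⟨fun z ↦ ⟨Φ z, hmem z⟩, ?_, heval⟩
  refine weaklyHolomorphicIsAnalytic E (Disc ρ)
    {l | ∃ w ∈ closedBall (0 : ℂ) ρ, l = discEvalCLM w} ?_ _ V hV ?_ ?_
  · intro φ hφ
    refine disc_ext fun w hw ↦ ?_
    have := hφ _ ⟨w, hw, rfl⟩
    rw [discEvalCLM_apply] at this
    rw [this]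
    exact (map_zero (discEvalCLM w)).symm
  · exact Topology.IsInducing.subtypeVal.continuousOn_iff.2
      (continuousOn_curryOn (f := fun z (w : closedBall (0 : ℂ) ρ) ↦ f (z, (w : ℂ))) hcont)
  · rintro _ ⟨w, hw, rfl⟩
    have : DifferentiableOn ℂ (fun z ↦ f (z, w)) V := fun z hz ↦
        (DifferentiableAt.comp (g := f) (f := fun z ↦ (z, w)) z
          (hf z hz w hw).differentiableAt (by fun_prop)).differentiableWithinAt
    exact this.congr fun z hz ↦ heval z hz w hw

/-- **Weierstrass division**: division with remainder by a function which vanishes to order `d` in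
the last variable. -/
theorem weierstrass_division {E : Type} [NormedAddCommGroup E] [NormedSpace ℂ E]
    [FiniteDimensional ℂ E] {f g : E × ℂ → ℂ} (hf : AnalyticAt ℂ f 0) (hg : AnalyticAt ℂ g 0)
    {d : ℕ} {u : ℂ → ℂ} (hu : AnalyticAt ℂ u 0) (hu0 : u 0 ≠ 0)
    (hgu : ∀ᶠ t in 𝓝 (0 : ℂ), g (0, t) = t ^ d * u t) :
    ∃ (q : E × ℂ → ℂ) (a : Fin d → E → ℂ), AnalyticAt ℂ q 0 ∧ (∀ j, AnalyticAt ℂ (a j) 0) ∧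
      ∀ᶠ p in 𝓝 (0 : E × ℂ), f p = q p * g p + ∑ j, a j p.1 * p.2 ^ (j : ℕ) := by
  have hev : ∀ᶠ p : E × ℂ in 𝓝 0, AnalyticAt ℂ f p ∧ AnalyticAt ℂ g p :=
    hf.eventually_analyticAt.and hg.eventually_analyticAt
  obtain ⟨r, hr, hrU⟩ := Metric.eventually_nhds_iff_ball.1 hev
  have hev' : ∀ᶠ t in 𝓝 (0 : ℂ), g (0, t) = t ^ d * u t ∧ AnalyticAt ℂ u t ∧ u t ≠ 0 :=
    hgu.and (hu.eventually_analyticAt.and (hu.continuousAt.eventually_ne hu0))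
  obtain ⟨r', hr', hrU'⟩ := Metric.eventually_nhds_iff_ball.1 hev'
  -- The disc is small enough that u has no zeros on it and that f and g are analytic on its product
  -- with a ball in E.
  obtain ⟨ρ, hρ, hρr⟩ := exists_between (lt_min hr hr')
  have hsub : ∀ z ∈ ball (0 : E) r, ∀ w ∈ closedBall (0 : ℂ) ρ, (z, w) ∈ ball (0 : E × ℂ) r := by
    intro z hz w hw
    rw [← Prod.mk_zero_zero, ← ball_prod_same]
    exact ⟨hz, closedBall_subset_ball (hρr.trans_le (min_le_left _ _)) hw⟩
  have hK : ∀ w ∈ closedBall (0 : ℂ) ρ, g (0, w) = w ^ d * u w ∧ AnalyticAt ℂ u w ∧ u w ≠ 0 :=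
    fun w hw ↦ hrU' w (closedBall_subset_ball (hρr.trans_le (min_le_right _ _)) hw)
  have hz0 : (0 : E) ∈ ball (0 : E) r := mem_ball_self hr
  obtain ⟨F, hF, hFe⟩ := exists_discFamily (ρ := ρ) (isOpen_ball (x := (0 : E)) (ε := r))
    (fun z hz w hw ↦ (hrU _ (hsub z hz w hw)).1)
  obtain ⟨G, hG, hGe⟩ := exists_discFamily (ρ := ρ) (isOpen_ball (x := (0 : E)) (ε := r))
    (fun z hz w hw ↦ (hrU _ (hsub z hz w hw)).2)
  have hud : DifferentiableOn ℂ u (closedBall 0 ρ) := fun w hw ↦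
    (hK w hw).2.1.differentiableAt.differentiableWithinAt
  have hud' : DifferentiableOn ℂ (fun w ↦ (u w)⁻¹) (closedBall 0 ρ) :=
    hud.inv fun w hw ↦ (hK w hw).2.2
  set U : Disc ρ := discMk u hud.continuousOn (hud.mono ball_subset_closedBall)
  set U' : Disc ρ := discMk _ hud'.continuousOn (hud'.mono ball_subset_closedBall)
  have hUU' : U * U' = 1 := disc_ext fun w hw ↦ by
    rw [discEval_mul, discEval_discMk _ _ hw, discEval_discMk _ _ hw, discEval_one hw,
      mul_inv_cancel₀ (hK w hw).2.2]
  have hG0 : G 0 = discX ^ d * U := disc_ext fun w hw ↦ by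
    rw [hGe 0 hz0 w hw, discEval_mul, discEval_pow _ hw, discEval_discX hw, discEval_discMk _ _ hw,
      (hK w hw).1]
  -- F - qG is a polynomial of degree less than d exactly when the d-th power of the shift kills it,
  -- that is, when A(z) q is that power applied to F(z). Division is thus the inversion of A(z).
  set A : E → (Disc ρ →L[ℂ] Disc ρ) := fun z ↦
    discShift hρ ^ d * ContinuousLinearMap.mul ℂ (Disc ρ) (G z) with hA
  -- At z = 0 the factor w ^ d of G is undone by the shift, and A(0) is multiplication by the unit
  -- U. Units are open, so A(z) is invertible for z near 0.
  have hA0 : IsUnit (A 0) := by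
    have hA0' : A 0 = ContinuousLinearMap.mul ℂ (Disc ρ) U := by
      ext1 φ
      simp only [hA, mul_apply_eq_comp, ContinuousLinearMap.mul_apply', hG0, mul_assoc,
        discShift_pow_discX_pow_mul]
    rw [hA0']
    refine ⟨⟨ContinuousLinearMap.mul ℂ (Disc ρ) U,
      ContinuousLinearMap.mul ℂ (Disc ρ) U', ?_, ?_⟩, rfl⟩
    · ext1 φ
      simp [← mul_assoc, hUU']
    · ext1 φ
      simp [← mul_assoc, mul_comm U' U, hUU']
  have hAan : AnalyticAt ℂ A 0 :=
    analyticAt_const.mul (((ContinuousLinearMap.mul ℂ (Disc ρ)).analyticAt _).comp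
      (hG 0 hz0))
  have hinv := AnalyticAt.comp (g := Ring.inverse) (f := A) (x := (0 : E))
    (analyticAt_inverse (𝕜 := ℂ) hA0.unit) hAan
  set q : E → Disc ρ := fun z ↦ Ring.inverse (A z) ((discShift hρ ^ d) (F z)) with hq
  have hqan : AnalyticAt ℂ q 0 :=
    analyticAt_clm_apply hinv (((discShift hρ ^ d).analyticAt _).comp (hF 0 hz0))
  have hRan : AnalyticAt ℂ (fun z ↦ F z - q z * G z) 0 := (hF 0 hz0).sub (hqan.mul (hG 0 hz0))
  refine ⟨fun p ↦ discEval (q p.1) p.2,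
    fun j z ↦ discEval ((discShift hρ ^ (j : ℕ)) (F z - q z * G z)) 0,
    analyticAt_eval_family hρ hqan, fun j ↦
      (((discEvalCLM 0).comp (discShift hρ ^ (j : ℕ))).analyticAt _).comp hRan, ?_⟩
  have hunit : ∀ᶠ z in 𝓝 (0 : E), IsUnit (A z) ∧ z ∈ ball (0 : E) r :=
    (hAan.continuousAt.eventually (Units.isOpen.mem_nhds hA0)).and (ball_mem_nhds 0 hr)
  have h1 : ∀ᶠ p : E × ℂ in 𝓝 0, IsUnit (A p.1) ∧ p.1 ∈ ball (0 : E) r :=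
    (continuousAt_fst (p := (0 : E × ℂ))).eventually hunit
  have h2 : ∀ᶠ p : E × ℂ in 𝓝 0, p.2 ∈ closedBall (0 : ℂ) ρ :=
    (continuousAt_snd (p := (0 : E × ℂ))).eventually (closedBall_mem_nhds 0 hρ)
  filter_upwards [h1, h2]
  rintro ⟨z, w⟩ ⟨hz, hzr⟩ hw
  have h3 : (discShift hρ ^ d) (F z - q z * G z) = 0 := by
    have := congrArg (fun T : Disc ρ →L[ℂ] Disc ρ ↦ T ((discShift hρ ^ d) (F z)))
      (Ring.mul_inverse_cancel _ hz)
    simp only [mul_apply_eq_comp, one_apply_eq_self] at this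
    rw [map_sub, sub_eq_zero, ← this]
    simp only [hA, mul_apply_eq_comp, ContinuousLinearMap.mul_apply', hq, mul_comm]
  have h4 := congrArg (fun φ ↦ discEval φ w) (disc_taylor hρ d (F z - q z * G z))
  simp only [h3, mul_zero, add_zero, discEval_sub, discEval_mul, hFe z hzr w hw,
    hGe z hzr w hw] at h4
  rw [sub_eq_iff_eq_add'] at h4
  rw [h4]
  congr 1
  have h5 := map_sum (discEvalCLM (ρ := ρ) w)
    (fun j : Fin d ↦ discEval ((discShift hρ ^ (j : ℕ)) (F z - q z * G z)) 0 • discX ^ (j : ℕ))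
    Finset.univ
  simp only [discEvalCLM_apply, discEval_smul, discEval_pow _ hw, discEval_discX hw] at h5
  exact h5

end DiscAlgebra

/-! ### Division by a linear form; rings of analytic functions at the origin. -/

section Nullstellensatz

open Set Metric Filter Topology Polynomial

/-- The splitting of a finite-dimensional space given by a functional `l` and a vector `v` with
`l v = 1`. -/
def splitEquiv {E : Type} [NormedAddCommGroup E] [NormedSpace ℂ E] [FiniteDimensional ℂ E]
    (l : E →L[ℂ] ℂ) (v : E) (h : l v = 1) : (LinearMap.ker l.toLinearMap × ℂ) ≃L[ℂ] E :=
  LinearEquiv.toContinuousLinearEquiv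
    { toFun := fun p ↦ p.1 + p.2 • v
      map_add' := fun p q ↦ by simp only [Prod.fst_add, Prod.snd_add, Submodule.coe_add]; module
      map_smul' := fun c p ↦ by simp [mul_smul]
      invFun := fun x ↦ (⟨x - l x • v, by simp [h]⟩, l x)
      left_inv := fun p ↦ by
        have : l p.1 = 0 := p.1.2
        ext <;> simp [h, this]
      right_inv := fun x ↦ by simp }

lemma splitEquiv_apply {E : Type} [NormedAddCommGroup E] [NormedSpace ℂ E] [FiniteDimensional ℂ E]
    (l : E →L[ℂ] ℂ) (v : E) (h : l v = 1) (p : LinearMap.ker l.toLinearMap × ℂ) :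
    splitEquiv l v h p = p.1 + p.2 • v := rfl

lemma apply_splitEquiv {E : Type} [NormedAddCommGroup E] [NormedSpace ℂ E] [FiniteDimensional ℂ E]
    (l : E →L[ℂ] ℂ) (v : E) (h : l v = 1) (p : LinearMap.ker l.toLinearMap × ℂ) :
    l (splitEquiv l v h p) = p.2 := by
  have : l p.1 = 0 := p.1.2
  simp [splitEquiv_apply, h, this]

/-- Weierstrass division by the coordinate l, with d = 1. The remainder depends only on the
variables of the hyperplane and agrees with f there, so it vanishes near the origin. -/
lemma exists_eq_mul_at_zero {E : Type} [NormedAddCommGroup E] [NormedSpace ℂ E]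
    [FiniteDimensional ℂ E] (l : E →L[ℂ] ℂ) (hl : l ≠ 0) {f : E → ℂ} (hf : AnalyticAt ℂ f 0)
    (h : ∀ᶠ z in 𝓝 0, l z = 0 → f z = 0) :
    ∃ q : E → ℂ, AnalyticAt ℂ q 0 ∧ ∀ᶠ z in 𝓝 0, f z = l z * q z := by
  obtain ⟨v', hv'⟩ : ∃ v, l v ≠ 0 := by
    by_contra! hc
    exact hl (ContinuousLinearMap.ext hc)
  set v := (l v')⁻¹ • v'
  have hv : l v = 1 := by simp [v, hv']
  set e := splitEquiv l v hv
  have hfe : AnalyticAt ℂ (f ∘ e) 0 :=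
    AnalyticAt.comp (g := f) (by rw [map_zero]; exact hf) (e.analyticAt 0)
  obtain ⟨q, a, hq, ha, hqa⟩ := weierstrass_division (f := f ∘ e)
    (g := fun p ↦ p.2) (d := 1) (u := fun _ ↦ 1) hfe analyticAt_snd analyticAt_const one_ne_zero
    (by simp)
  have hcont : Tendsto e (𝓝 0) (𝓝 0) := by
    simpa using e.continuous.tendsto 0
  have hcont' : Tendsto e.symm (𝓝 0) (𝓝 0) := by
    simpa using e.symm.continuous.tendsto 0
  have hi : Tendsto (fun p : LinearMap.ker l.toLinearMap × ℂ ↦ (p.1, (0 : ℂ))) (𝓝 0) (𝓝 0) := by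
    have : Continuous (fun p : LinearMap.ker l.toLinearMap × ℂ ↦ (p.1, (0 : ℂ))) := by fun_prop
    exact this.tendsto' 0 0 rfl
  refine ⟨q ∘ e.symm, AnalyticAt.comp (g := q) (by rw [map_zero]; exact hq)
    (e.symm.analyticAt 0), ?_⟩
  have hev : ∀ᶠ p in 𝓝 (0 : LinearMap.ker l.toLinearMap × ℂ), f (e p) = p.2 * q p := by
    filter_upwards [hqa, hi.eventually hqa, hi.eventually (hcont.eventually h)] with p h1 h2 h3
    have h4 : l (e (p.1, 0)) = 0 := apply_splitEquiv l v hv _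
    simp only [Function.comp_apply, h3 h4, mul_zero, zero_add, Finset.univ_unique,
      Fin.default_eq_zero, Fin.val_zero, pow_zero, mul_one, Finset.sum_singleton] at h1 h2
    rw [h1, ← h2, add_zero, mul_comm]
  filter_upwards [hcont'.eventually hev] with z hz
  have h5 := apply_splitEquiv l v hv (e.symm z)
  change l (e (e.symm z)) = _ at h5
  rw [ContinuousLinearEquiv.apply_symm_apply] at hz h5
  rw [hz, h5]
  rfl

/-- A holomorphic function vanishing on a hyperplane is divisible by its equation. -/
lemma exists_eq_mul_of_vanishing {E : Type} [NormedAddCommGroup E] [NormedSpace ℂ E]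
    [FiniteDimensional ℂ E] (l : E →L[ℂ] ℂ) (hl : l ≠ 0) {f : E → ℂ} {x : E} (hx : l x = 0)
    (hf : AnalyticAt ℂ f x) (h : ∀ᶠ z in 𝓝 x, l z = 0 → f z = 0) :
    ∃ q : E → ℂ, AnalyticAt ℂ q x ∧ ∀ᶠ z in 𝓝 x, f z = l z * q z := by
  have ht : Tendsto (fun z ↦ z + x) (𝓝 0) (𝓝 x) := by
    have : Continuous (fun z : E ↦ z + x) := by fun_prop
    simpa using this.tendsto 0
  have ht' : Tendsto (fun z ↦ z - x) (𝓝 x) (𝓝 0) := by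
    have : Continuous (fun z : E ↦ z - x) := by fun_prop
    simpa using this.tendsto x
  obtain ⟨q, hq, hqe⟩ := exists_eq_mul_at_zero l hl (f := fun z ↦ f (z + x))
    (AnalyticAt.comp (g := f) (f := fun z ↦ z + x) (by rw [zero_add]; exact hf) (by fun_prop))
    (by
      filter_upwards [ht.eventually h] with z hz hlz
      exact hz (by rw [map_add, hlz, hx, add_zero]))
  refine ⟨fun z ↦ q (z - x), AnalyticAt.comp (g := q) (f := fun z ↦ z - x)
    (by rw [sub_self]; exact hq) (by fun_prop), ?_⟩
  filter_upwards [ht'.eventually hqe] with z hz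
  simpa [hx] using hz

/-- The ring of functions on `E` which are analytic at the origin. -/
def anRing (E : Type) [NormedAddCommGroup E] [NormedSpace ℂ E] : Subring (E → ℂ) where
  carrier := {f | AnalyticAt ℂ f 0}
  mul_mem' hf hg := hf.mul hg
  one_mem' := analyticAt_const
  add_mem' hf hg := hf.add hg
  zero_mem' := analyticAt_const
  neg_mem' hf := hf.neg

section anRing

variable {E E' : Type} [NormedAddCommGroup E'] [NormedSpace ℂ E'] [NormedAddCommGroup E]
  [NormedSpace ℂ E]

/-- Evaluation at a point. -/
def anEval (z : E) : anRing E →+* ℂ := (Pi.evalRingHom (fun _ : E ↦ ℂ) z).comp (anRing E).subtype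

@[simp] lemma anEval_apply (z : E) (f : anRing E) : anEval z f = f.1 z := rfl

/-- Composition with a continuous linear map. -/
def anComp (l : E →L[ℂ] E') : anRing E' →+* anRing E where
  toFun f := ⟨fun z ↦ f.1 (l z), AnalyticAt.comp (g := f.1) (by rw [map_zero]; exact f.2)
    (l.analyticAt 0)⟩
  map_one' := rfl
  map_mul' _ _ := rfl
  map_zero' := rfl
  map_add' _ _ := rfl

@[simp] lemma anComp_apply (l : E →L[ℂ] E') (f : anRing E') (z : E) :
    (anComp l f).1 z = f.1 (l z) := rfl

/-- The ideal contains all functions which vanish near the origin. -/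
def IsGermIdeal (P : Ideal (anRing E)) : Prop := ∀ f : anRing E, (∀ᶠ z in 𝓝 0, f.1 z = 0) → f ∈ P

lemma IsGermIdeal.comap {P : Ideal (anRing E)} (hP : IsGermIdeal P) (l : E →L[ℂ] E') :
    IsGermIdeal (P.comap (anComp l)) := by
  intro f hf
  refine hP _ ?_
  have : Tendsto l (𝓝 0) (𝓝 0) := by simpa using l.continuous.tendsto 0
  exact this.eventually hf

lemma IsGermIdeal.mem_of_eventually_eq {P : Ideal (anRing E)} (hP : IsGermIdeal P)
    {f g : anRing E} (h : ∀ᶠ z in 𝓝 0, f.1 z = g.1 z) (hg : g ∈ P) : f ∈ P := by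
  have : f - g ∈ P := hP _ (by filter_upwards [h] with z hz; simp [hz])
  simpa using P.add_mem this hg

/-- A function that is not zero at the origin is invertible near it. -/
lemma IsGermIdeal.apply_zero {P : Ideal (anRing E)} (hP : IsGermIdeal P) (h1 : P ≠ ⊤)
    {f : anRing E} (hf : f ∈ P) : f.1 0 = 0 := by
  by_contra h0
  refine h1 ((Ideal.eq_top_iff_one _).2 (hP.mem_of_eventually_eq (g := ⟨fun z ↦ (f.1 z)⁻¹,
    f.2.inv h0⟩ * f) ?_ (P.mul_mem_left _ hf)))
  filter_upwards [f.2.continuousAt.eventually_ne h0] with z hz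
  exact (inv_mul_cancel₀ hz).symm

/-- Every prime ideal of germs is determined by its zeros: finitely many of its elements have
common zeros, arbitrarily close to the origin, where a given function outside it is not zero. -/
def PrimesHaveZeros (E : Type) [NormedAddCommGroup E] [NormedSpace ℂ E] : Prop :=
  ∀ P : Ideal (anRing E), P.IsPrime → IsGermIdeal P → ∀ s : Finset (anRing E), (∀ g ∈ s, g ∈ P) →
    ∀ f ∉ P, ∃ᶠ z in 𝓝 (0 : E), (∀ g ∈ s, g.1 z = 0) ∧ f.1 z ≠ 0

/-- Pseudo-division by an element of minimal degree of an ideal of polynomials. -/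
lemma exists_pow_mul_eq_mul {A : Type*} [CommRing A] [IsDomain A] (I : Ideal A[X]) {μ : A[X]}
    (hμ : μ ∈ I) (hdeg : 0 < μ.natDegree)
    (hmin : ∀ r ∈ I, r ≠ 0 → μ.natDegree ≤ r.natDegree) (r : A[X]) (hr : r ∈ I) :
    ∃ (k : ℕ) (s : A[X]), C (μ.leadingCoeff ^ k) * r = μ * s := by
  induction hn : r.natDegree using Nat.strong_induction_on generalizing r with
  | _ n ih =>
    by_cases hr0 : r = 0
    · exact ⟨0, 0, by simp [hr0]⟩
    have hle := hmin r hr hr0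
    -- Cancelling the leading term of r lowers the degree at the cost of one more factor of the
    -- leading coefficient of μ.
    have hlt := natDegree_cancelLeads_lt_of_natDegree_le_natDegree hle (hdeg.trans_le hle)
    have hmem : μ.cancelLeads r ∈ I := I.sub_mem (I.mul_mem_left _ hr) (I.mul_mem_left _ hμ)
    obtain ⟨k, s, hs⟩ := ih _ (hn ▸ hlt) _ hmem rfl
    refine ⟨k + 1, s + C (μ.leadingCoeff ^ k) * (C r.leadingCoeff * X ^ (r.natDegree - μ.natDegree)),
      ?_⟩
    have h0 : μ.natDegree - r.natDegree = 0 := Nat.sub_eq_zero_of_le hle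
    rw [cancelLeads, h0, pow_zero, mul_one] at hs
    rw [mul_add, ← hs, pow_succ, C_mul]
    ring

/-- The function on `E × ℂ` given by a polynomial with coefficients in the functions on `E`. -/
def polyFun (r : (anRing E)[X]) : anRing (E × ℂ) :=
  r.eval₂ (anComp (ContinuousLinearMap.fst ℂ E ℂ)) ⟨fun p ↦ p.2, analyticAt_snd⟩

lemma polyFun_apply (r : (anRing E)[X]) (p : E × ℂ) :
    (polyFun r).1 p = (r.map (anEval p.1)).eval p.2 := by
  have h := hom_eval₂ r (anComp (ContinuousLinearMap.fst ℂ E ℂ)) (anEval p)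
    ⟨fun p ↦ p.2, analyticAt_snd⟩
  rw [Polynomial.eval_map]
  exact h

/-- A nonzero polynomial of degree less than d has order less than d at 0. This makes the lower
coefficients of a Weierstrass polynomial vanish at the origin. -/
lemma coeff_eq_zero_of_eventually {d : ℕ} (a : Fin d → ℂ) {v : ℂ → ℂ} (hv : ContinuousAt v 0)
    (h : ∀ᶠ t in 𝓝 (0 : ℂ), ∑ j, a j * t ^ (j : ℕ) = t ^ d * v t) : a = 0 := by
  set pol : ℂ[X] := ∑ j, C (a j) * X ^ (j : ℕ) with hpol
  have heval : ∀ t, pol.eval t = ∑ j, a j * t ^ (j : ℕ) := fun t ↦ by simp [hpol, eval_finsetSum]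
  have hcoeff : ∀ j : Fin d, pol.coeff j = a j := by
    intro j
    simp [hpol, coeff_X_pow, Fin.val_inj]
  have hdeg : pol.degree < d := degree_sum_fin_lt a
  by_contra ha
  have hpol0 : pol ≠ 0 := by
    intro h0
    apply ha
    ext j
    simp [← hcoeff, h0]
  obtain ⟨p', hp', hnd⟩ := exists_eq_pow_rootMultiplicity_mul_and_not_dvd pol hpol0 0
  set k := pol.rootMultiplicity 0
  rw [C_0, sub_zero] at hp' hnd
  have hk : k < d := by
    have h1 : (X ^ k : ℂ[X]).degree ≤ pol.degree :=
      degree_le_of_dvd (Dvd.intro _ hp'.symm) hpol0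
    rw [degree_X_pow] at h1
    exact_mod_cast h1.trans_lt hdeg
  have h2 : Tendsto (fun t : ℂ ↦ t ^ (d - k) * v t) (𝓝[≠] 0) (𝓝 0) := by
    have : ContinuousAt (fun t : ℂ ↦ t ^ (d - k) * v t) 0 := by fun_prop
    have h3 := this.tendsto
    simp only [zero_pow (Nat.sub_ne_zero_of_lt hk), zero_mul] at h3
    exact h3.mono_left nhdsWithin_le_nhds
  have h4 : Tendsto (fun t : ℂ ↦ p'.eval t) (𝓝[≠] 0) (𝓝 (p'.eval 0)) :=
    (p'.continuous.tendsto 0).mono_left nhdsWithin_le_nhds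
  have h5 : p'.eval 0 = 0 := by
    refine tendsto_nhds_unique h4 (h2.congr' ?_)
    filter_upwards [self_mem_nhdsWithin, nhdsWithin_le_nhds h] with t ht0 ht
    have ht0' : t ^ k ≠ 0 := pow_ne_zero _ ht0
    apply mul_left_cancel₀ ht0'
    rw [← heval, hp', eval_mul, eval_pow, eval_X] at ht
    rw [ht, ← mul_assoc, ← pow_add, Nat.add_sub_cancel' hk.le]
  exact hnd (X_dvd_iff.2 (by rw [coeff_zero_eq_eval_zero, h5]))

/-- If ‖w‖ ≥ ε, then each ‖w‖ ^ j * ε ^ d with j < d is at most ‖w‖ ^ d, and the equation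
contradicts `ha`. It keeps the roots of a Weierstrass polynomial close to 0. -/
lemma norm_lt_of_small_coeff {d : ℕ} (a : Fin d → ℂ) {ε : ℝ} (hε : 0 < ε) (hε1 : ε ≤ 1)
    (ha : ∑ j, ‖a j‖ < ε ^ d) {w : ℂ} (hw : w ^ d = ∑ j, a j * w ^ (j : ℕ)) : ‖w‖ < ε := by
  by_contra! hc
  have hw0 : 0 < ‖w‖ := hε.trans_le hc
  have h1 : ‖w‖ ^ d * ε ^ d ≤ (∑ j, ‖a j‖) * ‖w‖ ^ d := by
    rw [← norm_pow, hw]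
    calc _ ≤ (∑ j, ‖a j‖ * ‖w‖ ^ (j : ℕ)) * ε ^ d := by
          gcongr
          refine (norm_sum_le _ _).trans (Finset.sum_le_sum fun j _ ↦ ?_)
          rw [norm_mul, norm_pow]
      _ = ∑ j, ‖a j‖ * (‖w‖ ^ (j : ℕ) * ε ^ d) := by rw [Finset.sum_mul]; simp only [mul_assoc]
      _ ≤ ∑ j, ‖a j‖ * ‖w‖ ^ d := by
          gcongr with j
          calc ‖w‖ ^ (j : ℕ) * ε ^ d ≤ ‖w‖ ^ (j : ℕ) * ε ^ (d - (j : ℕ)) := by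
                gcongr ?_ * ?_
                exact pow_le_pow_of_le_one hε.le hε1 (Nat.sub_le _ _)
            _ ≤ ‖w‖ ^ (j : ℕ) * ‖w‖ ^ (d - (j : ℕ)) := by gcongr
            _ = ‖w‖ ^ d := by rw [← pow_add, Nat.add_sub_cancel' j.2.le]
      _ = _ := by
        rw [← hw, norm_pow, Finset.sum_mul]
  have h2 : (∑ j, ‖a j‖) * ‖w‖ ^ d < ε ^ d * ‖w‖ ^ d := by gcongr
  linarith [mul_comm (‖w‖ ^ d) (ε ^ d)]

end anRing

end Nullstellensatz

/-! ### Zeros of prime ideals and the local Nullstellensatz. -/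

section Nullstellensatz

open Set Metric Filter Topology Polynomial

variable {E E' : Type} [NormedAddCommGroup E'] [NormedSpace ℂ E'] [NormedAddCommGroup E]
  [NormedSpace ℂ E]

lemma polyFun_remainder {d : ℕ} (a : Fin d → anRing E) (p : E × ℂ) :
    (polyFun (∑ j, C (a j) * X ^ (j : ℕ))).1 p = ∑ j, (a j).1 p.1 * p.2 ^ (j : ℕ) := by
  simp [polyFun_apply, Polynomial.map_sum, eval_finsetSum]

lemma polyFun_sub (r s : (anRing E)[X]) : polyFun (r - s) = polyFun r - polyFun s :=
  eval₂_sub _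

/-- A prime ideal containing a function which is regular in the last variable contains a
Weierstrass polynomial. -/
lemma exists_weierstrass_polynomial [FiniteDimensional ℂ E] {P : Ideal (anRing (E × ℂ))}
    (hPg : IsGermIdeal P) {g : anRing (E × ℂ)} (hg : g ∈ P)
    (hreg : ¬ ∀ᶠ t in 𝓝 (0 : ℂ), g.1 (0, t) = 0) :
    ∃ (d : ℕ) (a : Fin d → anRing E), (∀ j, (a j).1 0 = 0) ∧
      polyFun (X ^ d - ∑ j, C (a j) * X ^ (j : ℕ)) ∈ P := by
  have hg0 : AnalyticAt ℂ (fun t : ℂ ↦ g.1 (0, t)) 0 :=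
    AnalyticAt.comp (g := g.1) (f := fun t : ℂ ↦ ((0 : E), t)) g.2 (by fun_prop)
  obtain ⟨d, u, hu, hu0, hgu⟩ := hg0.exists_eventuallyEq_pow_smul_nonzero_iff.2 hreg
  simp only [sub_zero, smul_eq_mul] at hgu
  -- Dividing w ^ d by g, the difference of w ^ d and the remainder is q g, near the origin, and
  -- lies in P. On the line z = 0 the remainder is t ^ d (1 - q u), so its coefficients vanish at
  -- the origin.
  obtain ⟨q, a, hq, ha, hqa⟩ := weierstrass_division (f := fun p : E × ℂ ↦ p.2 ^ d)
    (analyticAt_snd.pow d) g.2 hu hu0 hgu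
  refine ⟨d, fun j ↦ ⟨a j, ha j⟩, ?_, ?_⟩
  · have hi : Tendsto (fun t : ℂ ↦ ((0 : E), t)) (𝓝 0) (𝓝 0) :=
      Continuous.tendsto' (by fun_prop) _ _ rfl
    have hv : AnalyticAt ℂ (fun t : ℂ ↦ 1 - q (0, t) * u t) 0 :=
      analyticAt_const.sub ((AnalyticAt.comp (g := q) (f := fun t : ℂ ↦ ((0 : E), t)) hq
        (by fun_prop)).mul hu)
    have := coeff_eq_zero_of_eventually (fun j ↦ a j 0) hv.continuousAt (by
      filter_upwards [hi.eventually hqa, hgu] with t h1 h2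
      rw [h2] at h1
      linear_combination -h1)
    exact fun j ↦ congrFun this j
  · refine hPg.mem_of_eventually_eq (g := ⟨q, hq⟩ * g) ?_ (P.mul_mem_left _ hg)
    filter_upwards [hqa] with p hp
    rw [polyFun_sub]
    change (polyFun (X ^ d)).1 p - (polyFun (∑ j, C (⟨a j, ha j⟩ : anRing E) * X ^ (j : ℕ))).1 p =
      q p * g.1 p
    rw [polyFun_remainder, polyFun_apply]
    simp only [Polynomial.map_pow, map_X, eval_pow, eval_X]
    rw [hp]
    ring

lemma exists_remainder [FiniteDimensional ℂ E] {d : ℕ} {a : Fin d → anRing E}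
    (ha : ∀ j, (a j).1 0 = 0) (f : anRing (E × ℂ)) :
    ∃ (q : anRing (E × ℂ)) (r : (anRing E)[X]), ∀ᶠ p in 𝓝 0,
      f.1 p = q.1 p * (polyFun (X ^ d - ∑ j, C (a j) * X ^ (j : ℕ))).1 p + (polyFun r).1 p := by
  obtain ⟨q, b, hq, hb, hqb⟩ := weierstrass_division f.2
    (polyFun (X ^ d - ∑ j, C (a j) * X ^ (j : ℕ))).2 (d := d) (u := fun _ ↦ 1) analyticAt_const
    one_ne_zero (Eventually.of_forall fun t ↦ by
      rw [polyFun_sub]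
      change (polyFun (X ^ d)).1 (0, t) - (polyFun (∑ j, C (a j) * X ^ (j : ℕ))).1 (0, t) = _
      rw [polyFun_remainder, polyFun_apply]
      simp [ha])
  refine ⟨⟨q, hq⟩, ∑ j : Fin d, C (⟨b j, hb j⟩ : anRing E) * X ^ (j : ℕ), ?_⟩
  filter_upwards [hqb] with p hp
  rw [polyFun_remainder]
  exact hp

/-- The value r(w) is integral over the image of φ, and in a domain the ideal of a nonzero integral
element meets the base ring nontrivially. For germs, it replaces f by a function of the first
variables. -/
lemma exists_multiple_in_range {R B : Type*} [CommRing R] [CommRing B] [IsDomain B] (φ : R →+* B)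
    (w : B) {W : R[X]} (hW : W.Monic) (hW0 : W.eval₂ φ w = 0) (r : R[X])
    (hr : r.eval₂ φ w ≠ 0) : ∃ h, φ h ≠ 0 ∧ r.eval₂ φ w ∣ φ h := by
  have hpoly : ∀ r : R[X], r.eval₂ φ w = aeval w (r.map φ.rangeRestrict) := by
    intro r
    rw [aeval_def, eval₂_map]
    rfl
  have hwint : IsIntegral φ.range w := by
    refine ⟨W.map φ.rangeRestrict, hW.map _, ?_⟩
    rw [← aeval_def, ← hpoly, hW0]
  have hfint : IsIntegral φ.range (r.eval₂ φ w) := by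
    rw [hpoly]
    exact adjoin_le_integralClosure hwint (aeval_mem_adjoin_singleton _ _)
  obtain ⟨x, hx, hx0⟩ := Submodule.exists_mem_ne_zero_of_ne_bot
    (Ideal.comap_ne_bot_of_integral_mem hr (Ideal.mem_span_singleton_self _) hfint)
  obtain ⟨h, rfl⟩ := φ.rangeRestrict_surjective x
  exact ⟨h, fun h0 ↦ hx0 (Subtype.ext h0), Ideal.mem_span_singleton.1 hx⟩

/-- An algebraic element satisfies, up to denominators, a relation which divides all others. -/
lemma exists_minimal_relation {R B : Type*} [CommRing R] [CommRing B] [IsDomain B] (φ : R →+* B)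
    (w : B) {W : R[X]} (hW : W.Monic) (hW0 : W.eval₂ φ w = 0) :
    ∃ (μ : R[X]) (n : ℕ), 0 < n ∧ φ (μ.coeff n) ≠ 0 ∧ ∀ r : R[X], r.eval₂ φ w = 0 →
      ∃ (k : ℕ) (s : R[X]), ∀ i, φ ((C (μ.coeff n ^ k) * r - μ * s).coeff i) = 0 := by
  have hpoly : ∀ r : R[X], r.eval₂ φ w = aeval w (r.map φ.rangeRestrict) := by
    intro r
    rw [aeval_def, eval₂_map]
    rfl
  set I : Ideal (φ.range)[X] := RingHom.ker (aeval (R := φ.range) w).toRingHom with hI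
  have hImem : ∀ r, r ∈ I ↔ aeval (R := φ.range) w r = 0 := fun r ↦ Iff.rfl
  obtain ⟨μ', ⟨hμ'I, hμ'0⟩, hmin⟩ : ∃ μ' : (φ.range)[X], (μ' ∈ I ∧ μ' ≠ 0) ∧
      ∀ r, r ∈ I ∧ r ≠ 0 → μ'.natDegree ≤ r.natDegree := by
    have hne : ∃ r : (φ.range)[X], r ∈ I ∧ r ≠ 0 := by
      refine ⟨W.map φ.rangeRestrict, ?_, (hW.map _).ne_zero⟩
      rw [hImem, ← hpoly, hW0]
    obtain ⟨m, hm, hm'⟩ := WellFounded.has_min (measure (natDegree (R := φ.range))).wf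
      {r | r ∈ I ∧ r ≠ 0} hne
    exact ⟨m, hm, fun r hr ↦ not_lt.1 (hm' r hr)⟩
  have hμdeg : 0 < μ'.natDegree := by
    by_contra h0
    have h1 := eq_C_of_natDegree_eq_zero (Nat.eq_zero_of_not_pos h0)
    have h2 := (hImem _).1 hμ'I
    rw [h1, aeval_C] at h2
    have h3 : μ'.coeff 0 = 0 := Subtype.ext h2
    exact hμ'0 (by rw [h1, h3, C_0])
  -- The lift to R may have terms of degree above that of the minimal relation, with coefficients in
  -- the kernel of φ; hence the conclusion speaks of the coefficient of index n.
  obtain ⟨μ, hμ⟩ := Polynomial.map_surjective _ φ.rangeRestrict_surjective μ'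
  have hcμ : φ.rangeRestrict (μ.coeff μ'.natDegree) = μ'.leadingCoeff := by
    rw [← coeff_map, hμ]; rfl
  refine ⟨μ, μ'.natDegree, hμdeg, fun h0 ↦ hμ'0 ?_, fun r hr ↦ ?_⟩
  · rw [← leadingCoeff_eq_zero, ← hcμ]
    exact Subtype.ext h0
  · obtain ⟨k, s', hs'⟩ := exists_pow_mul_eq_mul I hμ'I hμdeg (fun r h1 h2 ↦ hmin r ⟨h1, h2⟩)
      (r.map φ.rangeRestrict) (by rw [hImem, ← hpoly, hr])
    obtain ⟨s, rfl⟩ := Polynomial.map_surjective _ φ.rangeRestrict_surjective s'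
    refine ⟨k, s, fun i ↦ ?_⟩
    have h1 : (C (μ.coeff μ'.natDegree ^ k) * r - μ * s).map φ.rangeRestrict = 0 := by
      rw [Polynomial.map_sub, Polynomial.map_mul, Polynomial.map_mul, hμ, ← hs', map_C, map_pow,
        hcμ, sub_self]
    have h2 := congrArg (fun r ↦ coeff r i) h1
    simp only [coeff_map, coeff_zero] at h2
    exact congrArg Subtype.val h2

/-- P contains a Weierstrass polynomial W, so modulo P every function is a polynomial in w over the
functions on E, and w is integral. Some multiple f u is congruent to a function h of z outside P.
Let μ be a minimal relation for w, with coefficient c outside P; each polynomial r in P satisfies c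
^ k r = μ S up to coefficients in the contracted ideal. By induction there is z near 0 where these
coefficients vanish and c h does not. A root t of μ(z, ·) kills all the polynomials, W among them,
so t is small; and f(z, t) u(z, t) = h(z) ≠ 0. -/
lemma zeros_of_regular [FiniteDimensional ℂ E] (hE : PrimesHaveZeros E)
    {P : Ideal (anRing (E × ℂ))} (hP : P.IsPrime) (hPg : IsGermIdeal P) {g : anRing (E × ℂ)}
    (hg : g ∈ P) (hreg : ¬ ∀ᶠ t in 𝓝 (0 : ℂ), g.1 (0, t) = 0) (s : Finset (anRing (E × ℂ)))
    (hs : ∀ g ∈ s, g ∈ P) (f : anRing (E × ℂ)) (hf : f ∉ P) :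
    ∃ᶠ z in 𝓝 (0 : E × ℂ), (∀ g ∈ s, g.1 z = 0) ∧ f.1 z ≠ 0 := by
  classical
  obtain ⟨d, a, ha, hW⟩ := exists_weierstrass_polynomial hPg hg hreg
  set W : (anRing E)[X] := X ^ d - ∑ j, C (a j) * X ^ (j : ℕ) with hWdef
  have hWmonic : W.Monic := by
    refine monic_X_pow_sub ?_
    exact (degree_sum_fin_lt a)
  choose q r hqr using exists_remainder (E := E) ha
  have hr_sub : ∀ f, f - polyFun (r f) ∈ P := fun f ↦
    hPg.mem_of_eventually_eq (g := q f * polyFun W) (by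
      filter_upwards [hqr f] with p hp
      change f.1 p - (polyFun (r f)).1 p = (q f).1 p * (polyFun W).1 p
      rw [hp]; ring) (P.mul_mem_left _ hW)
  set ι : anRing E →+* anRing (E × ℂ) := anComp (ContinuousLinearMap.fst ℂ E ℂ) with hι
  set φ : anRing E →+* anRing (E × ℂ) ⧸ P := (Ideal.Quotient.mk P).comp ι with hφ
  have hφ0 : ∀ x, φ x = 0 ↔ x ∈ P.comap ι := fun x ↦ Ideal.Quotient.eq_zero_iff_mem
  let w : anRing (E × ℂ) ⧸ P := Ideal.Quotient.mk P ⟨fun p ↦ p.2, analyticAt_snd⟩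
  have hpoly : ∀ r : (anRing E)[X], Ideal.Quotient.mk P (polyFun r) = r.eval₂ φ w := fun r ↦
    hom_eval₂ _ _ _ _
  have hW0 : W.eval₂ φ w = 0 := by rw [← hpoly]; exact Ideal.Quotient.eq_zero_iff_mem.2 hW
  obtain ⟨h, hh, u, hu⟩ : ∃ h : anRing E, h ∉ P.comap ι ∧ ∃ u, ι h - f * u ∈ P := by
    have hf1 : Ideal.Quotient.mk P f = (r f).eval₂ φ w := by
      rw [← hpoly, Ideal.Quotient.eq]
      exact hr_sub f
    obtain ⟨h, hh, y, hy⟩ := exists_multiple_in_range φ w hWmonic hW0 (r f) (by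
      rw [← hf1]
      exact fun h ↦ hf (Ideal.Quotient.eq_zero_iff_mem.1 h))
    obtain ⟨u, rfl⟩ := Ideal.Quotient.mk_surjective y
    refine ⟨h, fun hmem ↦ hh ((hφ0 h).2 hmem), u, ?_⟩
    rw [← Ideal.Quotient.eq, map_mul, hf1, ← hy]
    rfl
  obtain ⟨μ, n, hn, hcP, hdiv⟩ := exists_minimal_relation φ w hWmonic hW0
  set c := μ.coeff n with hc
  rw [ne_eq, hφ0] at hcP
  simp only [hφ0, ← hpoly, Ideal.Quotient.eq_zero_iff_mem] at hdiv
  choose! k S hkS using hdiv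
  -- The extra equation forces f u = h at the zero to be constructed, hence f ≠ 0 there.
  set s' := insert (ι h - f * u) s with hs'
  have hs'P : ∀ g ∈ s', g ∈ P := by
    intro g hg
    rcases Finset.mem_insert.1 hg with rfl | hg
    · exact hu
    · exact hs g hg
  set T : Finset (anRing E)[X] := insert W (s'.image r) with hT
  have hTP : ∀ r' ∈ T, polyFun r' ∈ P := by
    intro r' hr'
    rcases Finset.mem_insert.1 hr' with rfl | hr'
    · exact hW
    · obtain ⟨g, hg, rfl⟩ := Finset.mem_image.1 hr'
      have := P.sub_mem (hs'P g hg) (hr_sub g)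
      rwa [sub_sub_cancel] at this
  set N : Finset (anRing E) := T.biUnion fun r' ↦ (C (c ^ k r') * r' - μ * S r').coeffs with hN
  have hNP : ∀ x ∈ N, x ∈ P.comap ι := by
    intro x hx
    obtain ⟨r', hr', hx⟩ := Finset.mem_biUnion.1 hx
    obtain ⟨i, _, rfl⟩ := mem_coeffs_iff.1 hx
    exact hkS r' (hTP r' hr') i
  have hprime : (P.comap ι).IsPrime := Ideal.comap_isPrime ι P
  have hfreq := hE (P.comap ι) hprime (hPg.comap _) N hNP (c * h)
    (fun hmem ↦ (hprime.mem_or_mem hmem).elim hcP hh)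
  rw [frequently_iff]
  intro U hU
  have hev : ∀ᶠ p in 𝓝 (0 : E × ℂ), p ∈ U ∧ ∀ g ∈ s',
      g.1 p = (q g).1 p * (polyFun W).1 p + (polyFun (r g)).1 p :=
    (show ∀ᶠ p in 𝓝 (0 : E × ℂ), p ∈ U from hU).and
      ((Finset.eventually_all s').2 fun g _ ↦ hqr g)
  obtain ⟨ε', hε', hball⟩ := Metric.eventually_nhds_iff_ball.1 hev
  set ε := min ε' 1
  have hε : 0 < ε := lt_min hε' one_pos
  have hsmall : ∀ᶠ z in 𝓝 (0 : E), ∑ j, ‖(a j).1 z‖ < ε ^ d := by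
    have hcont : ContinuousAt (fun z ↦ ∑ j, ‖(a j).1 z‖) 0 :=
      tendsto_finsetSum _ fun j _ ↦ (a j).2.continuousAt.norm
    refine hcont.eventually (gt_mem_nhds ?_)
    simp only [ha, norm_zero, Finset.sum_const_zero]
    positivity
  obtain ⟨z, ⟨hz1, hz2⟩, hz3, hz4⟩ :=
    (hfreq.and_eventually (hsmall.and (ball_mem_nhds (0 : E) hε))).exists
  have hz2' : c.1 z * h.1 z ≠ 0 := hz2
  have hcz : c.1 z ≠ 0 := left_ne_zero_of_mul hz2'
  have hhz : h.1 z ≠ 0 := right_ne_zero_of_mul hz2'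
  -- Since n > 0 and c(z) ≠ 0, the specialised polynomial is not constant.
  obtain ⟨t, ht⟩ : ∃ t, (μ.map (anEval z)).IsRoot t := by
    apply IsAlgClosed.exists_root
    intro h0
    have h1 : (μ.map (anEval z)).coeff n ≠ 0 := by
      rw [coeff_map, anEval_apply]; exact hcz
    have h2 := le_natDegree_of_ne_zero h1
    have h3 := natDegree_eq_of_degree_eq_some (n := 0) h0
    omega
  have hTz : ∀ r' ∈ T, (polyFun r').1 (z, t) = 0 := by
    intro r' hr'
    have h1 : (C (c ^ k r') * r' - μ * S r').map (anEval z) = 0 := by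
      ext i
      rw [coeff_map, coeff_zero]
      by_cases h0 : (C (c ^ k r') * r' - μ * S r').coeff i = 0
      · rw [h0, map_zero]
      · exact hz1 _ (Finset.mem_biUnion.2 ⟨r', hr', coeff_mem_coeffs h0⟩)
    have h2 := congrArg (Polynomial.eval t) h1
    rw [Polynomial.map_sub, Polynomial.map_mul, Polynomial.map_mul, eval_sub, eval_mul, eval_mul,
      ht.eq_zero, zero_mul, sub_zero, map_C, eval_C, map_pow, eval_zero] at h2
    rw [polyFun_apply]
    exact (mul_eq_zero.1 h2).resolve_left (pow_ne_zero _ hcz)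
  have hWz := hTz W (Finset.mem_insert_self _ _)
  have ht' : ‖t‖ < ε := by
    refine norm_lt_of_small_coeff (fun j ↦ (a j).1 z) hε (min_le_right _ _) hz3 ?_
    rw [hWdef, polyFun_sub] at hWz
    change (polyFun (X ^ d)).1 (z, t) - (polyFun (∑ j, C (a j) * X ^ (j : ℕ))).1 (z, t) = _ at hWz
    rw [polyFun_remainder, polyFun_apply] at hWz
    simpa [sub_eq_zero] using hWz
  have hmem : (z, t) ∈ ball (0 : E × ℂ) ε' := by
    rw [← Prod.mk_zero_zero, ← ball_prod_same]
    exact ⟨ball_subset_ball (min_le_left _ _) hz4,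
      mem_ball_zero_iff.2 (ht'.trans_le (min_le_left _ _))⟩
  obtain ⟨hU', hg'⟩ := hball _ hmem
  have hzero : ∀ g ∈ s', g.1 (z, t) = 0 := fun g hg ↦ by
    rw [hg' g hg, hWz, hTz (r g) (Finset.mem_insert_of_mem (Finset.mem_image_of_mem r hg)),
      mul_zero, add_zero]
  refine ⟨(z, t), hU', fun g hg ↦ hzero g (Finset.mem_insert_of_mem hg), fun h0 ↦ hhz ?_⟩
  have h1 := hzero _ (Finset.mem_insert_self _ _)
  change h.1 z - f.1 (z, t) * u.1 (z, t) = 0 at h1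
  rw [h0, zero_mul, sub_zero] at h1
  exact h1

lemma frequently_zeros_of_equiv {e : E' ≃L[ℂ] E}
    {P : Ideal (anRing E)} (s : Finset (anRing E)) (hs : ∀ g ∈ s, g ∈ P) (f : anRing E) (hf : f ∉ P)
    (h : ∀ (s' : Finset (anRing E')),
      (∀ g ∈ s', g ∈ P.comap (anComp (e.symm : E →L[ℂ] E'))) →
      ∀ f' ∉ P.comap (anComp (e.symm : E →L[ℂ] E')),
        ∃ᶠ z in 𝓝 (0 : E'), (∀ g ∈ s', g.1 z = 0) ∧ f'.1 z ≠ 0) :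
    ∃ᶠ z in 𝓝 (0 : E), (∀ g ∈ s, g.1 z = 0) ∧ f.1 z ≠ 0 := by
  classical
  have hinv : ∀ g : anRing E, anComp (e.symm : E →L[ℂ] E') (anComp (e : E' →L[ℂ] E) g) = g := by
    intro g
    ext z
    simp
  have := h (s.image (anComp (e : E' →L[ℂ] E))) (by
    intro g' hg'
    obtain ⟨g, hg, rfl⟩ := Finset.mem_image.1 hg'
    rw [Ideal.mem_comap, hinv]
    exact hs g hg) (anComp (e : E' →L[ℂ] E) f) (by rwa [Ideal.mem_comap, hinv])
  have ht : Tendsto e (𝓝 0) (𝓝 0) := by simpa using e.continuous.tendsto 0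
  refine ht.frequently (this.mono fun z hz ↦ ?_)
  exact ⟨fun g hg ↦ hz.1 _ (Finset.mem_image_of_mem _ hg), hz.2⟩

/-- Identity theorem on complex lines: if g vanished near 0 on every line through 0, it would vanish
on a whole ball where it is analytic. -/
lemma exists_regular_direction {g : anRing E} (hg0 : g.1 0 = 0)
    (hg : ¬ ∀ᶠ z in 𝓝 0, g.1 z = 0) : ∃ v : E, ¬ ∀ᶠ t in 𝓝 (0 : ℂ), g.1 (t • v) = 0 := by
  by_contra! hc
  apply hg
  obtain ⟨r, hr, hrU⟩ := Metric.eventually_nhds_iff_ball.1 g.2.eventually_analyticAt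
  filter_upwards [ball_mem_nhds (0 : E) hr] with z hz
  by_cases hz0 : z = 0
  · rw [hz0, hg0]
  have hzn : 0 < ‖z‖ := norm_pos_iff.2 hz0
  rw [mem_ball_zero_iff] at hz
  have han : AnalyticOnNhd ℂ (fun t : ℂ ↦ g.1 (t • z)) (ball 0 (r / ‖z‖)) := by
    intro t ht
    refine AnalyticAt.comp (g := g.1) (f := fun t : ℂ ↦ t • z) (hrU _ ?_)
      (analyticAt_id.smul analyticAt_const)
    rw [mem_ball_zero_iff] at ht ⊢
    rw [norm_smul]
    exact (lt_div_iff₀ hzn).1 ht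
  have := han.eqOn_zero_of_preconnected_of_eventuallyEq_zero
    (convex_ball _ _).isPreconnected (mem_ball_self (by positivity)) (hc z)
  have h1 := this (x := 1) (by
    rw [mem_ball_zero_iff, norm_one]
    exact (one_lt_div hzn).2 hz)
  simpa using h1

/-- If all elements of P vanish near 0 there is no equation to solve. Otherwise a linear change of
coordinates makes some element of P regular in the last variable, and `zeros_of_regular` lowers the
dimension. -/
theorem primesHaveZeros (n : ℕ) : ∀ (E : Type) [NormedAddCommGroup E] [NormedSpace ℂ E]
    [FiniteDimensional ℂ E], Module.finrank ℂ E = n → PrimesHaveZeros E := by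
  induction n with
  | zero =>
    intro E _ _ _ hn P hP hPg s hs f hf
    have : Subsingleton E := Module.finrank_zero_iff.1 hn
    refine Eventually.frequently (Eventually.of_forall fun z ↦ ?_)
    rw [Subsingleton.elim z 0]
    refine ⟨fun g hg ↦ hPg.apply_zero hP.ne_top (hs g hg), fun h0 ↦ hf (hPg _ ?_)⟩
    exact Eventually.of_forall fun z ↦ by rw [Subsingleton.elim z 0, h0]
  | succ n ih =>
    intro E _ _ _ hn P hP hPg s hs f hf
    by_cases hall : ∀ g ∈ P, ∀ᶠ z in 𝓝 0, g.1 z = 0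
    · have h1 : ∀ᶠ z in 𝓝 (0 : E), ∀ g ∈ s, g.1 z = 0 :=
        (Finset.eventually_all s).2 fun g hg ↦ hall g (hs g hg)
      have h2 : ∃ᶠ z in 𝓝 (0 : E), f.1 z ≠ 0 := fun h ↦ hf (hPg f (by simpa using h))
      exact (h2.and_eventually h1).mono fun z hz ↦ ⟨hz.2, hz.1⟩
    · push Not at hall
      obtain ⟨g, hgP, hg⟩ := hall
      have hg0 := hPg.apply_zero hP.ne_top hgP
      obtain ⟨v, hv⟩ := exists_regular_direction hg0 (by simpa using hg)
      have hv0 : v ≠ 0 := by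
        rintro rfl
        simp [hg0] at hv
      obtain ⟨l, hl⟩ := SeparatingDual.exists_eq_one (R := ℂ) hv0
      set e := splitEquiv l v hl
      have hrank : Module.finrank ℂ (LinearMap.ker l.toLinearMap) = n := by
        have h1 := e.toLinearEquiv.finrank_eq
        rw [Module.finrank_prod, Module.finrank_self, hn] at h1
        omega
      refine frequently_zeros_of_equiv (e := e) s hs f hf fun s' hs' f' hf' ↦ ?_
      refine zeros_of_regular (ih _ hrank) (Ideal.comap_isPrime _ P) (hPg.comap _)
        (g := anComp (e : _ →L[ℂ] E) g) ?_ ?_ s' hs' f' hf'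
      · rw [Ideal.mem_comap]
        convert hgP
        ext z
        simp
      · convert hv using 4
        simp [e, splitEquiv_apply]

/-- The local **Nullstellensatz**: if `f` vanishes at the common zeros of finitely many holomorphic
functions near a point, then a power of `f` is a combination of these functions near the point. -/
theorem nullstellensatz [FiniteDimensional ℂ E] {ι : Type} [Fintype ι] {x : E} {g : ι → E → ℂ}
    (hg : ∀ i, AnalyticAt ℂ (g i) x) {f : E → ℂ} (hf : AnalyticAt ℂ f x)
    (h : ∀ᶠ z in 𝓝 x, (∀ i, g i z = 0) → f z = 0) :
    ∃ (m : ℕ) (c : ι → E → ℂ), (∀ i, AnalyticAt ℂ (c i) x) ∧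
      ∀ᶠ z in 𝓝 x, f z ^ m = ∑ i, c i z * g i z := by
  classical
  have ht : Tendsto (fun z ↦ z + x) (𝓝 0) (𝓝 x) := Continuous.tendsto' (by fun_prop) _ _ (by simp)
  have ht' : Tendsto (fun z ↦ z - x) (𝓝 x) (𝓝 0) := Continuous.tendsto' (by fun_prop) _ _ (by simp)
  have htr : ∀ {k : E → ℂ}, AnalyticAt ℂ k x → AnalyticAt ℂ (fun z ↦ k (z + x)) 0 := fun {k} hk ↦
    AnalyticAt.comp (g := k) (f := fun z ↦ z + x) (by rw [zero_add]; exact hk) (by fun_prop)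
  have htr' : ∀ {k : E → ℂ}, AnalyticAt ℂ k 0 → AnalyticAt ℂ (fun z ↦ k (z - x)) x := fun {k} hk ↦
    AnalyticAt.comp (g := k) (f := fun z ↦ z - x) (by rw [sub_self]; exact hk) (by fun_prop)
  let f' : anRing E := ⟨_, htr hf⟩
  let g' : ι → anRing E := fun i ↦ ⟨_, htr (hg i)⟩
  -- Adding N to the ideal of the g i makes every prime above it a germ ideal.
  let N : Ideal (anRing E) :=
    { carrier := {k | ∀ᶠ z in 𝓝 0, k.1 z = 0}
      add_mem' := fun {a b} ha hb ↦ by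
        filter_upwards [ha, hb] with z h1 h2
        simp [h1, h2]
      zero_mem' := Eventually.of_forall fun z ↦ rfl
      smul_mem' := fun c k hk ↦ by
        filter_upwards [hk] with z hz
        simp [hz] }
  let I : Ideal (anRing E) := Ideal.span (Set.range g') ⊔ N
  -- Otherwise a prime above I avoids all powers of f, and near the origin it has zeros of all the g
  -- i at which f is not zero.
  obtain ⟨m, hm⟩ : ∃ m, f' ^ m ∈ I := by
    by_contra! hc
    have hdisj : Disjoint (I : Set (anRing E)) (Submonoid.powers f' : Set (anRing E)) := by
      rw [Set.disjoint_left]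
      rintro _ hI ⟨m, rfl⟩
      exact hc m hI
    obtain ⟨P, hP, hIP, hPd⟩ := Ideal.exists_le_prime_disjoint I (Submonoid.powers f') hdisj
    have hfP : f' ∉ P := fun hmem ↦ Set.disjoint_left.1 hPd hmem ⟨1, pow_one _⟩
    have hfreq := primesHaveZeros _ E rfl P hP (fun k hk ↦ hIP (Ideal.mem_sup_right hk))
      (Finset.univ.image g') (by
        intro k hk
        obtain ⟨i, _, rfl⟩ := Finset.mem_image.1 hk
        exact hIP (Ideal.mem_sup_left (Ideal.subset_span ⟨i, rfl⟩))) f' hfP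
    obtain ⟨z, ⟨hz1, hz2⟩, hz3⟩ := (hfreq.and_eventually (ht.eventually h)).exists
    exact hz2 (hz3 fun i ↦ hz1 _ (Finset.mem_image_of_mem _ (Finset.mem_univ i)))
  obtain ⟨a, ha, b, hb, hab⟩ := Submodule.mem_sup.1 hm
  obtain ⟨c, hc⟩ := (Ideal.mem_span_range_iff_exists_fun).1 ha
  refine ⟨m, fun i z ↦ (c i).1 (z - x), fun i ↦ htr' (c i).2, ?_⟩
  filter_upwards [ht'.eventually (show ∀ᶠ z in 𝓝 0, b.1 z = 0 from hb)] with z hz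
  have h1 := congrArg (anEval (z - x)) hab
  rw [map_add, ← hc, map_sum] at h1
  simp only [map_mul, map_pow, anEval_apply, hz, add_zero, f', g', sub_add_cancel] at h1
  exact h1.symm

end Nullstellensatz

/-! ### Grothendieck groups and uniqueness of dévissage. -/

section Devissage

open Limits

universe v u

variable {C : Type u} [Category.{v} C] [Abelian C]

lemma K0.cls_of_shortExact (P : ObjectProperty C) {S : ShortComplex C} (hS : S.ShortExact)
    (h₁ : P S.X₁) (h₂ : P S.X₂) (h₃ : P S.X₃) :
    K0.cls P ⟨S.X₂, h₂⟩ = K0.cls P ⟨S.X₁, h₁⟩ + K0.cls P ⟨S.X₃, h₃⟩ := by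
  have h : FreeAbelianGroup.of (⟨S.X₁, h₁⟩ : P.FullSubcategory) + FreeAbelianGroup.of ⟨S.X₃, h₃⟩
      - FreeAbelianGroup.of ⟨S.X₂, h₂⟩ ∈ AddSubgroup.closure (relations P) :=
    AddSubgroup.subset_closure ⟨S, hS, h₁, h₂, h₃, rfl⟩
  have h' := (QuotientAddGroup.eq_zero_iff _).2 h
  rw [QuotientAddGroup.mk_sub, QuotientAddGroup.mk_add, sub_eq_zero] at h'
  exact h'.symm

lemma K0.cls_of_isZero (P : ObjectProperty C) {F : C} (hF : IsZero F) (h : P F) :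
    K0.cls P ⟨F, h⟩ = 0 := by
  have hS : (ShortComplex.mk (0 : F ⟶ F) (0 : F ⟶ F) (by simp)).ShortExact :=
    { exact := ShortComplex.exact_of_isZero_X₂ _ hF
      mono_f := ⟨fun _ _ _ ↦ hF.eq_of_tgt _ _⟩
      epi_g := ⟨fun _ _ _ ↦ hF.eq_of_src _ _⟩ }
  have := K0.cls_of_shortExact P hS h h h
  exact left_eq_add.1 this

/-- The homomorphism out of `K0` given by an additive invariant. -/
def K0.lift (P : ObjectProperty C) {A : Type*} [AddCommGroup A] (f : P.FullSubcategory → A)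
    (hf : ∀ (S : ShortComplex C) (_ : S.ShortExact) (h₁ : P S.X₁) (h₂ : P S.X₂) (h₃ : P S.X₃),
      f ⟨S.X₂, h₂⟩ = f ⟨S.X₁, h₁⟩ + f ⟨S.X₃, h₃⟩) : K0 P →+ A :=
  QuotientAddGroup.lift _ (FreeAbelianGroup.lift f) (by
    rw [AddSubgroup.closure_le]
    rintro _ ⟨S, hS, h₁, h₂, h₃, rfl⟩
    simp [hf S hS h₁ h₂ h₃])

lemma K0.lift_cls (P : ObjectProperty C) {A : Type*} [AddCommGroup A] (f : P.FullSubcategory → A)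
    (hf : ∀ (S : ShortComplex C) (_ : S.ShortExact) (h₁ : P S.X₁) (h₂ : P S.X₂) (h₃ : P S.X₃),
      f ⟨S.X₂, h₂⟩ = f ⟨S.X₁, h₁⟩ + f ⟨S.X₃, h₃⟩) (F : P.FullSubcategory) :
    K0.lift P f hf (K0.cls P F) = f F := by
  simp [K0.lift, K0.cls]

lemma K0.hom_ext {P : ObjectProperty C} {A : Type*} [AddCommGroup A] {f g : K0 P →+ A}
    (h : ∀ F, f (K0.cls P F) = g (K0.cls P F)) : f = g := by
  refine QuotientAddGroup.addMonoidHom_ext _ (FreeAbelianGroup.lift_ext _ _ fun F ↦ ?_)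
  exact h F

lemma K0.induction {P : ObjectProperty C} {H : AddSubgroup (K0 P)}
    (h : ∀ F, K0.cls P F ∈ H) (x : K0 P) : x ∈ H := by
  have : (QuotientAddGroup.mk' H) = 0 := K0.hom_ext fun F ↦ by
    rw [AddMonoidHom.zero_apply]
    exact (QuotientAddGroup.eq_zero_iff _).2 (h F)
  exact (QuotientAddGroup.eq_zero_iff _).1 (congrArg (fun f ↦ f x) this)

variable {X : Type}

/-- The formal properties of the classes `P Z` of coherent sheaves with support in `Z`. -/
structure IsSupportTheory (P : Set X → ObjectProperty C) : Prop where
  mono : Monotone P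
  inter : ∀ {Z W : Set X} {F : C}, P Z F → P W F → P (Z ∩ W) F
  sub : ∀ {Z : Set X} {S : ShortComplex C}, S.ShortExact → P Set.univ S.X₁ → P Z S.X₂ → P Z S.X₁
  quot : ∀ {Z : Set X} {S : ShortComplex C}, S.ShortExact → P Set.univ S.X₃ → P Z S.X₂ → P Z S.X₃
  kernel : ∀ {F G : C} (f : F ⟶ G), P Set.univ F → P Set.univ G → P Set.univ (kernel f)
  cokernel : ∀ {F G : C} (f : F ⟶ G), P Set.univ F → P Set.univ G → P Set.univ (cokernel f)

/-- `Dev P D q F a`: the object `F` is a successive extension of objects in the classes `P (D i)`,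
whose classes under the maps `q i` add up to `a`. -/
inductive Dev {ι : Type} (P : Set X → ObjectProperty C) (D : ι → Set X) {A : Type*}
    [AddCommGroup A] (q : ∀ i, K0 (P (D i)) →+ A) : C → A → Prop
  | zero {F : C} (hF : IsZero F) : Dev P D q F 0
  | piece {F : C} (i : ι) (hF : P (D i) F) : Dev P D q F (q i (K0.cls _ ⟨F, hF⟩))
  | ext (S : ShortComplex C) (hS : S.ShortExact) (h₁ : P Set.univ S.X₁) (h₂ : P Set.univ S.X₂)
      (h₃ : P Set.univ S.X₃) {a b : A} (ha : Dev P D q S.X₁ a) (hb : Dev P D q S.X₃ b) :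
      Dev P D q S.X₂ (a + b)

variable {ι : Type} {P : Set X → ObjectProperty C} {D : ι → Set X} {A : Type*} [AddCommGroup A]
  {q : ∀ i, K0 (P (D i)) →+ A}

/-- A pair of a subobject and an extension structure on the same object gives rise to the four
subquotients of the common refinement. -/
lemma exists_refinement (hP : IsSupportTheory P) {A₀ F B A' B' : C} {s : A₀ ⟶ F} {p : F ⟶ B}
    {w : s ≫ p = 0} (hS : (ShortComplex.mk s p w).ShortExact) (h₃ : P Set.univ B)
    {i : A' ⟶ F} {p' : F ⟶ B'} {w' : i ≫ p' = 0} (hT : (ShortComplex.mk i p' w').ShortExact)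
    (t₁ : P Set.univ A') (t₃ : P Set.univ B') :
    ∃ K I N M : C, P Set.univ K ∧ P Set.univ I ∧ P Set.univ N ∧ P Set.univ M ∧
      (∃ (f : K ⟶ A₀) (g : A₀ ⟶ N) (w : f ≫ g = 0), (ShortComplex.mk f g w).ShortExact) ∧
      (∃ (f : I ⟶ B) (g : B ⟶ M) (w : f ≫ g = 0), (ShortComplex.mk f g w).ShortExact) ∧
      (∃ (f : K ⟶ A') (g : A' ⟶ I) (w : f ≫ g = 0), (ShortComplex.mk f g w).ShortExact) ∧
      (∃ (f : N ⟶ B') (g : B' ⟶ M) (w : f ≫ g = 0), (ShortComplex.mk f g w).ShortExact) := by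
  have := hS.mono_f
  have := hS.epi_g
  have := hT.mono_f
  have := hT.epi_g
  dsimp only at *
  -- For the subobjects A₀ and A' of F, the four objects are K = A₀ ∩ A', I = A' / K (the image of
  -- α), M = F / (A₀ + A') (the cokernel of α), and N = A₀ / K, realised as the kernel of F / A' →
  -- M.
  let α : A' ⟶ B := i ≫ p
  have hα : i ≫ p ≫ cokernel.π α = 0 := by rw [← Category.assoc]; exact cokernel.condition α
  let δ : B' ⟶ cokernel α := hT.exact.desc (p ≫ cokernel.π α) hα
  have hδ : p' ≫ δ = p ≫ cokernel.π α := hT.exact.g_desc _ _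
  have hδepi : Epi δ := by
    have : Epi (p' ≫ δ) := by rw [hδ]; infer_instance
    exact epi_of_epi p' δ
  let κ : kernel α ⟶ A₀ := hS.exact.lift (kernel.ι α ≫ i) (by
    rw [Category.assoc]; exact kernel.condition α)
  have hκ : κ ≫ s = kernel.ι α ≫ i := hS.exact.lift_f _ _
  have hκmono : Mono κ := by
    have : Mono (κ ≫ s) := by rw [hκ]; infer_instance
    exact mono_of_mono κ s
  let β : A₀ ⟶ kernel δ := kernel.lift δ (s ≫ p') (by
    rw [Category.assoc, hδ, ← Category.assoc, w, zero_comp])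
  have hβ : β ≫ kernel.ι δ = s ≫ p' := kernel.lift_ι _ _ _
  have hκβ : κ ≫ β = 0 := by
    rw [← cancel_mono (kernel.ι δ), Category.assoc, hβ, ← Category.assoc, hκ, Category.assoc, w',
      comp_zero, zero_comp]
  have hM := hP.cokernel α t₁ h₃
  refine ⟨kernel α, kernel (cokernel.π α), kernel δ, cokernel α, hP.kernel α t₁ h₃,
    hP.kernel _ h₃ hM, hP.kernel _ t₃ hM, hM, ⟨κ, β, hκβ, ?_⟩,
    ⟨kernel.ι _, cokernel.π α, kernel.condition _, ?_⟩,
    ⟨kernel.ι α, kernel.lift _ α (cokernel.condition α), ?_, ?_⟩,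
    ⟨kernel.ι δ, δ, kernel.condition _, ?_⟩⟩
  · have hβepi : Epi β := by
      rw [epi_iff_surjective_up_to_refinements]
      intro T n
      obtain ⟨T₁, π₁, hπ₁, x, hx⟩ := surjective_up_to_refinements_of_epi p' (n ≫ kernel.ι δ)
      have hx0 : (x ≫ p) ≫ cokernel.π α = 0 := by
        rw [Category.assoc, ← hδ, ← Category.assoc, ← hx]
        simp
      have hex : (ShortComplex.mk α (cokernel.π α) (cokernel.condition α)).Exact :=
        ShortComplex.exact_cokernel α
      obtain ⟨T₂, π₂, hπ₂, a, ha⟩ := hex.exact_up_to_refinements (x ≫ p) hx0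
      dsimp only at ha
      have hy : (π₂ ≫ x - a ≫ i) ≫ p = 0 := by
        rw [Preadditive.sub_comp, Category.assoc, ha, Category.assoc, sub_self]
      refine ⟨T₂, π₂ ≫ π₁, epi_comp _ _, hS.exact.lift _ hy, ?_⟩
      rw [← cancel_mono (kernel.ι δ), Category.assoc, Category.assoc, Category.assoc, hβ, hx,
        ← Category.assoc _ s p']
      rw [show hS.exact.lift _ hy ≫ s = _ from hS.exact.lift_f _ hy]
      rw [Preadditive.sub_comp, Category.assoc, Category.assoc, w', comp_zero, sub_zero]
    refine { exact := ?_, mono_f := hκmono, epi_g := hβepi }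
    rw [ShortComplex.exact_iff_exact_up_to_refinements]
    intro T x hx
    dsimp only at x hx
    have hx' : (x ≫ s) ≫ p' = 0 := by
      rw [Category.assoc, ← hβ, ← Category.assoc, hx, zero_comp]
    have h0 : hT.exact.lift (x ≫ s) hx' ≫ α = 0 := by
      rw [← Category.assoc, show hT.exact.lift _ hx' ≫ i = _ from hT.exact.lift_f _ hx',
        Category.assoc, w, comp_zero]
    refine ⟨T, 𝟙 T, inferInstance, kernel.lift α (hT.exact.lift (x ≫ s) hx') h0, ?_⟩
    dsimp only
    rw [← cancel_mono s, Category.assoc, Category.assoc, hκ, ← Category.assoc (kernel.lift _ _ _),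
      kernel.lift_ι, show hT.exact.lift _ hx' ≫ i = _ from hT.exact.lift_f _ hx', Category.id_comp]
  · exact { exact := ShortComplex.exact_kernel _, mono_f := inferInstance, epi_g := inferInstance }
  · rw [← cancel_mono (kernel.ι (cokernel.π α)), Category.assoc, kernel.lift_ι, zero_comp,
      kernel.condition]
  · have hepi : Epi (kernel.lift (cokernel.π α) α (cokernel.condition α)) :=
      inferInstanceAs (Epi (Abelian.factorThruImage α))
    refine { exact := ?_, mono_f := inferInstance, epi_g := hepi }
    rw [ShortComplex.exact_iff_exact_up_to_refinements]
    intro T x hx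
    dsimp only at x hx
    have hx' : x ≫ α = 0 := by
      rw [← kernel.lift_ι (cokernel.π α) α (cokernel.condition α), ← Category.assoc, hx, zero_comp]
    exact ⟨T, 𝟙 T, inferInstance, kernel.lift α x hx', by simp⟩
  · exact { exact := ShortComplex.exact_kernel _, mono_f := inferInstance, epi_g := hδepi }

/-- Schreier refinement by induction on the dévissage: an extension step is cut into four
subquotients; K and I rebuild the subobject, N and M the quotient. -/
lemma Dev.split (hP : IsSupportTheory P) {F A' B' : C} {a : A} (h : Dev P D q F a)
    {i : A' ⟶ F} {p : F ⟶ B'} {w : i ≫ p = 0} (hT : (ShortComplex.mk i p w).ShortExact)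
    (t₁ : P Set.univ A') (t₃ : P Set.univ B') :
    ∃ b c, Dev P D q A' b ∧ Dev P D q B' c ∧ a = b + c := by
  induction h generalizing A' B' with
  | zero hF =>
    have := hT.mono_f
    have := hT.epi_g
    exact ⟨0, 0, .zero (hF.of_mono i), .zero (hF.of_epi p), by simp⟩
  | piece j hF =>
    have h₁ := hP.sub hT t₁ hF
    have h₃ := hP.quot hT t₃ hF
    exact ⟨_, _, .piece j h₁, .piece j h₃, by
      rw [← map_add, ← K0.cls_of_shortExact _ hT h₁ hF h₃]⟩
  | ext S hS h₁ h₂ h₃ _ _ iha ihb =>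
    obtain ⟨K, I, N, M, hK, hI, hN, hM, ⟨f₁, g₁, w₁, hx₁⟩, ⟨f₂, g₂, w₂, hx₂⟩, ⟨f₃, g₃, w₃, hx₃⟩,
      ⟨f₄, g₄, w₄, hx₄⟩⟩ := exists_refinement hP hS h₃ hT t₁ t₃
    obtain ⟨b₁, c₁, hb₁, hc₁, rfl⟩ := iha hx₁ hK hN
    obtain ⟨b₂, c₂, hb₂, hc₂, rfl⟩ := ihb hx₂ hI hM
    exact ⟨b₁ + b₂, c₁ + c₂, .ext _ hx₃ hK t₁ hI hb₁ hb₂, .ext _ hx₄ hN t₃ hM hc₁ hc₂, by abel⟩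

/-- All pieces of F inherit support in D i, so by `hq` each of them may be counted on that branch,
where classes are additive. -/
lemma Dev.eq_of_piece (hP : IsSupportTheory P)
    (hq : ∀ i j F (hi : P (D i) F) (hj : P (D j) F), q i (K0.cls _ ⟨F, hi⟩) = q j (K0.cls _ ⟨F, hj⟩))
    {F : C} {a : A} (h : Dev P D q F a) (i : ι) (hF : P (D i) F) : a = q i (K0.cls _ ⟨F, hF⟩) := by
  induction h with
  | zero h0 => rw [K0.cls_of_isZero _ h0, map_zero]
  | piece j hj => exact hq j i _ hj hF
  | ext S hS h₁ h₂ h₃ _ _ iha ihb =>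
    have t₁ := hP.sub hS h₁ hF
    have t₃ := hP.quot hS h₃ hF
    rw [K0.cls_of_shortExact _ hS t₁ hF t₃, map_add, iha t₁, ihb t₃]

lemma Dev.eq_zero_of_isZero {F : C} {a : A} (h : Dev P D q F a)
    (hF : IsZero F) : a = 0 := by
  induction h with
  | zero h0 => rfl
  | piece j hj => rw [K0.cls_of_isZero _ hF, map_zero]
  | ext S hS h₁ h₂ h₃ _ _ iha ihb =>
    have := hS.mono_f
    have := hS.epi_g
    rw [iha (hF.of_mono S.f), ihb (hF.of_epi S.g), add_zero]

/-- Induct on one dévissage, splitting the other along each extension. -/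
lemma Dev.unique (hP : IsSupportTheory P)
    (hq : ∀ i j F (hi : P (D i) F) (hj : P (D j) F), q i (K0.cls _ ⟨F, hi⟩) = q j (K0.cls _ ⟨F, hj⟩))
    {F : C} {a b : A} (h : Dev P D q F a) (h' : Dev P D q F b) : a = b := by
  induction h generalizing b with
  | zero h0 => exact (h'.eq_zero_of_isZero h0).symm
  | piece i hi => exact (h'.eq_of_piece hP hq i hi).symm
  | ext S hS h₁ h₂ h₃ _ _ iha ihb =>
    obtain ⟨c, d, hc, hd, rfl⟩ := h'.split hP hS h₁ h₃
    rw [iha hc, ihb hd]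

end Devissage

/-! ### From dévissage to the exact sequence. -/

section Exactness

universe v u

variable {C : Type u} [Category.{v} C] [Abelian C] {X : Type} {N : ℕ}
  {P : Set X → ObjectProperty C} (hP : IsSupportTheory P) (D : Fin N → Set X)

/-- The map from the groups of the pairwise intersections to those of the branches. -/
def pairsMap : (⨁ p : {p : Fin N × Fin N // p.1 < p.2}, K0 (P (D p.1.1 ∩ D p.1.2))) →+
    ⨁ i, K0 (P (D i)) :=
  DirectSum.toAddMonoid fun p ↦
    (DirectSum.of (fun i ↦ K0 (P (D i))) p.1.1).comp (K0.map (hP.mono Set.inter_subset_left)) -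
      (DirectSum.of (fun i ↦ K0 (P (D i))) p.1.2).comp (K0.map (hP.mono Set.inter_subset_right))

/-- The map from the groups of the branches to the group of their union. -/
def branchesMap : (⨁ i, K0 (P (D i))) →+ K0 (P (⋃ i, D i)) :=
  DirectSum.toAddMonoid fun i ↦ K0.map (hP.mono (Set.subset_iUnion D i))

lemma branchesMap_of (i : Fin N) {F : C} (hF : P (D i) F) :
    branchesMap hP D (DirectSum.of (fun i ↦ K0 (P (D i))) i (K0.cls _ ⟨F, hF⟩)) =
      K0.cls _ ⟨F, hP.mono (Set.subset_iUnion D i) _ hF⟩ := by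
  rw [branchesMap, DirectSum.toAddMonoid_of, K0.map_cls]

lemma pairsMap_of (p : {p : Fin N × Fin N // p.1 < p.2}) {F : C}
    (hF : P (D p.1.1 ∩ D p.1.2) F) :
    pairsMap hP D (DirectSum.of (fun p : {p : Fin N × Fin N // p.1 < p.2} ↦
        K0 (P (D p.1.1 ∩ D p.1.2))) p (K0.cls _ ⟨F, hF⟩)) =
      DirectSum.of (fun i ↦ K0 (P (D i))) p.1.1
          (K0.cls _ ⟨F, hP.mono Set.inter_subset_left _ hF⟩) -
        DirectSum.of (fun i ↦ K0 (P (D i))) p.1.2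
          (K0.cls _ ⟨F, hP.mono Set.inter_subset_right _ hF⟩) := by
  rw [pairsMap, DirectSum.toAddMonoid_of, AddMonoidHom.sub_apply, AddMonoidHom.comp_apply,
    AddMonoidHom.comp_apply, K0.map_cls, K0.map_cls]

/-- The maps from the groups of the branches to the cokernel of `pairsMap`. -/
def toCoker (i : Fin N) : K0 (P (D i)) →+ (⨁ i, K0 (P (D i))) ⧸ (pairsMap hP D).range :=
  (QuotientAddGroup.mk' _).comp (DirectSum.of (fun i ↦ K0 (P (D i))) i)

/-- F has support in D i ∩ D j, and the difference of its two classes is, up to sign, the image of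
its class there. -/
lemma toCoker_eq (i j : Fin N) (F : C) (hi : P (D i) F) (hj : P (D j) F) :
    toCoker hP D i (K0.cls _ ⟨F, hi⟩) = toCoker hP D j (K0.cls _ ⟨F, hj⟩) := by
  wlog hij : i < j generalizing i j with H
  · rcases (not_lt.1 hij).eq_or_lt with rfl | h
    · rfl
    · exact (H j i hj hi h).symm
  have h := pairsMap_of hP D ⟨(i, j), hij⟩ (hP.inter hi hj)
  rw [← sub_eq_zero]
  exact (QuotientAddGroup.eq_zero_iff _).2 ⟨_, h⟩

/-- Exactness of the sequence of Grothendieck groups, when every object with support in the union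
is a successive extension of objects with support in the branches. -/
theorem exact_of_devissage
    (hdev : ∀ F, P (⋃ i, D i) F → ∃ a, Dev P D (toCoker hP D) F a) :
    Function.Exact (pairsMap hP D) (branchesMap hP D) ∧
      Function.Surjective (branchesMap hP D) := by
  constructor
  · choose! c hc using hdev
    -- Uniqueness makes the class of a chosen dévissage additive. Composed with `branchesMap`, Φ is
    -- the projection to the cokernel, so the kernel of `branchesMap` lies in the range of
    -- `pairsMap`.
    set Φ : K0 (P (⋃ i, D i)) →+ (⨁ i, K0 (P (D i))) ⧸ (pairsMap hP D).range :=
      K0.lift _ (fun F ↦ c F.obj) (fun S hS h₁ h₂ h₃ ↦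
        (hc _ h₂).unique hP (toCoker_eq hP D) (.ext S hS
          (hP.mono (Set.subset_univ _) _ h₁) (hP.mono (Set.subset_univ _) _ h₂)
          (hP.mono (Set.subset_univ _) _ h₃) (hc _ h₁) (hc _ h₃))) with hΦ
    have hcomp : Φ.comp (branchesMap hP D) = QuotientAddGroup.mk' _ := by
      refine DirectSum.addHom_ext' fun i ↦ K0.hom_ext fun F ↦ ?_
      rw [AddMonoidHom.comp_apply, AddMonoidHom.comp_apply, branchesMap_of, hΦ, K0.lift_cls]
      exact (hc _ (hP.mono (Set.subset_iUnion D i) _ F.property)).eq_of_piece hP (toCoker_eq hP D) i F.property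
    have hzero : (branchesMap hP D).comp (pairsMap hP D) = 0 := by
      refine DirectSum.addHom_ext' fun p ↦ K0.hom_ext fun F ↦ ?_
      rw [AddMonoidHom.comp_apply, AddMonoidHom.comp_apply, pairsMap_of, map_sub, branchesMap_of,
        branchesMap_of, sub_self]
      rfl
    intro y
    constructor
    · intro hy
      have h1 : Φ (branchesMap hP D y) = QuotientAddGroup.mk' _ y := congrArg (fun f ↦ f y) hcomp
      rw [hy, map_zero] at h1
      exact (QuotientAddGroup.eq_zero_iff _).1 h1.symm
    · rintro ⟨x, rfl⟩
      exact congrArg (fun f ↦ f x) hzero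
  · intro x
    refine K0.induction (H := (branchesMap hP D).range) (fun F ↦ ?_) x
    obtain ⟨F, hF⟩ := F
    obtain ⟨a, ha⟩ := hdev F hF
    induction ha with
    | zero h0 => rw [K0.cls_of_isZero _ h0]; exact zero_mem _
    | piece i hi => exact ⟨_, branchesMap_of hP D i hi⟩
    | ext S hS h₁ h₂ h₃ _ _ iha ihb =>
      have t₁ := hP.sub hS h₁ hF
      have t₃ := hP.quot hS h₃ hF
      rw [K0.cls_of_shortExact _ hS t₁ hF t₃]
      exact add_mem (iha t₁) (ihb t₃)

end Exactness

/-! ### Sections of sheaves of modules: kernels, images, local lifting. -/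

section Sections

variable {X : TopCat.{0}} {R : Sheaf (Opens.grothendieckTopology X) RingCat.{0}}

lemma resM_self (F : SheafOfModules.{0} R) {U : Opens X} (h : U ≤ U) (s : F.val.obj (op U)) :
    resM F h s = s := by
  change (F.val.presheaf.map (𝟙 (op U))) s = s
  rw [F.val.presheaf.map_id]
  rfl

lemma resM_resM (F : SheafOfModules.{0} R) {U V W : Opens X} (h : V ≤ U) (h' : W ≤ V)
    (s : F.val.obj (op U)) : resM F h' (resM F h s) = resM F (h'.trans h) s := by
  have := F.val.map_comp_apply (homOfLE h).op (homOfLE h').op s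
  exact this.symm

lemma resR_resR {U V W : Opens X} (h : V ≤ U) (h' : W ≤ V)
    (s : R.obj.obj (op U)) : resR R h' (resR R h s) = resR R (h'.trans h) s := by
  have := R.obj.map_comp (homOfLE h).op (homOfLE h').op
  exact (ConcreteCategory.congr_hom this s).symm

lemma resR_self {U : Opens X} (h : U ≤ U) (s : R.obj.obj (op U)) : resR R h s = s := by
  have := R.obj.map_id (op U)
  exact (ConcreteCategory.congr_hom this s)

lemma resM_smul (F : SheafOfModules.{0} R) {U V : Opens X} (h : V ≤ U) (c : R.obj.obj (op U))
    (s : F.val.obj (op U)) : resM F h (c • s) = resR R h c • resM F h s :=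
  map_smulₛₗ _ _ _

/-- Sections which agree locally are equal. -/
lemma eq_of_locally (F : SheafOfModules.{0} R) {U : Opens X} {s t : F.val.obj (op U)}
    (h : ∀ x ∈ U, ∃ (V : Opens X) (hV : V ≤ U), x ∈ V ∧ resM F hV s = resM F hV t) : s = t := by
  choose! V hV hx hst using h
  exact TopCat.Sheaf.eq_of_locally_eq' (C := AddCommGrpCat.{0}) (X := X) ⟨F.val.presheaf, F.isSheaf⟩
    (fun x : U ↦ V x) U (fun x ↦ homOfLE (hV x x.2))
    (fun x hxU ↦ Opens.mem_iSup.2 ⟨⟨x, hxU⟩, hx x hxU⟩) s t (fun x ↦ hst x x.2)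

/-- The map on sections given by a morphism. -/
def appM {F G : SheafOfModules.{0} R} (f : F ⟶ G) (U : Opens X) :
    F.val.obj (op U) →ₗ[R.obj.obj (op U)] G.val.obj (op U) := (f.val.app (op U)).hom

lemma appM_resM {F G : SheafOfModules.{0} R} (f : F ⟶ G) {U V : Opens X} (h : V ≤ U)
    (s : F.val.obj (op U)) : appM f V (resM F h s) = resM G h (appM f U s) :=
  PresheafOfModules.naturality_apply f.val (homOfLE h).op s

lemma appM_comp {F G H : SheafOfModules.{0} R} (f : F ⟶ G) (g : G ⟶ H) (U : Opens X)
    (s : F.val.obj (op U)) : appM (f ≫ g) U s = appM g U (appM f U s) := rfl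

lemma appM_zero {F G : SheafOfModules.{0} R} (U : Opens X) (s : F.val.obj (op U)) :
    appM (0 : F ⟶ G) U s = 0 := rfl

lemma appM_injective {F G : SheafOfModules.{0} R} (f : F ⟶ G) [Mono f] (U : Opens X) :
    Function.Injective (appM f U) := by
  have : Mono f.val := inferInstanceAs (Mono ((SheafOfModules.forget R).map f))
  exact PresheafOfModules.injective_of_mono f.val (op U)

/-- Taking sections over an open set is left exact. -/
lemma exists_appM_eq {S : ShortComplex (SheafOfModules.{0} R)} (hS : S.Exact) [Mono S.f]
    {U : Opens X} (s : S.X₂.val.obj (op U)) (hs : appM S.g U s = 0) : ∃ t, appM S.f U t = s := by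
  have : (SheafOfModules.evaluation R (op U)).PreservesZeroMorphisms := ⟨fun _ _ ↦ rfl⟩
  have h := hS.map_of_mono_of_preservesKernel (SheafOfModules.evaluation R (op U)) inferInstance
    inferInstance
  rw [ShortComplex.moduleCat_exact_iff] at h
  exact h s hs

/-- A submodule of a sheaf of modules given by a local condition. -/
def IsLocalSubmodule {F : SheafOfModules.{0} R} (N : F.val.Submodule) : Prop :=
  ∀ (U : Opens X) (s : F.val.obj (op U)),
    (∀ x ∈ U, ∃ (V : Opens X) (hV : V ≤ U), x ∈ V ∧ resM F hV s ∈ N.obj (op V)) → s ∈ N.obj (op U)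

/-- The sheaf of modules given by a local submodule. -/
def subsheaf {F : SheafOfModules.{0} R} (N : F.val.Submodule) (hN : IsLocalSubmodule N) :
    SheafOfModules.{0} R where
  val := N.toPresheafOfModules
  isSheaf := by
    change TopCat.Presheaf.IsSheaf (C := AddCommGrpCat.{0}) (X := X) _
    rw [TopCat.Presheaf.isSheaf_iff_isSheafUniqueGluing]
    intro ι U sf hsf
    obtain ⟨s, hs, hs'⟩ := TopCat.Sheaf.existsUnique_gluing (C := AddCommGrpCat.{0}) (X := X)
      ⟨F.val.presheaf, F.isSheaf⟩ U (fun i ↦ (sf i).1) (fun i j ↦ congrArg Subtype.val (hsf i j))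
    refine ⟨⟨s, hN _ s fun x hx ↦ ?_⟩, fun i ↦ Subtype.ext (hs i), fun t ht ↦
      Subtype.ext (hs' t.1 fun i ↦ congrArg Subtype.val (ht i))⟩
    obtain ⟨i, hi⟩ := Opens.mem_iSup.1 hx
    refine ⟨U i, le_iSup U i, hi, ?_⟩
    have h1 : resM F (le_iSup U i) s = (sf i).1 := hs i
    rw [h1]
    exact (sf i).2

/-- The inclusion of a subsheaf. -/
def subsheafι {F : SheafOfModules.{0} R} (N : F.val.Submodule) (hN : IsLocalSubmodule N) :
    subsheaf N hN ⟶ F := ⟨N.ι⟩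

instance {F : SheafOfModules.{0} R} (N : F.val.Submodule) (hN : IsLocalSubmodule N) :
    Mono (subsheafι N hN) :=
  (SheafOfModules.forget R).mono_of_mono_map (inferInstanceAs (Mono N.ι))

/-- The submodule of sections which are locally in the image of a morphism. -/
def imageSubmodule {F G : SheafOfModules.{0} R} (f : F ⟶ G) : G.val.Submodule where
  obj U :=
    { carrier := {s | ∀ x ∈ U.unop, ∃ (V : Opens X) (hV : V ≤ U.unop), x ∈ V ∧
        ∃ t, appM f V t = resM G hV s}
      add_mem' := by
        intro s s' hs hs' x hx
        obtain ⟨V, hV, hxV, t, ht⟩ := hs x hx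
        obtain ⟨V', hV', hxV', t', ht'⟩ := hs' x hx
        refine ⟨V ⊓ V', inf_le_left.trans hV, ⟨hxV, hxV'⟩,
          resM F inf_le_left t + resM F inf_le_right t', ?_⟩
        rw [map_add, map_add, appM_resM, appM_resM, ht, ht', resM_resM, resM_resM]
      zero_mem' := fun x hx ↦ ⟨U.unop, le_rfl, hx, 0, by rw [map_zero, map_zero]⟩
      smul_mem' := by
        intro c s hs x hx
        obtain ⟨V, hV, hxV, t, ht⟩ := hs x hx
        exact ⟨V, hV, hxV, resR R hV c • t, by rw [map_smul, ht, ← resM_smul]⟩ }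
  map {U V} h s hs x hx := by
    obtain ⟨W, hW, hxW, t, ht⟩ := hs x (leOfHom h.unop hx)
    refine ⟨W ⊓ V.unop, inf_le_right, ⟨hxW, hx⟩, resM F inf_le_left t, ?_⟩
    rw [appM_resM, ht, resM_resM]
    exact (resM_resM G (leOfHom h.unop) inf_le_right s).symm

lemma isLocalSubmodule_imageSubmodule {F G : SheafOfModules.{0} R} (f : F ⟶ G) :
    IsLocalSubmodule (imageSubmodule f) := by
  intro U s hs x hx
  obtain ⟨V, hV, hxV, h⟩ := hs x hx
  obtain ⟨W, hW, hxW, t, ht⟩ := h x hxV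
  exact ⟨W, hW.trans hV, hxW, t, by rw [ht, resM_resM]⟩

/-- Epimorphisms of sheaves of modules are locally surjective. -/
lemma exists_local_lift {F G : SheafOfModules.{0} R} (f : F ⟶ G) [Epi f] {U : Opens X}
    (s : G.val.obj (op U)) (x : X) (hx : x ∈ U) :
    ∃ (V : Opens X) (hV : V ≤ U) (_ : x ∈ V) (t : F.val.obj (op V)), appM f V t = resM G hV s := by
  let i := subsheafι _ (isLocalSubmodule_imageSubmodule f)
  let p : F ⟶ subsheaf _ (isLocalSubmodule_imageSubmodule f) :=
    ⟨PresheafOfModules.homMk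
      { app := fun U ↦ AddCommGrpCat.ofHom (((f.val.app U).hom.codRestrict
          ((imageSubmodule f).obj U) (fun t y hy ↦ ⟨U.unop, le_rfl, hy, t, by
            rw [resM_self]; rfl⟩)).toAddMonoidHom)
        naturality := fun U V h ↦ by
          ext t
          exact Subtype.ext (PresheafOfModules.naturality_apply f.val h t) }
      (fun U r m ↦ Subtype.ext ((f.val.app U).hom.map_smul r m))⟩
  have hp : p ≫ i = f := rfl
  have hi : Epi i := by
    have : Epi (p ≫ i) := by rw [hp]; infer_instance
    exact epi_of_epi p i
  -- The sheaf of sections locally in the image is a subobject through which the epimorphism f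
  -- factors; its inclusion is mono and epi, hence invertible.
  have hiso : IsIso i := isIso_of_mono_of_epi i
  have h1 : s = appM i U (appM (inv i) U s) := by
    rw [← appM_comp, IsIso.inv_hom_id]
    rfl
  obtain ⟨V, hV, hxV, t, ht⟩ := (appM (inv i) U s).2 x hx
  refine ⟨V, hV, hxV, t, ?_⟩
  exact ht.trans (congrArg (resM G hV) h1.symm)

end Sections

/-! ### Finite type and finite relations in exact sequences. -/

section CoherentClosure

variable {X : TopCat.{0}} {R : Sheaf (Opens.grothendieckTopology X) RingCat.{0}}

lemma resM_sum_smul (F : SheafOfModules.{0} R) {ι : Type} [Fintype ι] {U V : Opens X} (h : V ≤ U)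
    (c : ι → R.obj.obj (op U)) (s : ι → F.val.obj (op U)) :
    resM F h (∑ i, c i • s i) = ∑ i, resR R h (c i) • resM F h (s i) := by
  rw [map_sum]
  exact Finset.sum_congr rfl fun i _ ↦ resM_smul F h _ _

lemma exists_common_nhd {ι : Type} [Finite ι] {x : X} (V : ι → Opens X) (h : ∀ i, x ∈ V i) :
    ∃ W : Opens X, x ∈ W ∧ ∀ i, W ≤ V i :=
  ⟨⟨⋂ i, (V i : Set X), isOpen_iInter_of_finite fun i ↦ (V i).isOpen⟩,
    Set.mem_iInter.2 h, fun i ↦ Set.iInter_subset _ i⟩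

lemma exists_local_lifts {F G : SheafOfModules.{0} R} (f : F ⟶ G) [Epi f] {U : Opens X} {n : ℕ}
    (s : Fin n → G.val.obj (op U)) (x : X) (hx : x ∈ U) :
    ∃ (V : Opens X) (hV : V ≤ U) (_ : x ∈ V) (t : Fin n → F.val.obj (op V)),
      ∀ i, appM f V (t i) = resM G hV (s i) := by
  choose V hV hxV t ht using fun i ↦ exists_local_lift f (s i) x hx
  obtain ⟨W, hxW, hW⟩ := exists_common_nhd V hxV
  refine ⟨W ⊓ U, inf_le_right, ⟨hxW, hx⟩, fun i ↦ resM F (inf_le_left.trans (hW i)) (t i),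
    fun i ↦ ?_⟩
  rw [appM_resM, ht, resM_resM]

lemma IsFiniteType.of_epi {F G : SheafOfModules.{0} R} (f : F ⟶ G) [Epi f] (hF : IsFiniteType F) :
    IsFiniteType G := by
  intro x
  obtain ⟨U, hxU, n, s, hs⟩ := hF x
  refine ⟨U, hxU, n, fun i ↦ appM f U (s i), fun V hV t y hy ↦ ?_⟩
  obtain ⟨V', hV', hyV', t', ht'⟩ := exists_local_lift f t y hy
  obtain ⟨W, hW, hyW, c, hc⟩ := hs V' (hV'.trans hV) t' y hyV'
  refine ⟨W, hW.trans hV', hyW, c, ?_⟩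
  rw [← resM_resM G hV' hW, ← ht', ← appM_resM, hc, map_sum]
  exact Finset.sum_congr rfl fun i _ ↦ by rw [map_smul, appM_resM]

lemma HasFiniteTypeRelations.of_mono {F G : SheafOfModules.{0} R} (f : F ⟶ G) [Mono f]
    (hG : HasFiniteTypeRelations G) : HasFiniteTypeRelations F := by
  intro U n s x hx
  have key : ∀ {V : Opens X} (hV : V ≤ U) (c : Fin n → R.obj.obj (op V)),
      ∑ i, c i • resM G hV (appM f U (s i)) = 0 ↔ ∑ i, c i • resM F hV (s i) = 0 := by
    intro V hV c
    rw [← map_eq_zero_iff (appM f V) (appM_injective f V), map_sum]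
    simp only [map_smul, appM_resM]
  obtain ⟨V, hV, hxV, m, r, hr, hr'⟩ := hG U n (fun i ↦ appM f U (s i)) x hx
  exact ⟨V, hV, hxV, m, r, fun j ↦ (key hV _).1 (hr j), fun W hW c hc ↦
    hr' W hW c ((key _ _).2 hc)⟩

/-- The kernel of a morphism from a sheaf of finite type to a sheaf with relations of finite type
is of finite type. -/
lemma IsFiniteType.of_exact {S : ShortComplex (SheafOfModules.{0} R)} (hS : S.Exact) [Mono S.f]
    (h₂ : IsFiniteType S.X₂) (h₃ : HasFiniteTypeRelations S.X₃) : IsFiniteType S.X₁ := by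
  intro x
  obtain ⟨U, hxU, n, s, hs⟩ := h₂ x
  obtain ⟨V, hV, hxV, m, r, hr, hr'⟩ := h₃ U n (fun i ↦ appM S.g U (s i)) x hxU
  have hker : ∀ j, appM S.g V (∑ i, r j i • resM S.X₂ hV (s i)) = 0 := by
    intro j
    rw [← hr j, map_sum]
    exact Finset.sum_congr rfl fun i _ ↦ by rw [map_smul, appM_resM]
  choose a ha using fun j ↦ exists_appM_eq hS _ (hker j)
  refine ⟨V, hxV, m, a, fun W hW t y hy ↦ ?_⟩
  obtain ⟨W₁, hW₁, hy₁, c, hc⟩ := hs W (hW.trans hV) (appM S.f W t) y hy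
  have hrel : ∑ i, c i • resM S.X₃ ((hW₁.trans hW).trans hV) (appM S.g U (s i)) = 0 := by
    have h1 := congrArg (appM S.g W₁) hc
    rw [← appM_resM, ← appM_comp, S.zero, appM_zero, map_sum] at h1
    rw [h1]
    exact Finset.sum_congr rfl fun i _ ↦ by rw [map_smul, appM_resM]
  obtain ⟨W₂, hW₂, hy₂, d, hd⟩ := hr' W₁ (hW₁.trans hW) c hrel y hy₁
  refine ⟨W₂, hW₂.trans hW₁, hy₂, d, ?_⟩
  apply appM_injective S.f W₂
  rw [appM_resM, ← resM_resM S.X₂ hW₁ hW₂, hc, resM_sum_smul, map_sum]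
  simp only [map_smul, appM_resM, ha, resM_sum_smul, resM_resM, hd, Finset.sum_smul,
    Finset.smul_sum, mul_smul]
  exact Finset.sum_comm

/-- Lift the s i locally to the middle term and adjoin generators of the subsheaf. Relations between
the s i are the truncations to the first n coefficients of relations in this larger family. -/
lemma HasFiniteTypeRelations.of_shortExact {S : ShortComplex (SheafOfModules.{0} R)}
    (hS : S.ShortExact) (h₁ : IsFiniteType S.X₁) (h₂ : HasFiniteTypeRelations S.X₂) :
    HasFiniteTypeRelations S.X₃ := by
  have := hS.mono_f
  have := hS.epi_g
  intro U n s x hx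
  obtain ⟨V₀, hV₀, hx₀, b₀, hb₀⟩ := exists_local_lifts S.g s x hx
  obtain ⟨U₁, hxU₁, m, a₀, ha₀⟩ := h₁ x
  let V := V₀ ⊓ U₁
  have hVU : V ≤ U := inf_le_left.trans hV₀
  let b : Fin n → S.X₂.val.obj (op V) := fun i ↦ resM S.X₂ inf_le_left (b₀ i)
  let a : Fin m → S.X₁.val.obj (op V) := fun j ↦ resM S.X₁ inf_le_right (a₀ j)
  have hb : ∀ i, appM S.g V (b i) = resM S.X₃ hVU (s i) := fun i ↦ by
    rw [appM_resM, hb₀, resM_resM]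
  obtain ⟨V₂, hV₂, hxV₂, l, r, hr, hr'⟩ := h₂ V (n + m)
    (Fin.append b (fun j ↦ appM S.f V (a j))) x ⟨hx₀, hxU₁⟩
  have hgf : ∀ {W : Opens X} (t : S.X₁.val.obj (op W)), appM S.g W (appM S.f W t) = 0 := by
    intro W t
    rw [← appM_comp, S.zero, appM_zero]
  refine ⟨V₂, hV₂.trans hVU, hxV₂, l, fun k i ↦ r k (Fin.castAdd m i), fun k ↦ ?_,
    fun W hW c hc y hy ↦ ?_⟩
  · have h1 := congrArg (appM S.g V₂) (hr k)
    rw [Fin.sum_univ_add] at h1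
    simpa only [Fin.append_left, Fin.append_right, map_add, map_sum, map_smul, appM_resM, hb, hgf,
      resM_resM, map_zero, smul_zero, Finset.sum_const_zero, add_zero] using h1
  · have hWV : W ≤ V := hW.trans hV₂
    have hker : appM S.g W (∑ i, c i • resM S.X₂ hWV (b i)) = 0 := by
      rw [← hc, map_sum]
      exact Finset.sum_congr rfl fun i _ ↦ by rw [map_smul, appM_resM, hb, resM_resM]
    obtain ⟨t, ht⟩ := exists_appM_eq hS.exact _ hker
    obtain ⟨W₁, hW₁, hy₁, e, he⟩ := ha₀ W (hWV.trans inf_le_right) t y hy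
    obtain ⟨W₂, hW₂, hy₂, d, hd⟩ := hr' W₁ (hW₁.trans hW)
      (Fin.append (fun i ↦ resR R hW₁ (c i)) (fun j ↦ - e j)) (by
        rw [Fin.sum_univ_add]
        simp only [Fin.append_left, Fin.append_right]
        have h1 := congrArg (resM S.X₂ hW₁) ht
        rw [← appM_resM, he, resM_sum_smul, map_sum] at h1
        simp only [resM_resM] at h1
        rw [← h1, ← Finset.sum_add_distrib]
        refine Finset.sum_eq_zero fun j _ ↦ ?_
        rw [map_smul, appM_resM, neg_smul, appM_resM, resM_resM, add_neg_cancel]) y hy₁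
    refine ⟨W₂, hW₂.trans hW₁, hy₂, d, fun i ↦ ?_⟩
    have h2 := hd (Fin.castAdd m i)
    rw [Fin.append_left, resR_resR] at h2
    exact h2

end CoherentClosure

/-! ### Supports; coherent sheaves form a support theory. -/

section Support

open Limits

variable {X : TopCat.{0}} {R : Sheaf (Opens.grothendieckTopology X) RingCat.{0}}

lemma notMem_support_iff (F : SheafOfModules.{0} R) (x : X) :
    x ∉ support F ↔ ∀ (U : Opens X) (_ : x ∈ U) (s : F.val.obj (op U)),
      ∃ (V : Opens X) (hV : V ≤ U), x ∈ V ∧ resM F hV s = 0 := by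
  rw [support, Set.mem_ofPred_eq, not_nontrivial_iff_subsingleton]
  constructor
  · intro h U hx s
    have h1 := Subsingleton.elim
      (TopCat.Presheaf.germ (C := AddCommGrpCat.{0}) (X := X) F.val.presheaf U x hx s)
      (TopCat.Presheaf.germ (C := AddCommGrpCat.{0}) (X := X) F.val.presheaf U x hx 0)
    obtain ⟨W, hxW, iU, iV, h2⟩ := TopCat.Presheaf.germ_eq (C := AddCommGrpCat.{0}) (X := X)
      F.val.presheaf x hx hx s 0 h1
    refine ⟨W, leOfHom iU, hxW, ?_⟩
    have h3 : resM F (leOfHom iU) s = resM F (leOfHom iU) 0 := h2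
    rw [h3, map_zero]
  · intro h
    refine ⟨fun a b ↦ ?_⟩
    have key : ∀ a : TopCat.Presheaf.stalk (C := AddCommGrpCat.{0}) (X := X) F.val.presheaf x,
        a = 0 := by
      intro a
      obtain ⟨U, hx, s, rfl⟩ := TopCat.Presheaf.exists_germ_eq (C := AddCommGrpCat.{0}) (X := X)
        F.val.presheaf a
      obtain ⟨V, hV, hxV, hs⟩ := h U hx s
      rw [← TopCat.Presheaf.germ_res_apply (C := AddCommGrpCat.{0}) (X := X) F.val.presheaf
        (homOfLE hV) x hxV s]
      have h2 : F.val.presheaf.map (homOfLE hV).op s = 0 := hs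
      rw [h2, map_zero]
    rw [key a, key b]

lemma support_subset_of_mono {F G : SheafOfModules.{0} R} (f : F ⟶ G) [Mono f] :
    support F ⊆ support G := by
  intro x
  contrapose
  rw [notMem_support_iff, notMem_support_iff]
  intro h U hx s
  obtain ⟨V, hV, hxV, hs⟩ := h U hx (appM f U s)
  refine ⟨V, hV, hxV, appM_injective f V ?_⟩
  rw [appM_resM, hs, map_zero]

lemma support_subset_of_epi {F G : SheafOfModules.{0} R} (f : F ⟶ G) [Epi f] :
    support G ⊆ support F := by
  intro x
  contrapose
  rw [notMem_support_iff, notMem_support_iff]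
  intro h U hx s
  obtain ⟨V, hV, hxV, t, ht⟩ := exists_local_lift f s x hx
  obtain ⟨W, hW, hxW, h0⟩ := h V hxV t
  refine ⟨W, hW.trans hV, hxW, ?_⟩
  rw [← resM_resM G hV hW, ← ht, ← appM_resM, h0, map_zero]

lemma IsCoherent.kernel {F G : SheafOfModules.{0} R} (f : F ⟶ G) (hF : IsCoherent F)
    (hG : IsCoherent G) : IsCoherent (kernel f) :=
  ⟨IsFiniteType.of_exact (S := ShortComplex.mk (kernel.ι f) f (kernel.condition f))
    (ShortComplex.exact_kernel f) hF.1 hG.2, hF.2.of_mono (kernel.ι f)⟩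

lemma IsCoherent.cokernel {F G : SheafOfModules.{0} R} (f : F ⟶ G) (hF : IsCoherent F)
    (hG : IsCoherent G) : IsCoherent (cokernel f) :=
  ⟨hG.1.of_epi (cokernel.π f),
    HasFiniteTypeRelations.of_shortExact
      (S := ShortComplex.mk (Abelian.image.ι f) (cokernel.π f) (kernel.condition _))
      { exact := ShortComplex.exact_kernel _, mono_f := inferInstance, epi_g := inferInstance }
      (hF.1.of_epi (Abelian.factorThruImage f)) hG.2⟩

lemma isSupportTheory (R : Sheaf (Opens.grothendieckTopology X) RingCat.{0}) :
    IsSupportTheory (cohWithSupport R) where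
  mono _ _ h := cohWithSupport_mono R h
  inter h h' := ⟨h.1, Set.subset_inter h.2 h'.2⟩
  sub {_ S} hS h₁ h₂ := by
    have := hS.mono_f
    exact ⟨h₁.1, (support_subset_of_mono S.f).trans h₂.2⟩
  quot {_ S} hS h₃ h₂ := by
    have := hS.epi_g
    exact ⟨h₃.1, (support_subset_of_epi S.g).trans h₂.2⟩
  kernel f hF hG := ⟨IsCoherent.kernel f hF.1 hG.1, Set.subset_univ _⟩
  cokernel f hF hG := ⟨IsCoherent.cokernel f hF.1 hG.1, Set.subset_univ _⟩

end Support

/-! ### The subsheaf annihilated by a locally principal ideal. -/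

section Annihilator

open Limits

variable {X : TopCat.{0}} {R : Sheaf (Opens.grothendieckTopology X) RingCat.{0}}

/-- Over `U`, the set of sections `J` is, locally, contained in the ideal generated by `e`. -/
def IsLocalGenerator (J : ∀ U : Opens X, Set (R.obj.obj (op U))) {U : Opens X}
    (e : R.obj.obj (op U)) : Prop :=
  ∀ (V : Opens X) (hV : V ≤ U), ∀ c ∈ J V, ∀ y ∈ V, ∃ (W : Opens X) (hW : W ≤ V) (_ : y ∈ W)
    (d : R.obj.obj (op W)), resR R hW c = d * resR R (hW.trans hV) e

lemma IsLocalGenerator.res {J : ∀ U : Opens X, Set (R.obj.obj (op U))} {U V : Opens X}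
    {e : R.obj.obj (op U)} (he : IsLocalGenerator J e) (h : V ≤ U) :
    IsLocalGenerator J (resR R h e) := by
  intro W hW c hc y hy
  obtain ⟨W', hW', hy', d, hd⟩ := he W (hW.trans h) c hc y hy
  exact ⟨W', hW', hy', d, by rw [hd, resR_resR]⟩

/-- `J` is a locally principal ideal, given by sets of sections which are stable under restriction
and locally generated by one of their elements. -/
structure IsLocallyPrincipal (J : ∀ U : Opens X, Set (R.obj.obj (op U))) : Prop where
  res_mem : ∀ {U V : Opens X} (h : V ≤ U), ∀ c ∈ J U, resR R h c ∈ J V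
  exists_generator : ∀ x : X, ∃ (U : Opens X) (_ : x ∈ U), ∃ e ∈ J U, IsLocalGenerator J e

/-- The sections of `F` annihilated by `J`. -/
def annihilated (hcomm : ∀ (U : Opens X) (a b : R.obj.obj (op U)), a * b = b * a)
    (J : ∀ U : Opens X, Set (R.obj.obj (op U))) (F : SheafOfModules.{0} R) : F.val.Submodule where
  obj U :=
    { carrier := {s | ∀ (V : Opens X) (hV : V ≤ U.unop), ∀ c ∈ J V, c • resM F hV s = 0}
      add_mem' := by
        intro s t hs ht V hV c hc
        rw [map_add, smul_add, hs V hV c hc, ht V hV c hc, add_zero]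
      zero_mem' := fun V hV c _ ↦ by rw [map_zero, smul_zero]
      smul_mem' := by
        intro a s hs V hV c hc
        have h := resM_smul F hV a s
        rw [h, ← mul_smul, hcomm, mul_smul, hs V hV c hc, smul_zero] }
  map {U V} h s hs W hW c hc := by
    have := hs W (hW.trans (leOfHom h.unop)) c hc
    rw [← resM_resM F (leOfHom h.unop) hW] at this
    exact this

variable (hcomm : ∀ (U : Opens X) (a b : R.obj.obj (op U)), a * b = b * a)
  {J : ∀ U : Opens X, Set (R.obj.obj (op U))}

lemma mem_annihilated_iff {F : SheafOfModules.{0} R} {U : Opens X} {s : F.val.obj (op U)} :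
    s ∈ (annihilated hcomm J F).obj (op U) ↔
      ∀ (V : Opens X) (hV : V ≤ U), ∀ c ∈ J V, c • resM F hV s = 0 := Iff.rfl

lemma smul_eq_zero_iff_of_isLocalGenerator {F : SheafOfModules.{0} R} {U : Opens X}
    {e : R.obj.obj (op U)} (heJ : e ∈ J U) (he : IsLocalGenerator J e) {s : F.val.obj (op U)} :
    s ∈ (annihilated hcomm J F).obj (op U) ↔ e • s = 0 := by
  rw [mem_annihilated_iff]
  constructor
  · intro h
    have := h U le_rfl e heJ
    rwa [resM_self] at this
  · intro h V hV c hc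
    refine eq_of_locally F fun y hy ↦ ?_
    obtain ⟨W, hW, hyW, d, hd⟩ := he V hV c hc y hy
    refine ⟨W, hW, hyW, ?_⟩
    rw [resM_smul, hd, resM_resM, mul_smul, ← resM_smul, h, map_zero, map_zero, smul_zero]

lemma isLocalSubmodule_annihilated (hJ : IsLocallyPrincipal J) (F : SheafOfModules.{0} R) :
    IsLocalSubmodule (annihilated hcomm J F) := by
  intro U s h V hV c hc
  refine eq_of_locally F fun y hy ↦ ?_
  obtain ⟨W, hW, hyW, hs⟩ := h y (hV hy)
  refine ⟨W ⊓ V, inf_le_right, ⟨hyW, hy⟩, ?_⟩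
  have := hs (W ⊓ V) inf_le_left _ (hJ.res_mem inf_le_right c hc)
  rw [resM_resM] at this
  rw [resM_smul, resM_resM, this, map_zero]

/-- Near a point the subsheaf is the kernel of multiplication by a generator e. If sections s i
generate F, its sections are the combinations of the s i whose coefficients are relations between
the e • s i, and these are finitely generated. -/
lemma isCoherent_annihilated (hJ : IsLocallyPrincipal J) {F : SheafOfModules.{0} R} (hF : IsCoherent F) :
    IsCoherent (subsheaf _ (isLocalSubmodule_annihilated hcomm hJ F)) := by
  refine ⟨fun x ↦ ?_, hF.2.of_mono (subsheafι _ _)⟩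
  obtain ⟨U₁, hx₁, e₁, heJ₁, he₁⟩ := hJ.exists_generator x
  obtain ⟨U₂, hx₂, n, s₂, hs₂⟩ := hF.1 x
  obtain ⟨V, hV, hxV, m, r, hr, hr'⟩ := hF.2 (U₁ ⊓ U₂) n
    (fun i ↦ resR R (inf_le_left : U₁ ⊓ U₂ ≤ U₁) e₁ •
      resM F (inf_le_right : U₁ ⊓ U₂ ≤ U₂) (s₂ i)) x ⟨hx₁, hx₂⟩
  have hV₁ : V ≤ U₁ := hV.trans inf_le_left
  have hV₂ : V ≤ U₂ := hV.trans inf_le_right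
  have ha : ∀ j, ∑ i, r j i • resM F hV₂ (s₂ i) ∈ (annihilated hcomm J F).obj (op V) := by
    intro j
    rw [smul_eq_zero_iff_of_isLocalGenerator hcomm (hJ.res_mem hV₁ _ heJ₁) (he₁.res hV₁),
      ← hr j, Finset.smul_sum]
    refine Finset.sum_congr rfl fun i _ ↦ ?_
    rw [resM_smul, resM_resM, resR_resR, ← mul_smul, ← mul_smul, hcomm]
  refine ⟨V, hxV, m, fun j ↦ ⟨_, ha j⟩, fun W hW t y hy ↦ ?_⟩
  obtain ⟨W₁, hW₁, hy₁, c, hc⟩ := hs₂ W (hW.trans hV₂) t.1 y hy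
  have hrel : ∑ i, c i • resM F ((hW₁.trans hW).trans hV)
      (resR R (inf_le_left : U₁ ⊓ U₂ ≤ U₁) e₁ •
        resM F (inf_le_right : U₁ ⊓ U₂ ≤ U₂) (s₂ i)) = 0 := by
    have h1 := (smul_eq_zero_iff_of_isLocalGenerator hcomm
      (hJ.res_mem (hW.trans hV₁) _ heJ₁) (he₁.res (hW.trans hV₁))).1 t.2
    have h2 := congrArg (resM F hW₁) h1
    rw [resM_smul, hc, map_zero, Finset.smul_sum] at h2
    rw [← h2]
    refine Finset.sum_congr rfl fun i _ ↦ ?_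
    rw [resM_smul, resM_resM, resR_resR, resR_resR, ← mul_smul, ← mul_smul, hcomm]
  obtain ⟨W₂, hW₂, hy₂, d, hd⟩ := hr' W₁ (hW₁.trans hW) c hrel y hy₁
  refine ⟨W₂, hW₂.trans hW₁, hy₂, d, ?_⟩
  apply appM_injective (subsheafι _ (isLocalSubmodule_annihilated hcomm hJ F)) W₂
  simp only [map_sum, map_smul, appM_resM]
  change resM F _ t.1 = ∑ j, d j • resM F _ (∑ i, r j i • resM F hV₂ (s₂ i))
  rw [← resM_resM F hW₁ hW₂, hc, resM_sum_smul]
  simp only [resM_sum_smul, resM_resM, hd, Finset.sum_smul, Finset.smul_sum, mul_smul]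
  exact Finset.sum_comm

lemma support_annihilated_subset (hJ : IsLocallyPrincipal J) (F : SheafOfModules.{0} R) {Z : Set X}
    (hZ : ∀ x ∉ Z, ∃ U : Opens X, x ∈ U ∧ 1 ∈ J U) :
    support (subsheaf _ (isLocalSubmodule_annihilated hcomm hJ F)) ⊆ Z := by
  intro x
  contrapose
  intro hx
  rw [notMem_support_iff]
  intro U hxU s
  obtain ⟨V, hxV, h1⟩ := hZ x hx
  refine ⟨V ⊓ U, inf_le_right, ⟨hxV, hxU⟩, Subtype.ext ?_⟩
  have h2 := s.2 (V ⊓ U) inf_le_right _ (hJ.res_mem inf_le_left 1 h1)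
  rw [map_one, one_smul] at h2
  exact h2

end Annihilator

/-! ### Products of ideals and the filtration by annihilators. -/

section Killed

open Limits

variable {X : TopCat.{0}} {R : Sheaf (Opens.grothendieckTopology X) RingCat.{0}} {ι : Type}

/-- All the products of one section from each of the sets `J i`, for the indices `i` of a list,
annihilate the section `s`. -/
def KilledBy (J : ι → ∀ U : Opens X, Set (R.obj.obj (op U))) (F : SheafOfModules.{0} R) :
    List ι → ∀ U : Opens X, F.val.obj (op U) → Prop
  | [], _, s => s = 0
  | i :: l, U, s => ∀ (V : Opens X) (hV : V ≤ U), ∀ c ∈ J i V, KilledBy J F l V (c • resM F hV s)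

variable {J : ι → ∀ U : Opens X, Set (R.obj.obj (op U))} {F : SheafOfModules.{0} R}

lemma KilledBy.of_locally (hJ : ∀ i, IsLocallyPrincipal (J i)) (l : List ι) {U : Opens X}
    {s : F.val.obj (op U)}
    (h : ∀ x ∈ U, ∃ (V : Opens X) (hV : V ≤ U), x ∈ V ∧ KilledBy J F l V (resM F hV s)) :
    KilledBy J F l U s := by
  induction l generalizing U with
  | nil =>
    refine eq_of_locally F fun x hx ↦ ?_
    obtain ⟨V, hV, hxV, hs⟩ := h x hx
    exact ⟨V, hV, hxV, by rw [map_zero]; exact hs⟩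
  | cons i l ih =>
    intro V hV c hc
    refine ih fun y hy ↦ ?_
    obtain ⟨W, hW, hyW, hs⟩ := h y (hV hy)
    refine ⟨W ⊓ V, inf_le_right, ⟨hyW, hy⟩, ?_⟩
    have := hs (W ⊓ V) inf_le_left _ ((hJ i).res_mem inf_le_right c hc)
    rw [resM_resM] at this
    rwa [resM_smul, resM_resM]

lemma KilledBy.smul (hcomm : ∀ (U : Opens X) (a b : R.obj.obj (op U)), a * b = b * a)
    (l : List ι) {U : Opens X} {s : F.val.obj (op U)} (h : KilledBy J F l U s)
    (a : R.obj.obj (op U)) : KilledBy J F l U (a • s) := by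
  induction l generalizing U with
  | nil => exact (congrArg (a • ·) h).trans (smul_zero a)
  | cons i l ih =>
    intro V hV c hc
    rw [resM_smul, ← mul_smul, hcomm, mul_smul]
    exact ih (h V hV c hc) _

lemma KilledBy.of_prod_smul_eq_zero (hJ : ∀ i, IsLocallyPrincipal (J i))
    (hcomm : ∀ (U : Opens X) (a b : R.obj.obj (op U)), a * b = b * a) (l : List ι) {U : Opens X}
    {e : ι → R.obj.obj (op U)} (he : ∀ i, IsLocalGenerator (J i) (e i)) {V : Opens X} (hV : V ≤ U)
    {s : F.val.obj (op V)} (h : resR R hV (l.map e).prod • s = 0) : KilledBy J F l V s := by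
  induction l generalizing V with
  | nil => simpa [KilledBy] using h
  | cons i l ih =>
    intro W hW c hc
    refine KilledBy.of_locally hJ l fun y hy ↦ ?_
    obtain ⟨W', hW', hyW', d, hd⟩ := he i W (hW.trans hV) c hc y hy
    refine ⟨W', hW', hyW', ?_⟩
    rw [resM_smul, hd, resM_resM, mul_smul]
    refine KilledBy.smul hcomm l (ih ((hW'.trans hW).trans hV) ?_) d
    have := congrArg (resM F (hW'.trans hW)) h
    rw [List.map_cons, List.prod_cons, resM_smul, map_zero, resR_resR, map_mul, hcomm,
      mul_smul] at this
    exact this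

/-- After the factors of l have been applied, what remains is annihilated by the last ideal, and p
kills such sections. -/
lemma KilledBy.of_append (hcomm : ∀ (U : Opens X) (a b : R.obj.obj (op U)), a * b = b * a)
    {G : SheafOfModules.{0} R} (p : F ⟶ G) (i : ι)
    (hp : ∀ (U : Opens X), ∀ s ∈ (annihilated hcomm (J i) F).obj (op U), appM p U s = 0)
    (l : List ι) {U : Opens X} {s : F.val.obj (op U)} (h : KilledBy J F (l ++ [i]) U s) :
    KilledBy J G l U (appM p U s) := by
  induction l generalizing U with
  | nil => exact hp U s h
  | cons j l ih =>
    intro V hV c hc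
    rw [← appM_resM, ← map_smul]
    exact ih (h V hV c hc)

/-- A coherent sheaf killed by a product of the ideals `J i` is a successive extension of coherent
sheaves with support in the zero sets of these ideals. -/
theorem exists_dev (hcomm : ∀ (U : Opens X) (a b : R.obj.obj (op U)), a * b = b * a)
    (hJ : ∀ i, IsLocallyPrincipal (J i)) {D : ι → Set X}
    (hD : ∀ i, ∀ x ∉ D i, ∃ U : Opens X, x ∈ U ∧ 1 ∈ J i U) {A : Type*} [AddCommGroup A]
    (q : ∀ i, K0 (cohWithSupport R (D i)) →+ A) (l : List ι) {F : SheafOfModules.{0} R}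
    (hF : IsCoherent F) (h : ∀ (U : Opens X) (s : F.val.obj (op U)), KilledBy J F l U s) :
    ∃ a, Dev (cohWithSupport R) D q F a := by
  induction l using List.reverseRecOn generalizing F with
  | nil =>
    refine ⟨0, .zero ?_⟩
    rw [IsZero.iff_id_eq_zero]
    ext U s
    exact h U.unop s
  | append_singleton l i ih =>
    -- The sections annihilated by the last ideal form a piece with support in D i; the quotient is
    -- killed by the shorter list.
    let ν := subsheafι _ (isLocalSubmodule_annihilated hcomm (hJ i) F)
    have hN : cohWithSupport R (D i) (subsheaf _ (isLocalSubmodule_annihilated hcomm (hJ i) F)) :=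
      ⟨isCoherent_annihilated hcomm (hJ i) hF, support_annihilated_subset hcomm (hJ i) F (hD i)⟩
    have hQ := IsCoherent.cokernel ν hN.1 hF
    obtain ⟨a, ha⟩ := ih hQ fun U s ↦ KilledBy.of_locally hJ l fun x hx ↦ by
      obtain ⟨V, hV, hxV, t, ht⟩ := exists_local_lift (cokernel.π ν) s x hx
      refine ⟨V, hV, hxV, ht ▸ KilledBy.of_append hcomm (cokernel.π ν) i ?_ l (h V t)⟩
      intro W t ht
      let t' : (subsheaf _ (isLocalSubmodule_annihilated hcomm (hJ i) F)).val.obj (op W) := ⟨t, ht⟩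
      change appM (cokernel.π ν) W (appM ν W t') = 0
      rw [← appM_comp, cokernel.condition, appM_zero]
    exact ⟨_, .ext (ShortComplex.mk ν (cokernel.π ν) (cokernel.condition ν))
      { exact := ShortComplex.exact_cokernel ν, mono_f := inferInstance, epi_g := inferInstance }
      ⟨hN.1, Set.subset_univ _⟩ ⟨hF, Set.subset_univ _⟩ ⟨hQ, Set.subset_univ _⟩ (.piece i hN) ha⟩

end Killed

/-! ### Holomorphic functions in charts. -/

section Neighbourhoods

open Topology

variable {X : Type} [TopologicalSpace X]

/-- A property of the points near `x` can be checked in a chart. -/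
lemma eventually_nhds_chart {H : Type} [TopologicalSpace H] {φ : OpenPartialHomeomorph X H} {x : X}
    (hx : x ∈ φ.source) {p : H → Prop} :
    (∀ᶠ z in 𝓝 (φ x), p z) ↔ ∀ᶠ y in 𝓝 x, p (φ y) := by
  rw [← φ.map_nhds_eq hx, Filter.eventually_map]

lemma exists_opens_of_eventually {x : X} {p : X → Prop} (h : ∀ᶠ y in 𝓝 x, p y)
    {U : Opens (TopCat.of X)} (hxU : x ∈ U) :
    ∃ V : Opens (TopCat.of X), V ≤ U ∧ x ∈ V ∧ ∀ y ∈ V, p y := by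
  obtain ⟨t, ht, hto, hxt⟩ := eventually_nhds_iff.1 h
  exact ⟨⟨t, hto⟩ ⊓ U, inf_le_right, ⟨hxt, hxU⟩, fun y hy ↦ ht y hy.1⟩

end Neighbourhoods

section HolomorphicSections

open Topology

variable {n : ℕ} {X : Type} [TopologicalSpace X] [ChartedSpace (EuclideanSpace ℂ (Fin n)) X]

/-- The value of a holomorphic function at a point. -/
def evalAt {U : Opens (TopCat.of X)} {y : X} (hy : y ∈ U) : (holSheaf n X).obj.obj (op U) →+* ℂ :=
  ContMDiffMap.evalRingHom (I := 𝓘(ℂ, EuclideanSpace ℂ (Fin n))) (I' := 𝓘(ℂ)) (N := (U : Opens X))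
    (R := ℂ) (n := ∞) ⟨y, hy⟩

lemma evalAt_resR {U V : Opens (TopCat.of X)} (h : V ≤ U) {y : X} (hy : y ∈ V)
    (c : (holSheaf n X).obj.obj (op U)) : evalAt hy (resR (holSheaf n X) h c) = evalAt (h hy) c :=
  rfl

lemma section_ext {U : Opens (TopCat.of X)} {c d : (holSheaf n X).obj.obj (op U)}
    (h : ∀ (y : X) (hy : y ∈ U), evalAt hy c = evalAt hy d) : c = d :=
  ContMDiffMap.ext (I := 𝓘(ℂ, EuclideanSpace ℂ (Fin n))) (I' := 𝓘(ℂ)) (M := (U : Opens X))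
    (M' := ℂ) (n := ∞) fun y ↦ h y.1 y.2

lemma holSheaf_mul_comm (U : Opens (TopCat.of X)) (a b : (holSheaf n X).obj.obj (op U)) :
    a * b = b * a :=
  section_ext fun y hy ↦ by rw [map_mul, map_mul, mul_comm]

lemma exists_section_of_contMDiffAt {U : Opens (TopCat.of X)} {f : X → ℂ}
    (hf : ∀ y ∈ U, ContMDiffAt 𝓘(ℂ, EuclideanSpace ℂ (Fin n)) 𝓘(ℂ) ∞ f y) :
    ∃ c : (holSheaf n X).obj.obj (op U), ∀ (y : X) (hy : y ∈ U), evalAt hy c = f y :=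
  ⟨(⟨fun y ↦ f y.1, fun y ↦ contMDiffAt_subtype_iff.2 (hf y.1 y.2)⟩ :
    C^∞⟮𝓘(ℂ, EuclideanSpace ℂ (Fin n)), (U : Opens X); 𝓘(ℂ), ℂ⟯), fun _ _ ↦ rfl⟩

open Classical in
lemma exists_contMDiffAt_of_section {U : Opens (TopCat.of X)}
    (c : (holSheaf n X).obj.obj (op U)) : ∃ f : X → ℂ, (∀ (y : X) (hy : y ∈ U), evalAt hy c = f y) ∧
      ∀ y ∈ U, ContMDiffAt 𝓘(ℂ, EuclideanSpace ℂ (Fin n)) 𝓘(ℂ) ∞ f y := by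
  let f : X → ℂ := fun y ↦ if hy : y ∈ U then evalAt hy c else 0
  have hf : ∀ (y : X) (hy : y ∈ U), evalAt hy c = f y := fun y hy ↦ by simp only [f, dif_pos hy]
  refine ⟨f, hf, fun y hy ↦ ?_⟩
  have h := ContMDiffMap.contMDiff (show C^∞⟮𝓘(ℂ, EuclideanSpace ℂ (Fin n)), (U : Opens X);
    𝓘(ℂ), ℂ⟯ from c)
  refine (contMDiffAt_subtype_iff (U := (U : Opens X)) (x := ⟨y, hy⟩)).1 ?_
  refine (h ⟨y, hy⟩).congr_of_eventuallyEq (Filter.Eventually.of_forall fun z ↦ ?_)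
  exact (hf z.1 z.2).symm

variable {φ : OpenPartialHomeomorph X (EuclideanSpace ℂ (Fin n))}

/-- In a chart, holomorphic functions are analytic. -/
lemma exists_analyticAt_of_section
    (hφ : φ ∈ IsManifold.maximalAtlas 𝓘(ℂ, EuclideanSpace ℂ (Fin n)) ω X) {x : X}
    (hx : x ∈ φ.source) {U : Opens (TopCat.of X)} (hxU : x ∈ U)
    (c : (holSheaf n X).obj.obj (op U)) :
    ∃ f : EuclideanSpace ℂ (Fin n) → ℂ, AnalyticAt ℂ f (φ x) ∧
      ∀ y ∈ φ.source, ∀ hy : y ∈ U, evalAt hy c = f (φ y) := by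
  obtain ⟨f, hf, hfU⟩ := exists_contMDiffAt_of_section c
  refine ⟨f ∘ φ.symm, ?_, fun y hy hyU ↦ by rw [hf, Function.comp_apply, φ.left_inv hy]⟩
  have hopen : IsOpen (φ.target ∩ φ.symm ⁻¹' (U : Set X)) :=
    φ.symm.isOpen_inter_preimage U.isOpen
  refine analyticAt_of_differentiableOn hopen (fun z hz ↦ ?_) ⟨φ.map_source hx, by
    rw [Set.mem_preimage, φ.left_inv hx]; exact hxU⟩
  have h1 := (contMDiffOn_symm_of_mem_maximalAtlas hφ).contMDiffAt (φ.open_target.mem_nhds hz.1)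
  have h2 : ContMDiffAt 𝓘(ℂ, EuclideanSpace ℂ (Fin n)) 𝓘(ℂ) ∞ (f ∘ φ.symm) z :=
    (hfU _ hz.2).comp z (h1.of_le le_top)
  exact (h2.contDiffAt.differentiableAt (by simp)).differentiableWithinAt

/-- A germ of analytic functions in a chart defines a holomorphic function. -/
lemma exists_section_of_analyticAt
    (hφ : φ ∈ IsManifold.maximalAtlas 𝓘(ℂ, EuclideanSpace ℂ (Fin n)) ω X) {x : X}
    (hx : x ∈ φ.source) {f : EuclideanSpace ℂ (Fin n) → ℂ} (hf : AnalyticAt ℂ f (φ x)) :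
    ∃ (V : Opens (TopCat.of X)) (_ : x ∈ V) (c : (holSheaf n X).obj.obj (op V)),
      ∀ (y : X) (hy : y ∈ V), evalAt hy c = f (φ y) := by
  let S := {z | AnalyticAt ℂ f z}
  have hS : IsOpen S := isOpen_analyticAt ℂ f
  let V : Opens (TopCat.of X) := ⟨φ.source ∩ φ ⁻¹' S, φ.isOpen_inter_preimage hS⟩
  obtain ⟨c, hc⟩ := exists_section_of_contMDiffAt (n := n) (U := V) (f := f ∘ φ) fun y hy ↦ by
    have h1 := (contMDiffOn_of_mem_maximalAtlas hφ).contMDiffAt (φ.open_source.mem_nhds hy.1)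
    have h2 : AnalyticAt ℂ f (φ y) := hy.2
    exact ContMDiffAt.comp y (h2.contDiffAt (n := ∞)).contMDiffAt (h1.of_le le_top)
  exact ⟨V, ⟨hx, hf⟩, c, hc⟩

end HolomorphicSections

/-! ### Minors of relations and the Nullstellensatz for coherent sheaves. -/

section Determinants

/-- A matrix with a left inverse has an invertible maximal minor. -/
lemma exists_det_ne_zero {m b : ℕ} {d : Fin b → Fin m → ℂ} {r : Fin m → Fin b → ℂ}
    (h : ∀ i j, ∑ k, d i k * r k j = if i = j then 1 else 0) :
    ∃ σ : Fin b → Fin m, (Matrix.of fun i j ↦ r (σ i) j).det ≠ 0 := by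
  by_contra! H
  have h1 : (Matrix.of fun i j ↦ ∑ k, d i k * r k j).det = 1 := by
    rw [← Matrix.det_one (n := Fin b)]
    congr 1
    ext i j
    rw [Matrix.of_apply, h, Matrix.one_apply]
  have h2 : (Matrix.of fun i j ↦ ∑ k, d i k * r k j).det =
      Matrix.detRowAlternating.toMultilinearMap (fun i ↦ ∑ k, d i k • r k) := by
    change Matrix.det _ = Matrix.det _
    congr 1
    ext i j
    simp [Finset.sum_apply]
  -- Expanding the determinant of the product row by row writes 1 as a combination of the minors of
  -- r; they cannot all vanish.
  rw [h2, MultilinearMap.map_sum] at h1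
  refine zero_ne_one (h1 ▸ (Finset.sum_eq_zero fun σ _ ↦ ?_).symm)
  rw [MultilinearMap.map_smul_univ]
  exact (congrArg _ (H σ)).trans (smul_zero _)

/-- The minors of a matrix of relations between elements of a module annihilate these elements. -/
lemma exists_annihilator_of_relations {A M : Type} [Ring A] (hcomm : ∀ a b : A, a * b = b * a)
    [AddCommGroup M] [Module A M] {b : ℕ} {r : Fin b → Fin b → A} {s : Fin b → M}
    (h : ∀ i, ∑ j, r i j • s j = 0) : ∃ δ : A, (∀ j, δ • s j = 0) ∧
      ∀ f : A →+* ℂ, f δ = (Matrix.of fun i j ↦ f (r i j)).det := by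
  -- `holSheaf` takes values in `RingCat`, so commutativity enters as a hypothesis.
  let _ : CommRing A := { (inferInstance : Ring A) with mul_comm := hcomm }
  refine ⟨(Matrix.of r).det, fun j ↦ ?_, fun f ↦ by rw [RingHom.map_det]; rfl⟩
  have h1 : ∑ k, ((Matrix.of r).adjugate * Matrix.of r) j k • s k = 0 := by
    simp only [Matrix.mul_apply, Finset.sum_smul, mul_smul]
    rw [Finset.sum_comm]
    refine Finset.sum_eq_zero fun i _ ↦ ?_
    rw [← Finset.smul_sum]
    exact (congrArg _ (h i)).trans (smul_zero _)
  rw [Matrix.adjugate_mul] at h1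
  simpa [Matrix.one_apply, ite_smul] using h1

end Determinants

section SheafNullstellensatz

open Topology

variable {n : ℕ} {X : Type} [TopologicalSpace X] [ChartedSpace (EuclideanSpace ℂ (Fin n)) X]

/-- Where all the maximal minors of a matrix of generating relations vanish, the sheaf has a
nonzero stalk. -/
lemma mem_support_of_det_eq_zero {F : SheafOfModules.{0} (holSheaf n X)}
    {V : Opens (TopCat.of X)} {b m : ℕ} {s : Fin b → F.val.obj (op V)}
    {r : Fin m → Fin b → (holSheaf n X).obj.obj (op V)}
    (hr : ∀ (W : Opens (TopCat.of X)) (hW : W ≤ V) (c : Fin b → (holSheaf n X).obj.obj (op W)),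
      ∑ i, c i • resM F hW (s i) = 0 → ∀ y ∈ W,
        ∃ (W' : Opens (TopCat.of X)) (hW' : W' ≤ W) (_ : y ∈ W')
          (d : Fin m → (holSheaf n X).obj.obj (op W')),
          ∀ i, resR _ hW' (c i) = ∑ j, d j * resR _ (hW'.trans hW) (r j i))
    {y : X} (hy : y ∈ V)
    (h : ∀ σ : Fin b → Fin m, (Matrix.of fun i j ↦ evalAt hy (r (σ i) j)).det = 0) :
    y ∈ support F := by
  by_contra hsupp
  rw [notMem_support_iff] at hsupp
  choose W hW hyW h0 using fun j ↦ hsupp V hy (s j)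
  -- If the stalk at y were zero, each s j would vanish near y, so the j-th unit vector would be a
  -- relation there, hence a combination of the generating ones. Evaluation at y gives a left
  -- inverse of the matrix of values of r.
  have key : ∀ j, ∃ d : Fin m → ℂ, ∀ i,
      (if j = i then (1 : ℂ) else 0) = ∑ k, d k * evalAt hy (r k i) := by
    intro j
    obtain ⟨W', hW', hyW', d, hd⟩ := hr (W j) (hW j) (fun i ↦ if j = i then 1 else 0)
      (by simp only [ite_smul, one_smul, zero_smul, Finset.sum_ite_eq, Finset.mem_univ, if_true,
            h0]) y (hyW j)
    refine ⟨fun k ↦ evalAt hyW' (d k), fun i ↦ ?_⟩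
    have := congrArg (evalAt hyW') (hd i)
    rw [map_sum, evalAt_resR, apply_ite (evalAt (hW' hyW')), map_one, map_zero] at this
    rw [this]
    exact Finset.sum_congr rfl fun k _ ↦ by rw [map_mul, evalAt_resR]
  choose d hd using key
  obtain ⟨σ, hσ⟩ := exists_det_ne_zero (d := d) (r := fun k i ↦ evalAt hy (r k i))
    (fun i j ↦ (hd i j).symm)
  exact hσ (h σ)

/-- A holomorphic function vanishing on the support of a coherent sheaf has, locally, a power
annihilating this sheaf. -/
theorem exists_pow_smul_eq_zero [IsManifold 𝓘(ℂ, EuclideanSpace ℂ (Fin n)) ω X]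
    {F : SheafOfModules.{0} (holSheaf n X)} (hF : IsCoherent F)
    {U : Opens (TopCat.of X)} (p : (holSheaf n X).obj.obj (op U))
    (hp : ∀ (y : X) (hy : y ∈ U), y ∈ support F → evalAt hy p = 0) {x : X} (hx : x ∈ U) :
    ∃ (V : Opens (TopCat.of X)) (hV : V ≤ U) (_ : x ∈ V) (k : ℕ),
      ∀ (W : Opens (TopCat.of X)) (hW : W ≤ V) (t : F.val.obj (op W)),
        resR _ (hW.trans hV) p ^ k • t = 0 := by
  obtain ⟨U₁, hxU₁, b, s, hs⟩ := hF.1 x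
  obtain ⟨V₁, hV₁, hxV₁, m, r, hr, hr'⟩ := hF.2 U₁ b s x hxU₁
  choose δ hδ hδ' using fun σ : Fin b → Fin m ↦ exists_annihilator_of_relations
    (holSheaf_mul_comm V₁) (r := fun i ↦ r (σ i)) (s := fun j ↦ resM F hV₁ (s j))
    (fun i ↦ hr (σ i))
  let φ := chartAt (EuclideanSpace ℂ (Fin n)) x
  have hφ : φ ∈ IsManifold.maximalAtlas 𝓘(ℂ, EuclideanSpace ℂ (Fin n)) ω X :=
    IsManifold.chart_mem_maximalAtlas x
  have hxφ : x ∈ φ.source := mem_chart_source _ x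
  obtain ⟨f, hfan, hf⟩ := exists_analyticAt_of_section hφ hxφ hx p
  choose g hgan hg using fun σ ↦ exists_analyticAt_of_section hφ hxφ hxV₁ (δ σ)
  -- At a common zero of the minors δ the point lies in the support of F, so p vanishes there. A
  -- power of p is then a combination of minors, each of which annihilates the generators.
  obtain ⟨k, c, hcan, hc⟩ := nullstellensatz hgan hfan (by
    rw [eventually_nhds_chart hxφ]
    filter_upwards [φ.open_source.mem_nhds hxφ, U.isOpen.mem_nhds hx, V₁.isOpen.mem_nhds hxV₁]
      with y hyφ hyU hyV hy0
    rw [← hf y hyφ hyU]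
    refine hp y hyU (mem_support_of_det_eq_zero (s := fun j ↦ resM F hV₁ (s j)) (r := r)
      (fun W hW c hc ↦ hr' W hW c ((Finset.sum_congr rfl fun i _ ↦
        congrArg (c i • ·) (resM_resM F hV₁ hW (s i)).symm).trans hc)) hyV fun σ ↦ ?_)
    rw [← hδ', hg σ y hyφ hyV, hy0])
  rw [eventually_nhds_chart hxφ] at hc
  choose V₂ hxV₂ C hC using fun σ ↦ exists_section_of_analyticAt hφ hxφ (hcan σ)
  obtain ⟨V₃, hxV₃, hV₃⟩ := exists_common_nhd V₂ hxV₂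
  obtain ⟨V, hV, hxV, hVp⟩ := exists_opens_of_eventually (hc.and (φ.open_source.mem_nhds hxφ))
    (U := U ⊓ V₁ ⊓ V₃) ⟨⟨hx, hxV₁⟩, hxV₃⟩
  have hVU : V ≤ U := fun y hy ↦ (hV hy).1.1
  have hVV₁ : V ≤ V₁ := fun y hy ↦ (hV hy).1.2
  have hVV₃ : V ≤ V₃ := fun y hy ↦ (hV hy).2
  have hpow : resR _ hVU p ^ k = ∑ σ, resR _ (hVV₃.trans (hV₃ σ)) (C σ) * resR _ hVV₁ (δ σ) := by
    refine section_ext fun y hy ↦ ?_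
    obtain ⟨h1, hyφ⟩ := hVp y hy
    rw [map_pow, evalAt_resR, hf y hyφ, h1, map_sum]
    exact Finset.sum_congr rfl fun σ _ ↦ by rw [map_mul, evalAt_resR, evalAt_resR, hC, hg σ y hyφ]
  refine ⟨V, hVU, hxV, k, fun W hW t ↦ eq_of_locally F fun y hy ↦ ?_⟩
  obtain ⟨W', hW', hyW', a, ha⟩ := hs W (hW.trans (hVV₁.trans hV₁)) t y hy
  refine ⟨W', hW', hyW', ?_⟩
  rw [map_zero, resM_smul, ha, Finset.smul_sum]
  refine Finset.sum_eq_zero fun j _ ↦ ?_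
  have hzero : resR (holSheaf n X) hVU p ^ k • resM F (hVV₁.trans hV₁) (s j) = 0 := by
    rw [hpow, Finset.sum_smul]
    refine Finset.sum_eq_zero fun σ _ ↦ ?_
    rw [mul_smul, ← resM_resM F hV₁ hVV₁, ← resM_smul, hδ, map_zero, smul_zero]
  have h2 := congrArg (resM F (hW'.trans hW)) hzero
  rw [resM_smul, resM_resM, map_zero, map_pow, resR_resR] at h2
  rw [map_pow, resR_resR, ← mul_smul, holSheaf_mul_comm, mul_smul, h2, smul_zero]

end SheafNullstellensatz

/-! ### Ideals of the branches and the global exponent. -/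

section NormalCrossing

open Topology

variable {n : ℕ} {X : Type} [TopologicalSpace X] [ChartedSpace (EuclideanSpace ℂ (Fin n)) X]

/-- The ideal of holomorphic functions vanishing on a subset. -/
def vanishingIdeal (n : ℕ) {X : Type} [TopologicalSpace X]
    [ChartedSpace (EuclideanSpace ℂ (Fin n)) X] (Z : Set X) (U : Opens (TopCat.of X)) :
    Set ((holSheaf n X).obj.obj (op U)) :=
  {c | ∀ (y : X) (hy : y ∈ U), y ∈ Z → evalAt hy c = 0}

/-- The hypersurface defined by a coordinate has a locally principal ideal. -/
lemma isLocalGenerator_of_coordinate {φ : OpenPartialHomeomorph X (EuclideanSpace ℂ (Fin n))}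
    (hφ : φ ∈ IsManifold.maximalAtlas 𝓘(ℂ, EuclideanSpace ℂ (Fin n)) ω X) {Z : Set X} {k : Fin n}
    (hZ : ∀ y ∈ φ.source, y ∈ Z ↔ φ y k = 0) {U : Opens (TopCat.of X)}
    (hU : ∀ y ∈ U, y ∈ φ.source) {e : (holSheaf n X).obj.obj (op U)}
    (he : ∀ (y : X) (hy : y ∈ U), evalAt hy e = φ y k) : IsLocalGenerator (vanishingIdeal n Z) e := by
  intro V hV c hc y hy
  have hyφ := hU y (hV hy)
  let l : EuclideanSpace ℂ (Fin n) →L[ℂ] ℂ := EuclideanSpace.proj k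
  obtain ⟨f, hfan, hf⟩ := exists_analyticAt_of_section hφ hyφ hy c
  obtain ⟨q, hqan, hq⟩ : ∃ q, AnalyticAt ℂ q (φ y) ∧ ∀ᶠ z in 𝓝 (φ y), f z = l z * q z := by
    -- On the hypersurface the coordinate divides every function vanishing on it; off the
    -- hypersurface the coordinate is a unit.
    by_cases h0 : l (φ y) = 0
    · refine exists_eq_mul_of_vanishing l (fun hl ↦ ?_) h0 hfan ?_
      · have := congrArg (fun l ↦ l (EuclideanSpace.single k 1)) hl
        simp [l] at this
      · rw [eventually_nhds_chart hyφ]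
        filter_upwards [V.isOpen.mem_nhds hy] with y' hy' h0'
        have hy'φ := hU y' (hV hy')
        rw [← hf y' hy'φ hy']
        exact hc y' hy' ((hZ y' hy'φ).2 h0')
    · refine ⟨fun z ↦ f z / l z, hfan.div (l.analyticAt _) h0, ?_⟩
      filter_upwards [l.continuous.continuousAt.eventually_ne h0] with z hz
      rw [mul_div_cancel₀ _ hz]
  obtain ⟨V₁, hyV₁, d, hd⟩ := exists_section_of_analyticAt hφ hyφ hqan
  rw [eventually_nhds_chart hyφ] at hq
  obtain ⟨W, hW, hyW, hWp⟩ := exists_opens_of_eventually hq (U := V ⊓ V₁) ⟨hy, hyV₁⟩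
  have hWV : W ≤ V := hW.trans inf_le_left
  have hWV₁ : W ≤ V₁ := hW.trans inf_le_right
  refine ⟨W, hWV, hyW, resR _ hWV₁ d, section_ext fun z hz ↦ ?_⟩
  rw [map_mul, evalAt_resR, evalAt_resR, evalAt_resR, hd, he,
    hf z (hU z (hV (hWV hz))), hWp z hz, mul_comm]
  rfl

variable {N : ℕ} {D : Fin N → Set X}

/-- Around a point of D i the generator is the coordinate defining D i; on the open complement of D
i it is 1. -/
lemma isLocallyPrincipal_vanishingIdeal (hD : IsSimpleNormalCrossing n D) (i : Fin N) :
    IsLocallyPrincipal (vanishingIdeal n (D i)) where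
  res_mem h c hc y hy hyD := by rw [evalAt_resR]; exact hc y _ hyD
  exists_generator x := by
    by_cases hx : x ∈ D i
    · obtain ⟨φ, hφ, hxφ, k, -, hk⟩ := hD.2 x
      obtain ⟨e, he⟩ := exists_section_of_contMDiffAt (n := n)
        (U := (⟨φ.source, φ.open_source⟩ : Opens (TopCat.of X))) (f := fun y ↦ φ y (k ⟨i, hx⟩))
        fun y hy ↦ by
          have h1 := (contMDiffOn_of_mem_maximalAtlas hφ).contMDiffAt (φ.open_source.mem_nhds hy)
          exact ((EuclideanSpace.proj (𝕜 := ℂ) (k ⟨i, hx⟩)).contDiff.contMDiff.contMDiffAt).comp y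
            (h1.of_le le_top)
      exact ⟨_, hxφ, e, fun y hy hyD ↦ by rw [he, ← hk ⟨i, hx⟩ y hy]; exact hyD,
        isLocalGenerator_of_coordinate hφ (hk ⟨i, hx⟩) (fun y hy ↦ hy) he⟩
    · exact ⟨⟨(D i)ᶜ, (hD.1 i).isOpen_compl⟩, hx, 1, fun y hy hyD ↦ (hy hyD).elim,
        fun V _ c _ y hy ↦ ⟨V, le_rfl, hy, c, by rw [resR_self, map_one, mul_one]⟩⟩

/-- A coherent sheaf with support in a normal crossing divisor on a compact manifold is killed by a
product of ideals of branches. -/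
lemma exists_killedBy [CompactSpace X] [IsManifold 𝓘(ℂ, EuclideanSpace ℂ (Fin n)) ω X]
    (hD : IsSimpleNormalCrossing n D) {F : SheafOfModules.{0} (holSheaf n X)}
    (hF : IsCoherent F) (hsupp : support F ⊆ ⋃ i, D i) :
    ∃ l : List (Fin N), ∀ (U : Opens (TopCat.of X)) (s : F.val.obj (op U)),
      KilledBy (fun i ↦ vanishingIdeal n (D i)) F l U s := by
  have hJ := isLocallyPrincipal_vanishingIdeal hD
  have key : ∀ x : X, ∃ (V : Opens (TopCat.of X)) (_ : x ∈ V)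
      (e : Fin N → (holSheaf n X).obj.obj (op V)) (k : ℕ),
      (∀ i, IsLocalGenerator (vanishingIdeal n (D i)) (e i)) ∧
      ∀ (W : Opens (TopCat.of X)) (hW : W ≤ V) (t : F.val.obj (op W)),
        resR _ hW ((List.finRange N).map e).prod ^ k • t = 0 := by
    intro x
    choose U hxU e heJ he using fun i ↦ (hJ i).exists_generator x
    obtain ⟨U', hxU', hU'⟩ := exists_common_nhd U hxU
    let e' : Fin N → (holSheaf n X).obj.obj (op U') := fun i ↦ resR _ (hU' i) (e i)
    -- The product of the generators of all branch ideals vanishes on the union of the branches,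
    -- hence on the support of F.
    obtain ⟨V, hV, hxV, k, hk⟩ := exists_pow_smul_eq_zero hF ((List.finRange N).map e').prod
      (fun y hy hyF ↦ by
        obtain ⟨i, hi⟩ := Set.mem_iUnion.1 (hsupp hyF)
        rw [map_list_prod, List.prod_eq_zero_iff]
        exact List.mem_map.2 ⟨e' i, List.mem_map.2 ⟨i, List.mem_finRange i, rfl⟩,
          (hJ i).res_mem (hU' i) _ (heJ i) y hy hi⟩) hxU'
    refine ⟨V, hxV, fun i ↦ resR _ hV (e' i), k, fun i ↦ ((he i).res (hU' i)).res hV,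
      fun W hW t ↦ ?_⟩
    rw [← hk W hW t, ← resR_resR hV hW, map_list_prod (resR _ hV), List.map_map]
    rfl
  choose V hxV e k he hk using key
  obtain ⟨T, hT⟩ := CompactSpace.elim_nhds_subcover (fun x ↦ (V x : Set X))
    fun x ↦ (V x).isOpen.mem_nhds (hxV x)
  -- The list of all branches is repeated as often as the largest exponent in a finite subcover
  -- requires.
  refine ⟨(List.replicate (T.sup k) (List.finRange N)).flatten, fun U s ↦
    KilledBy.of_locally hJ _ fun y hy ↦ ?_⟩
  obtain ⟨x, hxT, hyx⟩ := Set.mem_iUnion₂.1 (hT.ge (Set.mem_univ y))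
  refine ⟨V x ⊓ U, inf_le_right, ⟨hyx, hy⟩,
    KilledBy.of_prod_smul_eq_zero hJ holSheaf_mul_comm _ (he x) inf_le_left ?_⟩
  rw [List.map_flatten, List.prod_flatten, List.map_replicate, List.map_replicate,
    List.prod_replicate, map_pow, ← Nat.sub_add_cancel (Finset.le_sup (f := k) hxT), pow_add,
    mul_smul, hk x, smul_zero]

end NormalCrossing

end AnalyticK

end


theorem mainTheorem6 (n : ℕ) (X : Type) [TopologicalSpace X] [T2Space X] [CompactSpace X]
    [ChartedSpace (EuclideanSpace ℂ (Fin n)) X]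
    [IsManifold 𝓘(ℂ, EuclideanSpace ℂ (Fin n)) ω X]
    (N : ℕ) (D : Fin N → Set X) (hD : AnalyticK.IsSimpleNormalCrossing n D) :
    Function.Exact (AnalyticK.pairsToBranches n D) (AnalyticK.branchesToDivisor n D) ∧
      Function.Surjective (AnalyticK.branchesToDivisor n D) := by
  -- The maps of the statement are by definition `pairsMap` and `branchesMap` for the support theory
  -- of coherent sheaves.
  refine AnalyticK.exact_of_devissage (AnalyticK.isSupportTheory (AnalyticK.holSheaf n X)) D
    fun F hF ↦ ?_
  obtain ⟨l, hl⟩ := AnalyticK.exists_killedBy hD hF.1 hF.2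
  refine AnalyticK.exists_dev AnalyticK.holSheaf_mul_comm
    (AnalyticK.isLocallyPrincipal_vanishingIdeal hD) (fun i x hx ↦ ?_) _ l hF.1 hl
  exact ⟨⟨(D i)ᶜ, (hD.1 i).isOpen_compl⟩, hx, fun y hy hyD ↦ (hy hyD).elim⟩
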